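/- Let $p,q\ge 1$ be integers with $p+q\ge 3$. Let $E=\mathbb C^{p+q}$ with the hermitian form $h(z,w)=\sum_{j\le p}z_j\overline{w_j}-\sum_{j>p}z_j\overline{w_j}$ and the conjugation $\tau(z)=\overline z$, and let $\mathfrak g=\mathfrak{su}(p,q)$ be the real Lie algebra of all trace-free endomorphisms $\xi$ of $E$ with $\operatorname{Re}h(\xi z,z)=0$ for all $z\in E$. Put $\mathfrak g^{-\tau}=\{\xi\in\mathfrak g:\tau\xi\tau=-\xi\}$ and let $G$ be the group of all $g\in\mathrm{SL}(E)$ such that $h(gz,gz)=\epsilon\, h(z,z)$ for all $z\in E$, with a sign $\epsilon=\pm1$ depending only on $g$; those $g\in G$ with $\epsilon=1$ form $\mathrm{SU}(p,q)$. A *qualifying MASA* is a maximal abelian subalgebra $\mathfrak v$ of $\mathfrak g$ such that $g\mathfrak v g^{-1}\subset\mathfrak g^{-\tau}$ for some $g\in G$. Its *toral part* $\mathfrak v^{\mathrm{red}}$ is the set of all elements of $\mathfrak v$ that are semisimple as endomorphisms of $E$. Let $\mathbf K=\{(s,t)\in\mathbb N^2: st=0\Rightarrow s+t=1\}$ (with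 $0\in\mathbb N$), let $\mathbf L=\{\mathbf 1,\mathbf 2,\mathbf 3,\dots\}$ be a copy of the positive integers, disjoint from $\mathbf K$, and let $\mathcal D$ be the free commutative monoid over $\mathbf K\sqcup\mathbf L$. Let $\mathcal D_{p,q}\subset\mathcal D$ be the set of all $D=\sum_{(s,t)\in\mathbf K}n_{(s,t)}\cdot(s,t)+\sum_{\mathbf j\in\mathbf L}n_{\mathbf j}\cdot\mathbf j$ with $$p=\sum_{(s,t)\in\mathbf K}n_{(s,t)}s+\sum_{\mathbf j\in\mathbf L}n_{\mathbf j}\,j,\qquad q=\sum_{(s,t)\in\mathbf K}n_{(s,t)}t+\sum_{\mathbf j\in\mathbf L}n_{\mathbf j}\,j .$$ The *$D$-invariant* of a qualifying MASA $\mathfrak v$ is defined as follows. Replace $\mathfrak v$ by a conjugate $g\mathfrak vg^{-1}\subset\mathfrak g^{-\tau}$ with $g\in\mathrm{SU}(p,q)$. Then $\tau$ permutes the (nonzero) joint eigenspaces of $\mathfrak v^{\mathrm{red}}$ in $E$. Let $\mathcal K$ be the set of those that are $\tau$-stable, and let $\mathcal L$ contain exactly one member of every pair $\{W,\tau W\}$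 of joint eigenspaces with $\tau W\ne W$. Then $$D(\mathfrak v)=\sum_{W\in\mathcal K}1\cdot(p_W,q_W)+\sum_{W\in\mathcal L}1\cdot\mathbf{m}_W\in\mathcal D,$$ where $(p_W,q_W)$ is the type of the (non-degenerate) restriction of $h$ to $W$ and $m_W=\dim_{\mathbb C} W$. Then: 1. every qualifying MASA in $\mathfrak{su}(p,q)$ has exactly one $D$-invariant $D(\mathfrak v)\in\mathcal D$, that is, the above construction is possible and its result does not depend on the choices made; 2. an element $D\in\mathcal D$ is the $D$-invariant of some qualifying MASA in $\mathfrak{su}(p,q)$ if and only if $D\in\mathcal D_{p,q}$; 3. there are only finitely many $\mathrm{SU}(p,q)$-conjugacy classes of centralizers $C_{\mathfrak g}(\mathfrak v^{\mathrm{red}})=\{x\in\mathfrak g:[x,y]=0\text{ for all }y\in\mathfrak v^{\mathrm{red}}\}$, where $\mathfrak v$ runs through all qualifying MASAs in $\mathfrak{su}(p,q)$. -/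

import Mathlib

attribute [local instance 100] LieRing.ofAssociativeRing

namespace SUpq

open Matrix

/-- The index set of the standard basis of the space `E = ℂ^(p+q)`:
the first `p` vectors are positive, the last `q` ones are negative. -/
abbrev Idx (p q : ℕ) : Type := Fin p ⊕ Fin q

/-- The complex vector space `E` with its standard basis. -/
abbrev E (p q : ℕ) : Type := Idx p q → ℂ

/-- Endomorphisms of `E`, as matrices with respect to the standard basis. -/
abbrev Mat (p q : ℕ) : Type := Matrix (Idx p q) (Idx p q) ℂ

/-- The diagonal matrix with `p` entries `1` followed by `q` entries `-1`. -/
def signMat (p q : ℕ) : Mat p q :=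
  Matrix.diagonal (Sum.elim (fun _ => 1) (fun _ => -1))

/-- The standard hermitian form of type `(p, q)` on `E`, linear in the first variable and
antilinear in the second one: `h z w = ∑ i, ± z i * conj (w i)`. -/
def herm (p q : ℕ) (z w : E p q) : ℂ := star w ⬝ᵥ (signMat p q *ᵥ z)

/-- The conjugation of `E`, taking complex conjugates of all coordinates. -/
def tau (p q : ℕ) : E p q →ₛₗ[starRingEnd ℂ] E p q where
  toFun z := star z
  map_add' := star_add
  map_smul' c z := by rw [star_smul]; rfl

/-- The real Lie algebra `su(p, q)`: trace-free matrices that are skew-adjoint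
with respect to `herm p q`. -/
def su (p q : ℕ) : LieSubalgebra ℝ (Mat p q) where
  carrier := {x | x.trace = 0 ∧ ∀ z w : E p q, herm p q (x *ᵥ z) w + herm p q z (x *ᵥ w) = 0}
  zero_mem' := by simp [herm]
  add_mem' := by
    rintro x y ⟨hx, hx'⟩ ⟨hy, hy'⟩
    refine ⟨by simp [hx, hy], fun z w => ?_⟩
    have h1 := hx' z w
    have h2 := hy' z w
    simp only [herm, Matrix.add_mulVec, Matrix.mulVec_add, dotProduct_add, star_add,
      add_dotProduct] at h1 h2 ⊢
    linear_combination h1 + h2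
  smul_mem' := by
    rintro c x ⟨hx, hx'⟩
    refine ⟨by simp [Matrix.trace_smul, hx], fun z w => ?_⟩
    have h1 := hx' z w
    simp only [herm, Matrix.smul_mulVec, Matrix.mulVec_smul, dotProduct_smul, star_smul,
      smul_dotProduct, star_trivial, ← smul_add] at h1 ⊢
    rw [h1, smul_zero]
  lie_mem' := by
    rintro x y ⟨hx, hx'⟩ ⟨hy, hy'⟩
    refine ⟨by rw [Ring.lie_def, Matrix.trace_sub, Matrix.trace_mul_comm, sub_self],
      fun z w => ?_⟩
    have h1 := hx' (y *ᵥ z) w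
    have h2 := hx' z (y *ᵥ w)
    have h3 := hy' (x *ᵥ z) w
    have h4 := hy' z (x *ᵥ w)
    simp only [Ring.lie_def, herm, Matrix.sub_mulVec, ← Matrix.mulVec_mulVec, Matrix.mulVec_sub,
      dotProduct_sub, star_sub, sub_dotProduct] at h1 h2 h3 h4 ⊢
    linear_combination h1 + h2 - h3 - h4

/-- `su(p, q)` consists of the trace-free matrices with `Re h(x z, z) = 0` for all `z`. -/
theorem mem_su_iff_re (p q : ℕ) (x : Mat p q) :
    x ∈ su p q ↔ x.trace = 0 ∧ ∀ z : E p q, (herm p q (x *ᵥ z) z).re = 0 := by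
  have hs : ∀ a b : E p q, herm p q b a = star (herm p q a b) := by
    intro a b
    simp only [herm, signMat, dotProduct, Matrix.mulVec_diagonal, star_sum]
    refine Finset.sum_congr rfl fun i _ => ?_
    rcases i with i | i <;> simp <;> ring
  have hadd : ∀ a b c d : E p q, herm p q (a + b) (c + d) =
      herm p q a c + herm p q a d + herm p q b c + herm p q b d := by
    intro a b c d
    simp only [herm, Matrix.mulVec_add, dotProduct_add, star_add, add_dotProduct]
    ring
  have hsm : ∀ (c : ℂ) (a b : E p q), herm p q (c • a) b = c * herm p q a b := by
    intro c a b
    simp [herm, Matrix.mulVec_smul, dotProduct_smul]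
  have hsm2 : ∀ (c : ℂ) (a b : E p q), herm p q a (c • b) = star c * herm p q a b := by
    intro c a b
    simp [herm, star_smul, smul_dotProduct]
  constructor
  · rintro ⟨h0, h⟩
    refine ⟨h0, fun z => ?_⟩
    have h1 := congrArg Complex.re (h z z)
    rw [hs (x *ᵥ z) z] at h1
    simp at h1
    linarith
  · rintro ⟨h0, h⟩
    refine ⟨h0, fun z w => ?_⟩
    have a1 := h z
    have a2 := h w
    have a3 := h (z + w)
    have a4 := h (z + Complex.I • w)
    rw [Matrix.mulVec_add, hadd] at a3 a4
    rw [Matrix.mulVec_smul, hsm, hsm, hsm2, hsm2] at a4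
    have e := hs (x *ᵥ w) z
    rw [e]
    apply Complex.ext
    · simp at a1 a2 a3 ⊢
      linarith
    · simp at a1 a2 a4 ⊢
      linarith

/-- The `(-1)`-eigenspace of the involution of `su(p, q)` induced by the conjugation `tau`:
since `(τ x τ) z = conj (x *ᵥ conj z)`, the involution conjugates all matrix entries. -/
def suMinus (p q : ℕ) : Set (Mat p q) :=
  {x | x ∈ su p q ∧ ∀ z : E p q, tau p q (x *ᵥ tau p q z) = -(x *ᵥ z)}

/-- The special linear group of `E`. -/
abbrev SL (p q : ℕ) : Type := Matrix.SpecialLinearGroup (Idx p q) ℂ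

/-- The group `G` of all `g ∈ SL(E)` that preserve the form up to a sign. -/
def groupG (p q : ℕ) : Set (SL p q) :=
  {g | (∀ z : E p q, herm p q (g.1 *ᵥ z) (g.1 *ᵥ z) = herm p q z z) ∨
       (∀ z : E p q, herm p q (g.1 *ᵥ z) (g.1 *ᵥ z) = -herm p q z z)}

/-- The group `SU(p, q)`. -/
def groupSU (p q : ℕ) : Set (SL p q) :=
  {g | ∀ z : E p q, herm p q (g.1 *ᵥ z) (g.1 *ᵥ z) = herm p q z z}

/-- The adjoint action `x ↦ g x g⁻¹` as a homomorphism of real Lie algebras. -/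
def Ad {p q : ℕ} (g : SL p q) : Mat p q →ₗ⁅ℝ⁆ Mat p q where
  toFun x := g.1 * x * (g⁻¹).1
  map_add' x y := by rw [mul_add, add_mul]
  map_smul' c x := by simp
  map_lie' := by
    intro x y
    have h : (g⁻¹).1 * g.1 = 1 := congrArg Subtype.val (inv_mul_cancel g)
    simp only [Ring.lie_def, mul_sub, sub_mul]
    have e : ∀ a b : Mat p q,
        g.1 * (a * b) * (g⁻¹).1 = g.1 * a * (g⁻¹).1 * (g.1 * b * (g⁻¹).1) := by
      intro a b
      calc g.1 * (a * b) * (g⁻¹).1 = g.1 * a * 1 * b * (g⁻¹).1 := by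
            simp only [mul_one, mul_assoc]
        _ = _ := by rw [← h]; simp only [mul_assoc]
    rw [e x y, e y x]

/-- Maximal abelian subalgebras (MASAs) of `su(p, q)`. -/
def IsMASA (p q : ℕ) (v : LieSubalgebra ℝ (Mat p q)) : Prop :=
  Maximal (fun a : LieSubalgebra ℝ (Mat p q) => a ≤ su p q ∧ IsLieAbelian a) v

/-- Qualifying MASAs: those that are conjugate under `G` to a subalgebra of the
`(-1)`-eigenspace of the involution. -/
def IsQualifyingMASA (p q : ℕ) (v : LieSubalgebra ℝ (Mat p q)) : Prop :=
  IsMASA p q v ∧ ∃ g ∈ groupG p q, (v.map (Ad g) : Set (Mat p q)) ⊆ suMinus p q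

/-- The toral part of `v`: the elements of `v` that are semisimple endomorphisms of `E`. -/
def toralPart {p q : ℕ} (v : LieSubalgebra ℝ (Mat p q)) : Set (Mat p q) :=
  {x | x ∈ v ∧ Module.End.IsSemisimple (Matrix.toLin' x)}

/-- The centralizer of a set of matrices in `su(p, q)`. -/
def centralizerSU (p q : ℕ) (S : Set (Mat p q)) : LieSubalgebra ℝ (Mat p q) where
  carrier := {x | x ∈ su p q ∧ ∀ y ∈ S, ⁅x, y⁆ = 0}
  zero_mem' := ⟨zero_mem _, fun y _ => zero_lie y⟩
  add_mem' := by
    rintro a b ⟨ha, ha'⟩ ⟨hb, hb'⟩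
    exact ⟨add_mem ha hb, fun y hy => by rw [add_lie, ha' y hy, hb' y hy, add_zero]⟩
  smul_mem' := by
    rintro c a ⟨ha, ha'⟩
    exact ⟨(su p q).smul_mem c ha, fun y hy => by rw [smul_lie, ha' y hy, smul_zero]⟩
  lie_mem' := by
    rintro a b ⟨ha, ha'⟩ ⟨hb, hb'⟩
    exact ⟨(su p q).lie_mem ha hb,
      fun y hy => by rw [lie_lie, ha' y hy, hb' y hy, lie_zero, lie_zero, sub_zero]⟩

/-- The conjugacy class of a subalgebra under `SU(p, q)`. -/
def conjClassSU {p q : ℕ} (c : LieSubalgebra ℝ (Mat p q)) : Set (LieSubalgebra ℝ (Mat p q)) :=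
  {d | ∃ g ∈ groupSU p q, d = c.map (Ad g)}

/-- The nonzero joint eigenspaces in `E` of a set of matrices. -/
def jointEigenspaces {p q : ℕ} (S : Set (Mat p q)) : Set (Submodule ℂ (E p q)) :=
  {W | W ≠ ⊥ ∧ ∃ γ : Mat p q → ℂ, W = ⨅ x ∈ S, Module.End.eigenspace (Matrix.toLin' x) (γ x)}

/-- The restriction of the form to `W` is (non-degenerate and) of type `(s, t)`. -/
def HasType {p q : ℕ} (W : Submodule ℂ (E p q)) (s t : ℕ) : Prop :=
  ∃ b : Module.Basis (Fin s ⊕ Fin t) ℂ W,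
    ∀ i j, herm p q (b i : E p q) (b j : E p q) = signMat s t i j

/-- The set `K` of all pairs `(s, t)` of natural numbers such that `s t = 0` implies
`s + t = 1`. -/
abbrev KSet : Type := {st : ℕ × ℕ // st.1 * st.2 = 0 → st.1 + st.2 = 1}

/-- The disjoint union of `K` and of the set `L` of positive natural numbers. -/
abbrev JSet : Type := KSet ⊕ ℕ+

/-- The free commutative monoid over `JSet`. -/
abbrev DMonoid : Type := JSet →₀ ℕ

/-- The contribution of a generator to the type: `(s, t)` for `(s, t) ∈ K`, and `(j, j)`
for `j ∈ L`. -/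
def JSet.weight : JSet → ℕ × ℕ
  | Sum.inl st => st.1
  | Sum.inr j => (j, j)

/-- The set `D_{p,q}` of all elements of the monoid with total type `(p, q)`. -/
def DSet (p q : ℕ) : Set DMonoid :=
  {D | p = D.sum (fun j n => n * j.weight.1) ∧ q = D.sum (fun j n => n * j.weight.2)}

/-- `D` is the `D`-invariant of `v`. After conjugation by an element of `SU(p, q)` that brings
`v` into the `(-1)`-eigenspace of the involution, let the joint eigenspaces of the toral part
be partitioned into the set `K` of the `tau`-stable ones and the sets `L` and `tau(L)`;
then `D` is the sum of the types of the form on the members of `K` and of the dimensions of the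
members of `L`. -/
def IsDInvariant {p q : ℕ} (v : LieSubalgebra ℝ (Mat p q)) (D : DMonoid) : Prop :=
  ∃ g ∈ groupSU p q, (v.map (Ad g) : Set (Mat p q)) ⊆ suMinus p q ∧
  ∃ K L : Finset (Submodule ℂ (E p q)),
    (∀ W, W ∈ jointEigenspaces (toralPart (v.map (Ad g))) ↔
      W ∈ K ∨ W ∈ L ∨ W.map (tau p q) ∈ L) ∧
    (∀ W ∈ K, W.map (tau p q) = W) ∧
    (∀ W ∈ L, W.map (tau p q) ∉ L) ∧
    ∃ (κ : Submodule ℂ (E p q) → KSet) (d : Submodule ℂ (E p q) → ℕ+),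
      (∀ W ∈ K, HasType W (κ W).1.1 (κ W).1.2) ∧
      (∀ W ∈ L, Module.finrank ℂ W = d W) ∧
      D = ∑ W ∈ K, Finsupp.single (Sum.inl (κ W)) 1 + ∑ W ∈ L, Finsupp.single (Sum.inr (d W)) 1

end SUpq

namespace SUpq

open Matrix

variable {p q : ℕ}

/-! ### The hermitian form -/

/-! The toral part of a MASA is a commuting family of semisimple operators, so `E` is the direct sum
of its joint eigenspaces. If the family lies in `suMinus`, then `tau` sends the eigenspace of weight
`χ` to the one of weight `-conj χ`, and skewness makes the weight spaces of `χ` and `χ'` orthogonal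
unless `χ' = -conj χ`. Hence the form pairs each `W` perfectly with `tau W`: `tau`-stable joint
eigenspaces are non-degenerate, all others are isotropic.

Well-definedness: the coefficients of `D` are therefore the numbers of joint eigenspaces of each
type and half the numbers of isotropic ones of each dimension (`IsDSum.count`). These do not mention
`tau` and are invariant under `SU(p, q)`. A definite `W` contains an anisotropic joint eigenvector
`b` of the MASA. The trace-free part of `z ↦ i h(z, b) b` commutes with the MASA, hence lies in its
toral part, and forces `W` to be the line of `b`; so types lie in `KSet`
(`finrank_eq_one_of_anisotropic`). An element of `G` with sign `-1` exists only for `p = q` and is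
corrected by the swap of coordinates (`IsQualifyingMASA.exists_groupSU`).

The condition `D ∈ DSet p q` is necessary because `E` is the orthogonal sum of the `tau`-stable `W`
and of the sums `W ⊔ tau W`, the latter of type `(m, m)` (`IsDSum.mem_DSet`). It is sufficient by a
construction: on a commutative Frobenius algebra with conjugation, whose form `φ(a * conj b)` is of
type `(p, q)`, the trace-free multiplications by skew elements form a qualifying MASA, since a
commutative algebra is its own commutant (`isMASA_masa`). Its joint eigenspaces are the local
factors (`Blocks.jointEigenspaces_eq`). A factor of type `(s, t)` with `s, t ≥ 1` is `QuadAlg`; a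
generator from `L` is realized by `B × B` with exchanging conjugation (`pair`).

Finiteness: the centralizer of the toral part consists of the elements of `su(p, q)` preserving all
joint eigenspaces. These have an adapted basis with Gram entries in `{0, 1, -1}`. The Gram matrix
and the partition of the basis are finitely many data, and they determine the system of joint
eigenspaces up to `SU(p, q)` (`IsAdapted.exists_groupSU`). -/

theorem herm_add_left (a b c : E p q) : herm p q (a + b) c = herm p q a c + herm p q b c := by
  simp [herm, Matrix.mulVec_add, dotProduct_add]

theorem herm_add_right (a b c : E p q) : herm p q a (b + c) = herm p q a b + herm p q a c := by
  simp [herm, add_dotProduct]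

theorem herm_smul_left (r : ℂ) (a b : E p q) : herm p q (r • a) b = r * herm p q a b := by
  simp [herm, Matrix.mulVec_smul, dotProduct_smul]

theorem herm_smul_right (r : ℂ) (a b : E p q) :
    herm p q a (r • b) = star r * herm p q a b := by
  simp [herm, star_smul, smul_dotProduct]

theorem herm_zero_left (a : E p q) : herm p q 0 a = 0 := by simp [herm]

theorem herm_zero_right (a : E p q) : herm p q a 0 = 0 := by simp [herm]

theorem herm_neg_left (a b : E p q) : herm p q (-a) b = -herm p q a b := by
  rw [← neg_one_smul ℂ, herm_smul_left]; ring

theorem herm_neg_right (a b : E p q) : herm p q a (-b) = -herm p q a b := by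
  rw [← neg_one_smul ℂ, herm_smul_right]; simp

theorem herm_sub_left (a b c : E p q) : herm p q (a - b) c = herm p q a c - herm p q b c := by
  rw [sub_eq_add_neg, herm_add_left, herm_neg_left, sub_eq_add_neg]

theorem herm_sub_right (a b c : E p q) : herm p q a (b - c) = herm p q a b - herm p q a c := by
  rw [sub_eq_add_neg, herm_add_right, herm_neg_right, sub_eq_add_neg]

theorem herm_sum_left {ι : Type*} (s : Finset ι) (f : ι → E p q) (b : E p q) :
    herm p q (∑ i ∈ s, f i) b = ∑ i ∈ s, herm p q (f i) b := by
  classical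
  induction s using Finset.induction_on with
  | empty => simp [herm_zero_left]
  | insert a s ha ih => rw [Finset.sum_insert ha, Finset.sum_insert ha, herm_add_left, ih]

theorem herm_sum_right {ι : Type*} (s : Finset ι) (a : E p q) (f : ι → E p q) :
    herm p q a (∑ i ∈ s, f i) = ∑ i ∈ s, herm p q a (f i) := by
  classical
  induction s using Finset.induction_on with
  | empty => simp [herm_zero_right]
  | insert x s hx ih => rw [Finset.sum_insert hx, Finset.sum_insert hx, herm_add_right, ih]

theorem herm_apply (z w : E p q) : herm p q z w =
    ∑ i, z (Sum.inl i) * star (w (Sum.inl i)) - ∑ j, z (Sum.inr j) * star (w (Sum.inr j)) := by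
  simp only [herm, signMat, dotProduct, mulVec_diagonal, Fintype.sum_sum_type, Pi.star_apply,
    Sum.elim_inl, Sum.elim_inr, one_mul, neg_mul, mul_neg, Finset.sum_neg_distrib, sub_eq_add_neg]
  simp only [mul_comm]

theorem herm_symm (a b : E p q) : herm p q b a = star (herm p q a b) := by
  simp only [herm_apply, star_sub, star_sum, star_mul', star_star]
  simp only [mul_comm]

theorem herm_eq_zero_symm {a b : E p q} (h : herm p q a b = 0) : herm p q b a = 0 := by
  rw [herm_symm, h, star_zero]

theorem herm_single_right (z : E p q) (i : Idx p q) :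
    herm p q z (Pi.single i 1) = signMat p q i i * z i := by
  have h : star (Pi.single i (1 : ℂ) : E p q) = Pi.single i 1 := by
    ext j
    by_cases hj : j = i
    · subst hj; simp
    · simp [hj]
  simp [herm, h, signMat, mulVec_diagonal]

theorem signMat_apply_self_ne_zero (i : Idx p q) : signMat p q i i ≠ 0 := by
  rcases i with i | i <;> simp [signMat]

theorem herm_basis (i j : Idx p q) :
    herm p q (Pi.single i 1) (Pi.single j 1) = signMat p q i j := by
  rw [herm_single_right]
  by_cases h : i = j
  · subst h; simp
  · rw [Pi.single_eq_of_ne (Ne.symm h), mul_zero, signMat, diagonal_apply_ne _ h]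

theorem eq_zero_of_herm_eq_zero {z : E p q} (h : ∀ w, herm p q z w = 0) : z = 0 := by
  ext i
  have := h (Pi.single i 1)
  rw [herm_single_right] at this
  simpa [signMat_apply_self_ne_zero] using this

theorem tau_apply (z : E p q) : tau p q z = star z := rfl

theorem tau_tau (z : E p q) : tau p q (tau p q z) = z := by simp [tau_apply]

theorem tau_smul (c : ℂ) (z : E p q) : tau p q (c • z) = star c • tau p q z := by
  simp [tau_apply]

/-! ### Families with diagonal Gram matrix -/

theorem herm_sum_smul {κ : Type*} [Fintype κ] [DecidableEq κ] {u : κ → E p q} {ε : κ → ℂ}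
    (h : ∀ i j, herm p q (u i) (u j) = if i = j then ε i else 0) (a : κ → ℂ) (j : κ) :
    herm p q (∑ i, a i • u i) (u j) = a j * ε j := by
  rw [herm_sum_left, Finset.sum_eq_single j]
  · rw [herm_smul_left, h, if_pos rfl]
  · intro i _ hi
    rw [herm_smul_left, h, if_neg hi, mul_zero]
  · simp

theorem linearIndependent_of_gram {κ : Type*} [Fintype κ] [DecidableEq κ] {u : κ → E p q}
    {ε : κ → ℂ} (hε : ∀ i, ε i ≠ 0)
    (h : ∀ i j, herm p q (u i) (u j) = if i = j then ε i else 0) : LinearIndependent ℂ u := by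
  rw [Fintype.linearIndependent_iff]
  intro a ha j
  have := herm_sum_smul h a j
  rw [ha, herm_zero_left] at this
  simpa [hε] using this.symm

/-- Projection to the positive coordinates is injective on the span: on a vector of its kernel the
form is `≤ 0`, while the Gram matrix gives `∑ |a i|²`. -/
theorem card_le_of_gram_pos {κ : Type*} [Fintype κ] [DecidableEq κ] {u : κ → E p q}
    (h : ∀ i j, herm p q (u i) (u j) = if i = j then 1 else 0) : Fintype.card κ ≤ p := by
  have hli : LinearIndependent ℂ fun k (i : Fin p) => u k (Sum.inl i) := by
    rw [Fintype.linearIndependent_iff]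
    intro a ha j
    set z : E p q := ∑ i, a i • u i with hz
    have hz0 : ∀ i, z (Sum.inl i) = 0 := by
      intro i
      have := congrFun ha i
      simpa [hz, Finset.sum_apply] using this
    have h1 : herm p q z z = ∑ i, (a i) * star (a i) := by
      conv_lhs => rw [hz, herm_sum_left]
      refine Finset.sum_congr rfl fun i _ => ?_
      rw [herm_smul_left, herm_symm, herm_sum_smul h]
      simp
    have h2 : (herm p q z z).re ≤ 0 := by
      rw [herm_apply]
      simp only [hz0, zero_mul, Finset.sum_const_zero, zero_sub, Complex.neg_re, Complex.re_sum]
      rw [neg_nonpos]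
      refine Finset.sum_nonneg fun i _ => ?_
      rw [Complex.star_def, Complex.mul_conj]
      exact Complex.normSq_nonneg _
    rw [h1] at h2
    simp only [Complex.star_def, Complex.mul_conj, Complex.re_sum, Complex.ofReal_re] at h2
    have h3 := (Finset.sum_eq_zero_iff_of_nonneg
      (fun i _ => Complex.normSq_nonneg (a i))).1 (le_antisymm h2
        (Finset.sum_nonneg fun i _ => Complex.normSq_nonneg (a i))) j (Finset.mem_univ _)
    exact Complex.normSq_eq_zero.1 h3
  simpa using hli.fintype_card_le_finrank

/-- Exchanging the positive and the negative coordinates. -/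
theorem herm_comp_swap (z w : E p q) :
    herm q p (z ∘ Sum.swap) (w ∘ Sum.swap) = -herm p q z w := by
  simp [herm_apply]

theorem card_le_of_gram_neg {κ : Type*} [Fintype κ] [DecidableEq κ] {u : κ → E p q}
    (h : ∀ i j, herm p q (u i) (u j) = if i = j then -1 else 0) : Fintype.card κ ≤ q := by
  refine card_le_of_gram_pos (p := q) (q := p) (u := fun i => u i ∘ Sum.swap) fun i j => ?_
  rw [herm_comp_swap, h]
  split_ifs <;> simp

/-! ### The type of the form on a subspace -/

theorem signMat_eq_ite {s t : ℕ} (i j : Fin s ⊕ Fin t) :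
    signMat s t i j = if i = j then signMat s t i i else 0 := by
  by_cases h : i = j
  · subst h; simp
  · rw [if_neg h, signMat, diagonal_apply_ne _ h]

theorem HasType.finrank_eq {W : Submodule ℂ (E p q)} {s t : ℕ} (h : HasType W s t) :
    Module.finrank ℂ W = s + t := by
  obtain ⟨b, -⟩ := h
  simp [Module.finrank_eq_card_basis b]

theorem coe_eq_sum_basis {W : Submodule ℂ (E p q)} {κ : Type*} [Fintype κ]
    (b : Module.Basis κ ℂ W) (x : W) : (x : E p q) = ∑ i, b.equivFun x i • (b i : E p q) := by
  simpa only [AddSubmonoidClass.coe_finsetSum, Submodule.coe_smul] using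
    (congrArg Subtype.val (b.sum_equivFun x)).symm

theorem herm_basis_sum {W : Submodule ℂ (E p q)} {s t : ℕ}
    {b : Module.Basis (Fin s ⊕ Fin t) ℂ W}
    (hb : ∀ i j, herm p q (b i : E p q) (b j : E p q) = signMat s t i j) (x y : W) :
    herm p q (x : E p q) (y : E p q) = herm s t (b.equivFun x) (b.equivFun y) := by
  have hx := coe_eq_sum_basis b x
  have hy := coe_eq_sum_basis b y
  have hg : ∀ i j, herm p q (b i : E p q) (b j : E p q) =
      if i = j then signMat s t i i else 0 := fun i j => by rw [hb, signMat_eq_ite]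
  conv_lhs => rw [hy, herm_sum_right]
  simp only [herm_smul_right, hx, herm_sum_smul hg]
  rw [herm_apply, Fintype.sum_sum_type]
  simp [signMat, mul_comm, sub_eq_add_neg]

/-- Coordinates identify `W` isometrically with `E s t`, where the bounds are known. This yields
Sylvester's law of inertia in `HasType.unique`. -/
theorem HasType.card_le {W : Submodule ℂ (E p q)} {s t : ℕ} (h : HasType W s t)
    {κ : Type*} [Fintype κ] [DecidableEq κ] {u : κ → E p q} (hu : ∀ i, u i ∈ W) :
    ((∀ i j, herm p q (u i) (u j) = if i = j then 1 else 0) → Fintype.card κ ≤ s) ∧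
    ((∀ i j, herm p q (u i) (u j) = if i = j then -1 else 0) → Fintype.card κ ≤ t) := by
  obtain ⟨b, hb⟩ := h
  have key : ∀ i j, herm s t (b.equivFun ⟨u i, hu i⟩) (b.equivFun ⟨u j, hu j⟩) =
      herm p q (u i) (u j) := fun i j => (herm_basis_sum hb ⟨u i, hu i⟩ ⟨u j, hu j⟩).symm
  exact ⟨fun h => card_le_of_gram_pos (fun i j => (key i j).trans (h i j)),
    fun h => card_le_of_gram_neg (fun i j => (key i j).trans (h i j))⟩

theorem HasType.unique {W : Submodule ℂ (E p q)} {s t s' t' : ℕ} (h : HasType W s t)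
    (h' : HasType W s' t') : s = s' ∧ t = t' := by
  have key : ∀ {s t s' t' : ℕ}, HasType W s t → HasType W s' t' → s' ≤ s ∧ t' ≤ t := by
    intro s t s' t' h ⟨b, hb⟩
    constructor
    · simpa using (h.card_le (u := fun i : Fin s' => (b (Sum.inl i) : E p q))
        (fun i => (b _).2)).1 (fun i j => by rw [hb, signMat, diagonal_apply]; simp)
    · simpa using (h.card_le (u := fun i : Fin t' => (b (Sum.inr i) : E p q))
        (fun i => (b _).2)).2 (fun i j => by rw [hb, signMat, diagonal_apply]; simp)
  obtain ⟨h1, h2⟩ := key h h'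
  obtain ⟨h3, h4⟩ := key h' h
  exact ⟨le_antisymm h3 h1, le_antisymm h4 h2⟩

theorem HasType.of_family {W : Submodule ℂ (E p q)} {s t : ℕ} (u : Fin s ⊕ Fin t → E p q)
    (hu : ∀ i, u i ∈ W) (h : ∀ i j, herm p q (u i) (u j) = signMat s t i j)
    (hc : Module.finrank ℂ W = s + t) : HasType W s t := by
  have hli : LinearIndependent ℂ u := linearIndependent_of_gram (ε := fun i => signMat s t i i)
    signMat_apply_self_ne_zero fun i j => by rw [h, signMat_eq_ite]
  have hli' : LinearIndependent ℂ (fun i => (⟨u i, hu i⟩ : W)) :=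
    LinearIndependent.of_comp W.subtype hli
  rcases isEmpty_or_nonempty (Fin s ⊕ Fin t) with he | he
  · have h0 : s + t = 0 := by
      rw [← Fintype.card_fin s, ← Fintype.card_fin t, ← Fintype.card_sum]
      exact Fintype.card_eq_zero
    have : Subsingleton W := Module.finrank_zero_iff.1 (hc.trans h0)
    exact ⟨Module.Basis.empty W, fun i => isEmptyElim i⟩
  · refine ⟨basisOfLinearIndependentOfCardEqFinrank hli' (by simp [hc]), fun i j => ?_⟩
    simp [h]

theorem HasType.of_signs {W : Submodule ℂ (E p q)} {κ : Type*} [Fintype κ] [DecidableEq κ]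
    (u : κ → E p q) (hu : ∀ i, u i ∈ W) (P : κ → Prop) [DecidablePred P]
    (h : ∀ i j, herm p q (u i) (u j) = if i = j then (if P i then 1 else -1) else 0)
    (hc : Module.finrank ℂ W = Fintype.card κ) :
    HasType W (Fintype.card {i // P i}) (Fintype.card {i // ¬ P i}) := by
  let f : Fin (Fintype.card {i // P i}) ⊕ Fin (Fintype.card {i // ¬ P i}) ≃ κ :=
    (Equiv.sumCongr (Fintype.equivFin _).symm (Fintype.equivFin _).symm).trans (Equiv.sumCompl P)
  refine HasType.of_family (u ∘ f) (fun i => hu _) (fun i j => ?_) ?_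
  · simp only [Function.comp, h, f.injective.eq_iff]
    rw [signMat_eq_ite]
    split_ifs with h1 h2
    · rcases i with i | i
      · simp [signMat]
      · exact absurd h2 ((Fintype.equivFin {i // ¬ P i}).symm i).2
    · rcases i with i | i
      · exact absurd ((Fintype.equivFin {i // P i}).symm i).2 h2
      · simp [signMat]
    · rfl
  · rw [hc, Fintype.card_subtype_compl, Nat.add_sub_cancel' (Fintype.card_subtype_le _)]

/-- The Gram matrix of any basis is Hermitian, and invertible by non-degeneracy. A unitary
diagonalization, followed by scaling with `|λ|^(-1/2)`, gives an orthonormal basis with signs. -/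
theorem exists_hasType (W : Submodule ℂ (E p q))
    (hW : ∀ z ∈ W, (∀ w ∈ W, herm p q z w = 0) → z = 0) : ∃ s t, HasType W s t := by
  classical
  set m := Module.finrank ℂ W
  let b : Module.Basis (Fin m) ℂ W := Module.finBasis ℂ W
  -- The indices are transposed because `herm` is antilinear in its second variable; in this way
  -- `star U * H * U` contains the Gram values of the columns of `U`.
  let H : Matrix (Fin m) (Fin m) ℂ := Matrix.of fun i j => herm p q (b j : E p q) (b i : E p q)
  have hH : H.IsHermitian := by
    ext i j
    simp only [conjTranspose_apply, H, of_apply]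
    exact (herm_symm _ _).symm
  have hdet : H.det ≠ 0 := by
    intro h0
    obtain ⟨x, hx, hx0⟩ := exists_mulVec_eq_zero_iff.2 h0
    have hsum : ∑ j, x j • (b j : E p q) = 0 := by
      refine hW _ (Submodule.sum_mem _ fun j _ => W.smul_mem _ (b j).2) fun w hw => ?_
      have hw' : w = ∑ i, b.equivFun ⟨w, hw⟩ i • (b i : E p q) := coe_eq_sum_basis b ⟨w, hw⟩
      rw [hw', herm_sum_right]
      refine Finset.sum_eq_zero fun i _ => ?_
      rw [herm_smul_right, herm_sum_left]
      have := congrFun hx0 i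
      simp only [mulVec, dotProduct, H, of_apply, Pi.zero_apply] at this
      simp only [herm_smul_left]
      rw [Finset.sum_congr rfl fun j _ => mul_comm (x j) _, this, mul_zero]
    have hsum' : ∑ j, x j • b j = 0 := by
      apply Subtype.ext
      simpa using hsum
    exact hx (funext (Fintype.linearIndependent_iff.1 b.linearIndependent x hsum'))
  have hlam : ∀ k, hH.eigenvalues k ≠ 0 := by
    intro k hk
    apply hdet
    rw [hH.det_eq_prod_eigenvalues]
    exact Finset.prod_eq_zero (Finset.mem_univ k) (by simp [hk])
  let U : Matrix (Fin m) (Fin m) ℂ := hH.eigenvectorUnitary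
  have hU : star U * H * U = diagonal (fun k => (hH.eigenvalues k : ℂ)) := by
    have := hH.conjStarAlgAut_star_eigenvectorUnitary
    rw [Unitary.conjStarAlgAut_star_apply] at this
    exact this
  let r : Fin m → ℂ := fun k => ((Real.sqrt |hH.eigenvalues k|)⁻¹ : ℝ)
  let c : Fin m → E p q := fun k => ∑ j, U j k • (b j : E p q)
  have hc : ∀ k l, herm p q (c k) (c l) = if k = l then (hH.eigenvalues k : ℂ) else 0 := by
    intro k l
    have h1 := congrFun (congrFun hU l) k
    rw [diagonal_apply] at h1
    simp only [c, herm_sum_left, herm_sum_right, herm_smul_left, herm_smul_right, Finset.mul_sum]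
    rw [Finset.sum_comm]
    have h2 : (star U * H * U) l k = ∑ x, ∑ i, star (U i l) * H i x * U x k := by
      simp only [mul_apply, Finset.sum_mul, star_apply]
    rw [h2] at h1
    rw [show (if k = l then (hH.eigenvalues k : ℂ) else 0) =
      if l = k then (hH.eigenvalues l : ℂ) else 0 by
        by_cases h : k = l
        · subst h; simp
        · simp [h, Ne.symm h], ← h1]
    refine Finset.sum_congr rfl fun x _ => Finset.sum_congr rfl fun i _ => ?_
    simp only [H, of_apply]
    ring
  refine ⟨_, _, HasType.of_signs (κ := Fin m) (fun k => r k • c k)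
    (fun k => W.smul_mem _ (Submodule.sum_mem _ fun j _ => W.smul_mem _ (b j).2))
    (fun k => 0 < hH.eigenvalues k) (fun k l => ?_) (by simp [m])⟩
  rw [herm_smul_left, herm_smul_right, hc]
  by_cases hkl : k = l
  · subst hkl
    rw [if_pos rfl, if_pos rfl]
    have hs : star (r k) = r k := Complex.conj_ofReal _
    rw [hs]
    have hpos : 0 < |hH.eigenvalues k| := abs_pos.2 (hlam k)
    have h1 : (√|hH.eigenvalues k|)⁻¹ * ((√|hH.eigenvalues k|)⁻¹ * hH.eigenvalues k) =
        if 0 < hH.eigenvalues k then 1 else -1 := by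
      rw [← mul_assoc, ← mul_inv, Real.mul_self_sqrt hpos.le]
      split_ifs with h
      · rw [abs_of_pos h, inv_mul_cancel₀ (hlam k)]
      · rw [abs_of_neg (lt_of_le_of_ne (not_lt.1 h) (hlam k)), inv_neg, neg_mul,
          inv_mul_cancel₀ (hlam k)]
    have h2 := congrArg (fun x : ℝ => (x : ℂ)) h1
    simp only [Complex.ofReal_mul] at h2
    change ((r k) * ((r k) * (hH.eigenvalues k : ℂ))) = _
    rw [h2]
    split_ifs <;> simp
  · simp [hkl]

/-! ### Isometries and the adjoint action -/

theorem herm_polarize {M : Mat p q} {c : ℝ}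
    (h : ∀ z, herm p q (M *ᵥ z) (M *ᵥ z) = c * herm p q z z) (z w : E p q) :
    herm p q (M *ᵥ z) (M *ᵥ w) = c * herm p q z w := by
  have h1 := h (z + w)
  have h2 := h (z + Complex.I • w)
  simp only [mulVec_add, mulVec_smul, herm_add_left, herm_add_right, herm_smul_left,
    herm_smul_right, h z, h w] at h1 h2
  have hI : star Complex.I = -Complex.I := Complex.conj_I
  rw [hI] at h2
  linear_combination (1 / 2) * h1 + (Complex.I / 2) * h2 -
    (1 / 2) * (herm p q (M *ᵥ w) (M *ᵥ z) - herm p q (M *ᵥ z) (M *ᵥ w) +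
     c * (herm p q z w - herm p q w z)) * Complex.I_sq

theorem groupSU_herm {g : SL p q} (hg : g ∈ groupSU p q) (z w : E p q) :
    herm p q (g.1 *ᵥ z) (g.1 *ᵥ w) = herm p q z w := by
  simpa using herm_polarize (c := 1) (fun z => by simpa using hg z) z w

theorem SL_inv_mul (g : SL p q) : (g⁻¹).1 * g.1 = 1 := congrArg Subtype.val (inv_mul_cancel g)

theorem SL_mul_inv (g : SL p q) : g.1 * (g⁻¹).1 = 1 := congrArg Subtype.val (mul_inv_cancel g)

theorem one_mem_groupSU : (1 : SL p q) ∈ groupSU p q := fun z => by simp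

theorem mul_mem_groupSU {g k : SL p q} (hg : g ∈ groupSU p q) (hk : k ∈ groupSU p q) :
    g * k ∈ groupSU p q := fun z => by
  have h : (g * k).1 *ᵥ z = g.1 *ᵥ (k.1 *ᵥ z) := by rw [mulVec_mulVec]; rfl
  rw [h, hg, hk]

theorem inv_mem_groupSU {g : SL p q} (hg : g ∈ groupSU p q) : g⁻¹ ∈ groupSU p q := fun z => by
  rw [← hg, mulVec_mulVec, SL_mul_inv, one_mulVec]

/-- The action of the special linear group on `E`. -/
def act (g : SL p q) : E p q ≃ₗ[ℂ] E p q := Matrix.SpecialLinearGroup.toLin' g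

theorem act_apply (g : SL p q) (z : E p q) : act g z = g.1 *ᵥ z := rfl

theorem act_inv_act (g : SL p q) (z : E p q) : act g⁻¹ (act g z) = z := by
  rw [act_apply, act_apply, mulVec_mulVec, SL_inv_mul, one_mulVec]

theorem Ad_apply (g : SL p q) (x : Mat p q) : Ad g x = g.1 * x * (g⁻¹).1 := rfl

theorem Ad_mulVec_act (g : SL p q) (x : Mat p q) (z : E p q) :
    Ad g x *ᵥ act g z = act g (x *ᵥ z) := by
  rw [Ad_apply, act_apply, act_apply, mulVec_mulVec, mul_assoc, SL_inv_mul, mul_one, mulVec_mulVec]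

theorem Ad_one (x : Mat p q) : Ad 1 x = x := by
  rw [Ad_apply, inv_one]
  change 1 * x * 1 = x
  simp

theorem Ad_mul (g k : SL p q) (x : Mat p q) : Ad (g * k) x = Ad g (Ad k x) := by
  simp only [Ad_apply, _root_.mul_inv_rev]
  change (g.1 * k.1) * x * ((k⁻¹).1 * (g⁻¹).1) = _
  simp only [mul_assoc]

theorem Ad_inv_Ad (g : SL p q) (x : Mat p q) : Ad g⁻¹ (Ad g x) = x := by
  rw [← Ad_mul, inv_mul_cancel, Ad_one]

theorem Ad_Ad_inv (g : SL p q) (x : Mat p q) : Ad g (Ad g⁻¹ x) = x := by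
  rw [← Ad_mul, mul_inv_cancel, Ad_one]

theorem map_Ad_one (v : LieSubalgebra ℝ (Mat p q)) : v.map (Ad 1) = v := by
  ext x
  simp [LieSubalgebra.mem_map, Ad_one]

theorem map_Ad_mul (g k : SL p q) (v : LieSubalgebra ℝ (Mat p q)) :
    v.map (Ad (g * k)) = (v.map (Ad k)).map (Ad g) := by
  ext x
  simp [LieSubalgebra.mem_map, Ad_mul]

theorem map_Ad_inv_map (g : SL p q) (v : LieSubalgebra ℝ (Mat p q)) :
    (v.map (Ad g)).map (Ad g⁻¹) = v := by
  rw [← map_Ad_mul, inv_mul_cancel, map_Ad_one]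

theorem map_map_Ad_inv (g : SL p q) (v : LieSubalgebra ℝ (Mat p q)) :
    (v.map (Ad g⁻¹)).map (Ad g) = v := by
  rw [← map_Ad_mul, mul_inv_cancel, map_Ad_one]

/-- The factor `c` covers isometries (`c = 1`) as well as the anti-isometric swap of coordinates (`c
= -1`). -/
theorem mem_su_of_intertwine {S : E p q ≃ₗ[ℂ] E p q} {c : ℂ} {x y : Mat p q} (hx : x ∈ su p q)
    (hS : ∀ z w, herm p q (S z) (S w) = c * herm p q z w) (ht : y.trace = 0)
    (hxy : ∀ z, y *ᵥ S z = S (x *ᵥ z)) : y ∈ su p q := by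
  refine ⟨ht, fun z w => ?_⟩
  obtain ⟨z, rfl⟩ := S.surjective z
  obtain ⟨w, rfl⟩ := S.surjective w
  rw [hxy, hxy, hS, hS, ← mul_add, hx.2, mul_zero]

theorem trace_Ad (g : SL p q) (x : Mat p q) : (Ad g x).trace = x.trace := by
  rw [Ad_apply, trace_mul_comm, ← mul_assoc, SL_inv_mul, one_mul]

theorem Ad_mem_su {g : SL p q} (hg : g ∈ groupSU p q) {x : Mat p q} (hx : x ∈ su p q) :
    Ad g x ∈ su p q :=
  mem_su_of_intertwine (S := act g) (c := 1) hx
    (fun z w => by rw [one_mul]; exact groupSU_herm hg z w)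
    (by rw [trace_Ad, hx.1]) (Ad_mulVec_act g x)

theorem map_Ad_le_su {g : SL p q} (hg : g ∈ groupSU p q) {v : LieSubalgebra ℝ (Mat p q)}
    (hv : v ≤ su p q) : v.map (Ad g) ≤ su p q := by
  intro y hy
  obtain ⟨x, hx, rfl⟩ := hy
  exact Ad_mem_su hg (hv hx)

theorem isLieAbelian_iff_lie {v : LieSubalgebra ℝ (Mat p q)} :
    IsLieAbelian v ↔ ∀ x ∈ v, ∀ y ∈ v, ⁅x, y⁆ = 0 := by
  constructor
  · intro h x hx y hy
    have := h.trivial ⟨x, hx⟩ ⟨y, hy⟩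
    simpa using congrArg Subtype.val this
  · intro h
    exact ⟨fun x y => Subtype.ext (h x x.2 y y.2)⟩

theorem isLieAbelian_map_Ad (g : SL p q) {v : LieSubalgebra ℝ (Mat p q)}
    (hv : IsLieAbelian v) : IsLieAbelian (v.map (Ad g)) := by
  rw [isLieAbelian_iff_lie] at hv ⊢
  rintro _ ⟨x, hx, rfl⟩ _ ⟨y, hy, rfl⟩
  change ⁅Ad g x, Ad g y⁆ = 0
  rw [← LieHom.map_lie, hv x hx y hy, _root_.map_zero]

theorem map_Ad_mono (g : SL p q) {v w : LieSubalgebra ℝ (Mat p q)} (h : v ≤ w) :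
    v.map (Ad g) ≤ w.map (Ad g) := by
  rintro _ ⟨x, hx, rfl⟩
  exact ⟨x, h hx, rfl⟩

theorem IsMASA.map_Ad {g : SL p q} (hg : g ∈ groupSU p q) {v : LieSubalgebra ℝ (Mat p q)}
    (hv : IsMASA p q v) : IsMASA p q (v.map (Ad g)) := by
  refine ⟨⟨map_Ad_le_su hg hv.1.1, isLieAbelian_map_Ad g hv.1.2⟩, fun a ha hle => ?_⟩
  have h1 : v ≤ a.map (Ad g⁻¹) := by
    have := map_Ad_mono g⁻¹ hle
    rwa [map_Ad_inv_map] at this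
  have h2 := hv.2 ⟨map_Ad_le_su (inv_mem_groupSU hg) ha.1, isLieAbelian_map_Ad _ ha.2⟩ h1
  have h3 := map_Ad_mono g h2
  rwa [map_map_Ad_inv] at h3

theorem IsMASA.comm {v : LieSubalgebra ℝ (Mat p q)} (hv : IsMASA p q v) {x y : Mat p q}
    (hx : x ∈ v) (hy : y ∈ v) : x * y = y * x := by
  have := isLieAbelian_iff_lie.1 hv.1.2 x hx y hy
  rwa [Ring.lie_def, sub_eq_zero] at this

/-- A MASA contains every element of `su(p, q)` commuting with it. -/
theorem IsMASA.mem_of_comm {v : LieSubalgebra ℝ (Mat p q)} (hv : IsMASA p q v) {y : Mat p q}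
    (hy : y ∈ su p q) (hc : ∀ x ∈ v, x * y = y * x) : y ∈ v := by
  have hmem : ∀ s, s ∈ v.toSubmodule ⊔ Submodule.span ℝ {y} ↔ ∃ x ∈ v, ∃ c : ℝ, s = x + c • y := by
    intro s
    simp only [Submodule.mem_sup, Submodule.mem_span_singleton]
    constructor
    · rintro ⟨x, hx, _, ⟨c, rfl⟩, rfl⟩
      exact ⟨x, hx, c, rfl⟩
    · rintro ⟨x, hx, c, rfl⟩
      exact ⟨x, hx, _, ⟨c, rfl⟩, rfl⟩
  have hlie : ∀ {s t : Mat p q}, (∃ x ∈ v, ∃ c : ℝ, s = x + c • y) →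
      (∃ x ∈ v, ∃ c : ℝ, t = x + c • y) → ⁅s, t⁆ = 0 := by
    rintro _ _ ⟨x, hx, c, rfl⟩ ⟨x', hx', c', rfl⟩
    have h1 : Commute x x' := hv.comm hx hx'
    have h2 : Commute x y := hc x hx
    have h3 : Commute y x' := (hc x' hx').symm
    rw [Ring.lie_def, sub_eq_zero]
    exact (h1.add_right (h2.smul_right c')).add_left
      ((h3.add_right ((Commute.refl y).smul_right c')).smul_left c)
  -- The span of `v` and `y` is abelian, so maximality of `v` puts it inside `v`.
  let a : LieSubalgebra ℝ (Mat p q) :=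
    { v.toSubmodule ⊔ Submodule.span ℝ {y} with
      lie_mem' := by
        intro s t hs ht
        rw [Submodule.mem_carrier, SetLike.mem_coe, hmem] at hs ht
        rw [hlie hs ht]
        exact Submodule.zero_mem _ }
  have ha : a ≤ v := hv.2 ⟨fun s hs => by
      obtain ⟨x, hx, c, rfl⟩ := (hmem s).1 hs
      exact add_mem (hv.1.1 hx) ((su p q).smul_mem c hy),
    isLieAbelian_iff_lie.2 fun s hs t ht => hlie ((hmem s).1 hs) ((hmem t).1 ht)⟩
    fun x hx => (hmem x).2 ⟨x, hx, 0, by simp⟩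
  exact ha ((hmem y).2 ⟨0, zero_mem _, 1, by simp⟩)

/-- An isometry is a multiple of an element of `SU(p, q)`. -/
theorem exists_groupSU_smul (hn : 0 < p + q) {M : Mat p q}
    (hM : ∀ z, herm p q (M *ᵥ z) (M *ᵥ z) = herm p q z z) :
    ∃ g ∈ groupSU p q, ∃ c : ℂ, c ≠ 0 ∧ g.1 = c • M := by
  have hpol : ∀ z w, herm p q (M *ᵥ z) (M *ᵥ w) = herm p q z w := fun z w => by
    simpa using herm_polarize (c := 1) (fun z => by simpa using hM z) z w
  have hmat : Mᴴ * signMat p q * M = signMat p q := by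
    ext i j
    have h1 := hpol (Pi.single j 1) (Pi.single i 1)
    rw [herm_basis] at h1
    rw [show signMat p q i j = signMat p q j i by simp [signMat, diagonal_apply, eq_comm]; grind, ← h1]
    simp only [herm, mulVec_single_one, dotProduct_mulVec]
    rfl
  have hJ : (signMat p q).det ≠ 0 := by
    rw [signMat, det_diagonal]
    refine Finset.prod_ne_zero_iff.2 fun i _ => ?_
    rcases i with i | i <;> simp
  have hdet : star M.det * M.det = 1 := by
    have := congrArg Matrix.det hmat
    rw [det_mul, det_mul, det_conjTranspose] at this
    apply mul_right_cancel₀ hJ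
    linear_combination this
  have hd0 : M.det ≠ 0 := fun h => by simp [h] at hdet
  -- Scaling by a root of order `p + q` of `1 / det M` makes the determinant `1`. Since `|det M| =
  -- 1`, the root has modulus `1`, and the form is still preserved.
  obtain ⟨c, hc⟩ := IsAlgClosed.exists_pow_nat_eq (M.det)⁻¹ hn
  have hcn : ‖c‖ = 1 := by
    have h1 : ‖M.det‖ = 1 := by
      have := congrArg norm hdet
      rw [norm_mul, norm_star, norm_one] at this
      nlinarith [norm_nonneg M.det]
    have h2 := congrArg norm hc
    rw [norm_pow, norm_inv, h1, inv_one] at h2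
    exact (pow_eq_one_iff_of_nonneg (norm_nonneg c) hn.ne').1 h2
  have hcc : c * star c = 1 := by
    rw [Complex.star_def, Complex.mul_conj, Complex.normSq_eq_norm_sq, hcn]
    simp
  have hc0 : c ≠ 0 := fun h => by simp [h] at hcc
  refine ⟨⟨c • M, ?_⟩, fun z => ?_, c, hc0, rfl⟩
  · rw [det_smul, Fintype.card_sum, Fintype.card_fin, Fintype.card_fin, hc, inv_mul_cancel₀ hd0]
  · simp only [smul_mulVec, herm_smul_left, herm_smul_right]
    rw [← mul_assoc, mul_comm (star c), hcc, one_mul, hM]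

/-- The images of the positive basis vectors are negative orthonormal and conversely, so the inertia
bounds give `p ≤ q` and `q ≤ p`. -/
theorem eq_of_mem_groupG_neg {g : SL p q}
    (hg : ∀ z : E p q, herm p q (g.1 *ᵥ z) (g.1 *ᵥ z) = -herm p q z z) : p = q := by
  have hpol : ∀ z w, herm p q (g.1 *ᵥ z) (g.1 *ᵥ w) = -herm p q z w := fun z w => by
    simpa using herm_polarize (c := -1) (fun z => by simpa using hg z) z w
  apply le_antisymm
  · have := card_le_of_gram_neg (p := p) (q := q)
      (u := fun i : Fin p => g.1 *ᵥ (Pi.single (Sum.inl i) 1)) fun i j => by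
        rw [hpol, herm_basis, signMat, diagonal_apply]
        simp only [Sum.inl.injEq, Sum.elim_inl]
        split_ifs <;> simp
    simpa using this
  · have := card_le_of_gram_pos (p := p) (q := q)
      (u := fun i : Fin q => g.1 *ᵥ (Pi.single (Sum.inr i) 1)) fun i j => by
        rw [hpol, herm_basis, signMat, diagonal_apply]
        simp only [Sum.inr.injEq, Sum.elim_inr]
        split_ifs <;> simp
    simpa using this

/-- A qualifying MASA can be moved into the `(-1)`-eigenspace by an element of `SU(p, q)`. -/
theorem IsQualifyingMASA.exists_groupSU (hn : 0 < p + q) {v : LieSubalgebra ℝ (Mat p q)}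
    (hv : IsQualifyingMASA p q v) :
    ∃ g ∈ groupSU p q, (v.map (Ad g) : Set (Mat p q)) ⊆ suMinus p q := by
  obtain ⟨-, g, hg | hg, hgv⟩ := hv
  · exact ⟨g, hg, hgv⟩
  obtain rfl := eq_of_mem_groupG_neg hg
  -- Exchanging the two halves of the coordinates reverses the sign of the form and commutes with
  -- `tau`. Composed with `g` it gives an isometry that still moves `v` into `suMinus`.
  let S : E p p ≃ₗ[ℂ] E p p := LinearEquiv.funCongrLeft ℂ ℂ (Equiv.sumComm (Fin p) (Fin p))
  have hS : ∀ z, S z = z ∘ Sum.swap := fun z => rfl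
  have hSh : ∀ z w, herm p p (S z) (S w) = -1 * herm p p z w := fun z w => by
    rw [hS, hS, herm_comp_swap]; ring
  have hStau : ∀ z, tau p p (S z) = S (tau p p z) := fun z => rfl
  have hM : ∀ z, (LinearMap.toMatrix' (S : E p p →ₗ[ℂ] E p p) * g.1) *ᵥ z = S (act g z) := by
    intro z
    rw [← mulVec_mulVec, ← toLin'_apply, toLin'_toMatrix']
    rfl
  obtain ⟨k, hk, c, hc, hkc⟩ := exists_groupSU_smul hn
    (M := LinearMap.toMatrix' (S : E p p →ₗ[ℂ] E p p) * g.1) (fun z => by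
      rw [hM, hSh, act_apply, hg]; ring)
  have hka : ∀ z, act k z = c • S (act g z) := fun z => by
    rw [act_apply, hkc, smul_mulVec, hM]
  refine ⟨k, hk, ?_⟩
  rintro _ ⟨x, hx, rfl⟩
  have hy : Ad g x ∈ suMinus p p := hgv ⟨x, hx, rfl⟩
  have hint : ∀ z, Ad k x *ᵥ S z = S (Ad g x *ᵥ z) := by
    intro z
    obtain ⟨z, rfl⟩ := (act g).surjective z
    have h1 := Ad_mulVec_act k x z
    rw [hka, hka, mulVec_smul] at h1
    rw [Ad_mulVec_act]
    exact smul_right_injective _ hc h1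
  refine ⟨mem_su_of_intertwine hy.1 hSh ((trace_Ad k x).trans ((trace_Ad g x).symm.trans hy.1.1)) hint,
    fun z => ?_⟩
  obtain ⟨z, rfl⟩ := S.surjective z
  change tau p p (Ad k x *ᵥ tau p p (S z)) = -(Ad k x *ᵥ S z)
  rw [hStau, hint, hint, hStau, hy.2, map_neg]

/-! ### Joint eigenspaces -/

theorem mem_eigenspaces_iff {S : Set (Mat p q)} {γ : Mat p q → ℂ} {z : E p q} :
    z ∈ ⨅ x ∈ S, Module.End.eigenspace (Matrix.toLin' x) (γ x) ↔
      ∀ x ∈ S, x *ᵥ z = γ x • z := by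
  simp only [Submodule.mem_iInf, Module.End.mem_eigenspace_iff, toLin'_apply]

theorem map_act_eigenspaces (g : SL p q) (S : Set (Mat p q)) (γ : Mat p q → ℂ) :
    (⨅ x ∈ S, Module.End.eigenspace (Matrix.toLin' x) (γ x)).map (act g : E p q →ₗ[ℂ] E p q) =
      ⨅ x ∈ Ad g '' S, Module.End.eigenspace (Matrix.toLin' x) (γ (Ad g⁻¹ x)) := by
  ext z
  obtain ⟨z, rfl⟩ := (act g).surjective z
  have h : act g z ∈ (⨅ x ∈ S, Module.End.eigenspace (Matrix.toLin' x) (γ x)).map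
      (act g : E p q →ₗ[ℂ] E p q) ↔
      z ∈ ⨅ x ∈ S, Module.End.eigenspace (Matrix.toLin' x) (γ x) := by
    rw [Submodule.mem_map]
    constructor
    · rintro ⟨y, hy, hyz⟩
      rwa [← (act g).injective hyz]
    · exact fun h => ⟨z, h, rfl⟩
  rw [h, mem_eigenspaces_iff, mem_eigenspaces_iff, Set.forall_mem_image]
  refine forall₂_congr fun x _ => ?_
  rw [Ad_mulVec_act, Ad_inv_Ad, ← map_smul, (act g).injective.eq_iff]

theorem jointEigenspaces_image_Ad (g : SL p q) (S : Set (Mat p q)) :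
    jointEigenspaces (Ad g '' S) =
      (Submodule.map (act g : E p q →ₗ[ℂ] E p q)) '' jointEigenspaces S := by
  ext W
  constructor
  · rintro ⟨hW, γ, rfl⟩
    have h : ⨅ x ∈ Ad g '' S, Module.End.eigenspace (Matrix.toLin' x) (γ x) =
        (⨅ x ∈ S, Module.End.eigenspace (Matrix.toLin' x) (γ (Ad g x))).map
          (act g : E p q →ₗ[ℂ] E p q) := by
      rw [map_act_eigenspaces g S fun x => γ (Ad g x)]
      simp only [Ad_Ad_inv]
    rw [h] at hW ⊢
    refine ⟨_, ⟨fun h0 => hW (by rw [h0, Submodule.map_bot]), _, rfl⟩, rfl⟩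
  · rintro ⟨_, ⟨hW, γ, rfl⟩, rfl⟩
    refine ⟨fun h0 => hW ?_, _, map_act_eigenspaces g S γ⟩
    exact Submodule.map_eq_bot_iff.1 h0

theorem toralPart_map_Ad (g : SL p q) (v : LieSubalgebra ℝ (Mat p q)) :
    toralPart (v.map (Ad g)) = Ad g '' toralPart v := by
  have key : ∀ x : Mat p q, Module.End.IsSemisimple (Matrix.toLin' (Ad g x)) ↔
      Module.End.IsSemisimple (Matrix.toLin' x) := by
    intro x
    rw [← LinearEquiv.isSemisimple_iff (f := Matrix.toLin' x) (g := Matrix.toLin' (Ad g x))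
      (act g) (LinearMap.ext fun z => (Ad_mulVec_act g x z).symm)]
  ext y
  constructor
  · rintro ⟨⟨x, hx, rfl⟩, hs⟩
    exact ⟨x, ⟨hx, (key x).1 hs⟩, rfl⟩
  · rintro ⟨x, ⟨hx, hs⟩, rfl⟩
    exact ⟨⟨x, hx, rfl⟩, (key x).2 hs⟩

theorem jointEigenspaces_map_Ad (g : SL p q) (v : LieSubalgebra ℝ (Mat p q)) :
    jointEigenspaces (toralPart (v.map (Ad g))) =
      (Submodule.map (act g : E p q →ₗ[ℂ] E p q)) '' jointEigenspaces (toralPart v) := by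
  rw [toralPart_map_Ad, jointEigenspaces_image_Ad]

/-! ### The joint eigenspace decomposition -/

section Decomposition

variable {S : Set (Mat p q)}

/-- The joint eigenspace to a family of eigenvalues. -/
def wtSpace (S : Set (Mat p q)) (χ : S → ℂ) : Submodule ℂ (E p q) :=
  ⨅ x : S, Module.End.eigenspace (Matrix.toLin' (x : Mat p q)) (χ x)

theorem mem_wtSpace {χ : S → ℂ} {z : E p q} :
    z ∈ wtSpace S χ ↔ ∀ x : S, (x : Mat p q) *ᵥ z = χ x • z := by
  simp only [wtSpace, Submodule.mem_iInf, Module.End.mem_eigenspace_iff, toLin'_apply]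

/-- Values of `γ` outside `S` are irrelevant, so different `γ` may give the same space. Indexing by
functions on `S` alone removes this ambiguity and makes the family independent. -/
theorem mem_jointEigenspaces_iff {W : Submodule ℂ (E p q)} :
    W ∈ jointEigenspaces S ↔ W ≠ ⊥ ∧ ∃ χ : S → ℂ, W = wtSpace S χ := by
  classical
  refine and_congr_right fun _ => ⟨?_, ?_⟩
  · rintro ⟨γ, rfl⟩
    exact ⟨fun x => γ x, iInf_subtype'⟩
  · rintro ⟨χ, rfl⟩
    refine ⟨fun x => if h : x ∈ S then χ ⟨x, h⟩ else 0, ?_⟩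
    ext z
    rw [mem_eigenspaces_iff, mem_wtSpace, Subtype.forall]
    refine forall₂_congr fun x hx => ?_
    rw [dif_pos hx]

theorem toLin'_commute {x y : Mat p q} (h : x * y = y * x) :
    Commute (Matrix.toLin' x : Module.End ℂ (E p q)) (Matrix.toLin' y) := by
  have := congrArg Matrix.toLin' h
  rwa [toLin'_mul, toLin'_mul] at this

/-- Semisimplicity identifies eigenspaces with generalized eigenspaces, for which independence and
spanning hold for commuting families over `ℂ`. -/
theorem wtSpace_eq (hss : ∀ x ∈ S, Module.End.IsSemisimple (Matrix.toLin' x)) (χ : S → ℂ) : wtSpace S χ =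
    ⨅ x : S, Module.End.maxGenEigenspace (Matrix.toLin' (x : Mat p q)) (χ x) :=
  iInf_congr fun x =>
    ((hss x x.2).isFinitelySemisimple.maxGenEigenspace_eq_eigenspace (χ x)).symm

theorem iSupIndep_wtSpace (hss : ∀ x ∈ S, Module.End.IsSemisimple (Matrix.toLin' x))
    (hcomm : ∀ x ∈ S, ∀ y ∈ S, x * y = y * x) :
    iSupIndep (wtSpace S) := by
  have := Module.End.independent_iInf_maxGenEigenspace_of_forall_mapsTo
    (fun x : S => Matrix.toLin' (x : Mat p q)) fun x y φ =>
      Module.End.mapsTo_maxGenEigenspace_of_comm (toLin'_commute (hcomm y y.2 x x.2)) φ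
  rwa [show wtSpace S = _ from funext (wtSpace_eq hss)]

theorem iSup_wtSpace (hss : ∀ x ∈ S, Module.End.IsSemisimple (Matrix.toLin' x))
    (hcomm : ∀ x ∈ S, ∀ y ∈ S, x * y = y * x) :
    ⨆ χ, wtSpace S χ = ⊤ := by
  rw [show wtSpace S = _ from funext (wtSpace_eq hss)]
  refine Module.End.iSup_iInf_maxGenEigenspace_eq_top_of_iSup_maxGenEigenspace_eq_top_of_commute
    (fun x : S => Matrix.toLin' (x : Mat p q)) 
    (fun x y _ => toLin'_commute (hcomm x x.2 y y.2)) fun x => ?_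
  exact Module.End.iSup_maxGenEigenspace_eq_top _

theorem sSupIndep_jointEigenspaces (hss : ∀ x ∈ S, Module.End.IsSemisimple (Matrix.toLin' x))
    (hcomm : ∀ x ∈ S, ∀ y ∈ S, x * y = y * x) :
    sSupIndep (jointEigenspaces S) := by
  refine (iSupIndep_wtSpace hss hcomm).sSupIndep_range.mono fun W hW => ?_
  obtain ⟨-, χ, rfl⟩ := mem_jointEigenspaces_iff.1 hW
  exact ⟨χ, rfl⟩

theorem sSup_jointEigenspaces (hss : ∀ x ∈ S, Module.End.IsSemisimple (Matrix.toLin' x))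
    (hcomm : ∀ x ∈ S, ∀ y ∈ S, x * y = y * x) :
    sSup (jointEigenspaces S) = ⊤ := by
  rw [eq_top_iff, ← iSup_wtSpace hss hcomm]
  refine iSup_le fun χ => ?_
  by_cases h : wtSpace S χ = ⊥
  · rw [h]; exact bot_le
  · exact le_sSup (mem_jointEigenspaces_iff.2 ⟨h, χ, rfl⟩)

theorem finite_jointEigenspaces (hss : ∀ x ∈ S, Module.End.IsSemisimple (Matrix.toLin' x))
    (hcomm : ∀ x ∈ S, ∀ y ∈ S, x * y = y * x) :
    (jointEigenspaces S).Finite :=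
  WellFoundedGT.finite_of_sSupIndep (sSupIndep_jointEigenspaces hss hcomm)

end Decomposition

/-! ### The action of the conjugation on the joint eigenspaces. -/

section Tau

variable {S : Set (Mat p q)}

theorem mem_map_tau {W : Submodule ℂ (E p q)} {z : E p q} :
    z ∈ W.map (tau p q) ↔ tau p q z ∈ W := by
  constructor
  · rintro ⟨w, hw, rfl⟩
    rwa [tau_tau]
  · exact fun h => ⟨_, h, tau_tau z⟩

theorem map_tau_map_tau (W : Submodule ℂ (E p q)) : (W.map (tau p q)).map (tau p q) = W := by
  ext z
  rw [mem_map_tau, mem_map_tau, tau_tau]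

theorem map_tau_injective :
    Function.Injective (fun W : Submodule ℂ (E p q) => W.map (tau p q)) :=
  Function.LeftInverse.injective map_tau_map_tau

theorem tau_linearIndependent {κ : Type*} {u : κ → E p q} (h : LinearIndependent ℂ u) :
    LinearIndependent ℂ fun i => tau p q (u i) := by
  rw [linearIndependent_iff'] at h ⊢
  intro s g hg i hi
  have := h s (fun i => star (g i)) (by
    have h1 := congrArg (tau p q) hg
    simpa only [map_sum, tau_smul, tau_tau, map_zero] using h1) i hi
  simpa using this

/-- The antilinear `tau` preserves linear independence, which gives one inequality; applying it to
`W.map (tau p q)` gives the other. -/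
theorem finrank_map_tau (W : Submodule ℂ (E p q)) :
    Module.finrank ℂ (W.map (tau p q)) = Module.finrank ℂ W := by
  have key : ∀ W : Submodule ℂ (E p q),
      Module.finrank ℂ W ≤ Module.finrank ℂ (W.map (tau p q)) := by
    intro W
    let b := Module.finBasis ℂ W
    have h1 : LinearIndependent ℂ fun i => (b i : E p q) :=
      b.linearIndependent.map' W.subtype W.ker_subtype
    have h2 : LinearIndependent ℂ fun i =>
        (⟨tau p q (b i), Submodule.mem_map_of_mem (b i).2⟩ : W.map (tau p q)) :=
      LinearIndependent.of_comp (W.map (tau p q)).subtype (tau_linearIndependent h1)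
    simpa using h2.fintype_card_le_finrank
  refine le_antisymm ?_ (key W)
  have := key (W.map (tau p q))
  rwa [map_tau_map_tau] at this

theorem map_tau_wtSpace (hS : S ⊆ suMinus p q) (χ : S → ℂ) :
    (wtSpace S χ).map (tau p q) = wtSpace S fun x => -star (χ x) := by
  ext z
  rw [mem_map_tau, mem_wtSpace, mem_wtSpace]
  refine forall_congr' fun x => ?_
  have h1 := (hS x.2).2 z
  constructor
  · intro h
    rw [h, tau_smul, tau_tau] at h1
    rw [neg_smul, h1, neg_neg]
  · intro h
    have h2 := congrArg (tau p q) h1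
    rw [tau_tau, h] at h2
    rw [h2, neg_smul, neg_neg, tau_smul, star_star]

theorem map_tau_mem_jointEigenspaces (hS : S ⊆ suMinus p q) {W : Submodule ℂ (E p q)} (hW : W ∈ jointEigenspaces S) :
    W.map (tau p q) ∈ jointEigenspaces S := by
  obtain ⟨h0, χ, rfl⟩ := mem_jointEigenspaces_iff.1 hW
  refine mem_jointEigenspaces_iff.2 ⟨fun h => h0 ?_, _, map_tau_wtSpace hS χ⟩
  have := congrArg (Submodule.map (tau p q)) h
  rwa [map_tau_map_tau, Submodule.map_bot] at this

/-- Skewness gives `(χ x + conj (χ' x)) * h(z, w) = 0` for all `x`, so a nonzero value forces `χ' =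
-conj χ`, the weight of `tau W`. -/
theorem herm_eq_zero_of_ne_map_tau (hS : S ⊆ suMinus p q) {W W' : Submodule ℂ (E p q)} (hW : W ∈ jointEigenspaces S)
    (hW' : W' ∈ jointEigenspaces S) (hne : W' ≠ W.map (tau p q)) {z w : E p q}
    (hz : z ∈ W) (hw : w ∈ W') : herm p q z w = 0 := by
  obtain ⟨-, χ, rfl⟩ := mem_jointEigenspaces_iff.1 hW
  obtain ⟨-, χ', rfl⟩ := mem_jointEigenspaces_iff.1 hW'
  by_contra h0
  refine hne ?_
  rw [map_tau_wtSpace hS]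
  congr 1
  ext x
  have h1 := (hS x.2).1.2 z w
  rw [mem_wtSpace.1 hz x, mem_wtSpace.1 hw x, herm_smul_left, herm_smul_right, ← add_mul] at h1
  have h2 := (mul_eq_zero.1 h1).resolve_right h0
  have h3 := congrArg star h2
  rw [star_add, star_star, star_zero] at h3
  linear_combination h3

/-- A vector of `W` is already orthogonal to every joint eigenspace except `tau W`; if it is also
orthogonal to that one, non-degeneracy on `E` kills it. -/
theorem eq_zero_of_herm_map_tau_eq_zero (hS : S ⊆ suMinus p q) (htop : sSup (jointEigenspaces S) = ⊤)
    {W : Submodule ℂ (E p q)} (hW : W ∈ jointEigenspaces S) {z : E p q} (hz : z ∈ W)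
    (h : ∀ w ∈ W.map (tau p q), herm p q z w = 0) : z = 0 := by
  refine eq_zero_of_herm_eq_zero fun w => ?_
  have hw : w ∈ sSup (jointEigenspaces S) := htop ▸ Submodule.mem_top
  rw [sSup_eq_iSup'] at hw
  induction hw using Submodule.iSup_induction' with
  | mem W' w hw =>
    by_cases hne : (W' : Submodule ℂ (E p q)) = W.map (tau p q)
    · exact h w (hne ▸ hw)
    · exact herm_eq_zero_of_ne_map_tau hS hW W'.2 hne hz hw
  | zero => exact herm_zero_right z
  | add a b _ _ ha hb => rw [herm_add_right, ha, hb, add_zero]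

end Tau

theorem toralPart_subset {v : LieSubalgebra ℝ (Mat p q)} : toralPart v ⊆ v := fun _ hx => hx.1

theorem toralPart_semisimple {v : LieSubalgebra ℝ (Mat p q)} :
    ∀ x ∈ toralPart v, Module.End.IsSemisimple (Matrix.toLin' x) := fun _ hx => hx.2

theorem IsMASA.toralPart_comm {v : LieSubalgebra ℝ (Mat p q)} (hv : IsMASA p q v) :
    ∀ x ∈ toralPart v, ∀ y ∈ toralPart v, x * y = y * x :=
  fun _ hx _ hy => hv.comm hx.1 hy.1

/-! ### Definite joint eigenspaces -/

/-- A commuting family of endomorphisms has a joint eigenvector in every nonzero invariant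
subspace. -/
theorem exists_joint_eigenvector {V : Type*} [AddCommGroup V] [Module ℂ V]
    [FiniteDimensional ℂ V] (T : Set (Module.End ℂ V)) (hT : ∀ f ∈ T, ∀ g ∈ T, f * g = g * f)
    (W : Submodule ℂ V) (hW : W ≠ ⊥) (hinv : ∀ f ∈ T, ∀ z ∈ W, f z ∈ W) :
    ∃ z ∈ W, z ≠ 0 ∧ ∀ f ∈ T, ∃ c : ℂ, f z = c • z := by
  generalize hn : Module.finrank ℂ W = n
  induction n using Nat.strong_induction_on generalizing W with
  | _ n ih =>
    -- If every operator is scalar on `W`, any nonzero vector works. Otherwise some `f` has an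
    -- eigenspace that cuts `W` down to a smaller invariant subspace.
    by_cases hall : ∀ f ∈ T, ∃ c : ℂ, ∀ z ∈ W, f z = c • z
    · obtain ⟨z, hz, hz0⟩ := Submodule.exists_mem_ne_zero_of_ne_bot hW
      exact ⟨z, hz, hz0, fun f hf => (hall f hf).imp fun c hc => hc z hz⟩
    · push Not at hall
      obtain ⟨f, hf, hfc⟩ := hall
      have : Nontrivial W := Submodule.nontrivial_iff_ne_bot.2 hW
      obtain ⟨c, hc⟩ := Module.End.exists_eigenvalue (f.restrict (hinv f hf))
      obtain ⟨⟨u, hu⟩, huc⟩ := hc.exists_hasEigenvector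
      have hfu : f u = c • u := by simpa using congrArg Subtype.val huc.apply_eq_smul
      have hu0 : u ≠ 0 := fun h => huc.2 (Subtype.ext h)
      let W' : Submodule ℂ V := W ⊓ Module.End.eigenspace f c
      have hmem : ∀ z, z ∈ W' ↔ z ∈ W ∧ f z = c • z := fun z => by
        simp [W']
      have hlt : W' < W := by
        refine lt_of_le_of_ne inf_le_left fun h => ?_
        obtain ⟨z, hz, hzc⟩ := hfc c
        exact hzc ((hmem z).1 (h ▸ hz)).2
      obtain ⟨z, hz, h⟩ := ih _ (hn ▸ Submodule.finrank_lt_finrank_of_lt hlt) W'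
        (fun h => hu0 ((Submodule.mem_bot ℂ).1 (h ▸ (hmem u).2 ⟨hu, hfu⟩)))
        (fun g hg z hz => by
          obtain ⟨h1, h2⟩ := (hmem z).1 hz
          refine (hmem _).2 ⟨hinv g hg z h1, ?_⟩
          have := LinearMap.congr_fun (hT f hf g hg) z
          rw [Module.End.mul_apply, Module.End.mul_apply] at this
          rw [this, h2, map_smul]) rfl
      exact ⟨z, ((hmem z).1 hz).1, h⟩

theorem exists_joint_eigenvector_of_mem {v : LieSubalgebra ℝ (Mat p q)} (hv : IsMASA p q v)
    {W : Submodule ℂ (E p q)} (hW : W ∈ jointEigenspaces (toralPart v)) :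
    ∃ z ∈ W, z ≠ 0 ∧ ∀ x ∈ v, ∃ c : ℂ, x *ᵥ z = c • z := by
  obtain ⟨h0, γ, rfl⟩ := hW
  obtain ⟨z, hz, hz0, h⟩ := exists_joint_eigenvector (Matrix.toLin' '' (v : Set (Mat p q)))
    (by
      rintro _ ⟨x, hx, rfl⟩ _ ⟨y, hy, rfl⟩
      exact toLin'_commute (hv.comm hx hy)) _ h0 (by
      rintro _ ⟨x, hx, rfl⟩ z hz
      rw [mem_eigenspaces_iff] at hz ⊢
      intro y hy
      rw [toLin'_apply, mulVec_mulVec, hv.comm hy.1 hx, ← mulVec_mulVec, hz y hy, mulVec_smul])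
  exact ⟨z, hz, hz0, fun x hx => by simpa using h _ ⟨x, hx, rfl⟩⟩

/-- The annihilating polynomial `X (X - c)` is squarefree since `c ≠ 0`. -/
theorem isSemisimple_of_mul_self {V : Type*} [AddCommGroup V] [Module ℂ V]
    {f : Module.End ℂ V} {c : ℂ} (hc : c ≠ 0) (h : f * f = c • f) : f.IsSemisimple := by
  refine Module.End.isSemisimple_of_squarefree_aeval_eq_zero
    (p := (Polynomial.X - Polynomial.C 0) * (Polynomial.X - Polynomial.C c)) ?_ ?_
  · refine Polynomial.Separable.squarefree ((Polynomial.separable_X_sub_C).mul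
      (Polynomial.separable_X_sub_C) ?_)
    exact Polynomial.isCoprime_X_sub_C_of_isUnit_sub (by simpa using hc)
  · rw [map_mul, map_sub, map_sub, Polynomial.aeval_X, Polynomial.aeval_C, Polynomial.aeval_C,
      map_zero, sub_zero, mul_sub, Algebra.algebraMap_eq_smul_one, mul_smul_comm, mul_one, h,
      sub_self]

/-- A joint eigenspace of the toral part of a MASA that contains an anisotropic joint eigenvector
of the MASA is one-dimensional. -/
theorem finrank_eq_one_of_anisotropic (hn : 0 < p + q) {v : LieSubalgebra ℝ (Mat p q)}
    (hv : IsMASA p q v) {W : Submodule ℂ (E p q)} (hW : W ∈ jointEigenspaces (toralPart v))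
    {b : E p q} (hb : b ∈ W) (hbv : ∀ x ∈ v, ∃ c : ℂ, x *ᵥ b = c • b)
    (hbb : herm p q b b ≠ 0) : Module.finrank ℂ W = 1 := by
  set e := herm p q b b with he
  have hee : star e = e := (herm_symm b b).symm
  have hn' : ((p + q : ℕ) : ℂ) ≠ 0 := Nat.cast_ne_zero.2 hn.ne'
  -- The trace of `P` is `i e`, so subtracting `r` makes it trace-free; `r` is purely imaginary
  -- because `e` is real, which keeps the result skew.
  let r : ℂ := Complex.I * e / ((p + q : ℕ) : ℂ)
  have hr : star r = -r := by
    simp [r, hee, star_div₀, neg_div]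
  let P : Mat p q := Complex.I • vecMulVec b (star b ᵥ* signMat p q)
  have hP : ∀ z, P *ᵥ z = (Complex.I * herm p q z b) • b := by
    intro z
    rw [smul_mulVec, vecMulVec_mulVec, herm, dotProduct_mulVec, mul_smul]
    simp
  let y : Mat p q := P - r • 1
  have hy : ∀ z, y *ᵥ z = (Complex.I * herm p q z b) • b - r • z := by
    intro z
    rw [sub_mulVec, hP, smul_mulVec, one_mulVec]
  have hysu : y ∈ su p q := by
    refine ⟨?_, fun z w => ?_⟩
    · have h1 : P.trace = Complex.I * e := by
        rw [trace_smul, trace_vecMulVec, he, herm, dotProduct_comm, dotProduct_mulVec, smul_eq_mul]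
      rw [trace_sub, h1, trace_smul, trace_one, Fintype.card_sum, Fintype.card_fin,
        Fintype.card_fin, smul_eq_mul, div_mul_cancel₀ _ hn', sub_self]
    · rw [hy, hy]
      simp only [herm_sub_left, herm_sub_right, herm_smul_left, herm_smul_right, star_mul', hr]
      rw [← herm_symm w b, show star Complex.I = -Complex.I from Complex.conj_I]
      ring
  -- As `b` is anisotropic, skewness makes its eigenvalues under `v` imaginary, and then `P`
  -- commutes with `v`.
  have hyv : y ∈ v := by
    refine hv.mem_of_comm hysu fun x hx => ?_
    obtain ⟨c, hc⟩ := hbv x hx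
    have hx' := (hv.1.1 hx).2
    have hcc : star c = -c := by
      have h1 := hx' b b
      rw [hc, herm_smul_left, herm_smul_right, ← add_mul] at h1
      linear_combination (mul_eq_zero.1 h1).resolve_right hbb
    refine toLin'.injective (LinearMap.ext fun z => ?_)
    rw [toLin'_apply, toLin'_apply, ← mulVec_mulVec, ← mulVec_mulVec, hy, hy, mulVec_sub,
      mulVec_smul, mulVec_smul, hc, smul_smul]
    congr 2
    have h1 := hx' z b
    rw [hc, herm_smul_right, hcc] at h1
    linear_combination -Complex.I * h1
  have hPsq : P * P = (Complex.I * e) • P := by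
    refine toLin'.injective (LinearMap.ext fun z => ?_)
    rw [toLin'_apply, toLin'_apply, ← mulVec_mulVec, hP, hP, herm_smul_left, smul_mulVec, hP,
      smul_smul, ← he]
    congr 1
    ring
  have hIe : Complex.I * e ≠ 0 := mul_ne_zero Complex.I_ne_zero hbb
  have hPss : Module.End.IsSemisimple (Matrix.toLin' P) := 
    isSemisimple_of_mul_self hIe ((toLin'_mul P P).symm.trans (by rw [hPsq, map_smul]))
  have hyss : Module.End.IsSemisimple (Matrix.toLin' y) := by
    have : Matrix.toLin' y = Matrix.toLin' P - algebraMap ℂ (Module.End ℂ (E p q)) r := by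
      rw [map_sub, map_smul _ r, toLin'_one, Algebra.algebraMap_eq_smul_one]
      rfl
    rw [this]
    exact Module.End.isSemisimple_sub_algebraMap_iff.2 hPss
  obtain ⟨h0, γ, rfl⟩ := hW
  have hb0 : b ≠ 0 := fun h => hbb (by rw [he, h, herm_zero_left])
  refine finrank_eq_one_iff'.2 ⟨⟨b, hb⟩, fun h => hb0 (congrArg Subtype.val h), ?_⟩
  -- On `W` the toral element `y` is a scalar. Hence `P` is scalar there too, nonzero since it is `i
  -- e` on `b`, and its image is the line of `b`.
  have h2 : ∀ w ∈ (⨅ x ∈ toralPart v, Module.End.eigenspace (Matrix.toLin' x) (γ x)),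
      (Complex.I * herm p q w b) • b = (γ y + r) • w := by
    intro w hw
    have h1 := mem_eigenspaces_iff.1 hw y ⟨hyv, hyss⟩
    rw [hy, sub_eq_iff_eq_add] at h1
    rw [h1, add_smul]
  have h3 : γ y + r = Complex.I * e := smul_left_injective ℂ hb0 (h2 b hb).symm
  rintro ⟨w, hw⟩
  refine ⟨(Complex.I * e)⁻¹ * (Complex.I * herm p q w b), Subtype.ext ?_⟩
  have h4 := h2 w hw
  rw [h3] at h4
  change _ • b = w
  rw [mul_smul, h4, smul_smul, inv_mul_cancel₀ hIe, one_smul]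

theorem HasType.anisotropic {W : Submodule ℂ (E p q)} {s t : ℕ} (h : HasType W s t)
    (hst : s * t = 0) {z : E p q} (hz : z ∈ W) (hz0 : z ≠ 0) : herm p q z z ≠ 0 := by
  obtain ⟨b, hb⟩ := h
  intro h0
  have h1 := herm_basis_sum hb ⟨z, hz⟩ ⟨z, hz⟩
  set a := b.equivFun ⟨z, hz⟩ with ha
  have ha0 : a ≠ 0 := fun h => hz0 (by
    have : (⟨z, hz⟩ : W) = 0 := b.equivFun.map_eq_zero_iff.1 h
    exact congrArg Subtype.val this)
  change herm p q z z = _ at h1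
  rw [h0, herm_apply] at h1
  apply ha0
  have key : ∀ {n : ℕ} (f : Fin n → ℂ), ∑ i, f i * star (f i) = 0 → ∀ i, f i = 0 := by
    intro n f hf i
    have h2 := congrArg Complex.re hf
    simp only [Complex.star_def, Complex.mul_conj, Complex.re_sum, Complex.ofReal_re,
      Complex.zero_re] at h2
    exact Complex.normSq_eq_zero.1 ((Finset.sum_eq_zero_iff_of_nonneg
      (fun i _ => Complex.normSq_nonneg (f i))).1 h2 i (Finset.mem_univ _))
  rcases Nat.mul_eq_zero.1 hst with rfl | rfl
  · have := key _ (by simpa using h1.symm)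
    ext i
    rcases i with i | i
    · exact i.elim0
    · exact this i
  · have := key _ (by simpa using h1.symm)
    ext i
    rcases i with i | i
    · exact this i
    · exact i.elim0

theorem HasType.mem_KSet (hn : 0 < p + q) {v : LieSubalgebra ℝ (Mat p q)}
    (hv : IsMASA p q v) {W : Submodule ℂ (E p q)} (hW : W ∈ jointEigenspaces (toralPart v))
    {s t : ℕ} (h : HasType W s t) (hst : s * t = 0) : s + t = 1 := by
  obtain ⟨z, hz, hz0, hzv⟩ := exists_joint_eigenvector_of_mem hv hW
  rw [← h.finrank_eq]
  exact finrank_eq_one_of_anisotropic hn hv hW hz hzv (h.anisotropic hst hz hz0)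

/-! ### Dual bases and hyperbolic pairs -/

/-- Pairing with `b` is an injective map from `W` to a space of the same dimension; the dual basis
is the preimage of the standard one. -/
theorem exists_dual_basis {W W' : Submodule ℂ (E p q)} {κ : Type*} [Fintype κ] [DecidableEq κ]
    (h : ∀ z ∈ W, (∀ w ∈ W', herm p q z w = 0) → z = 0)
    (hfr : Module.finrank ℂ W = Fintype.card κ) (b : Module.Basis κ ℂ W') :
    ∃ c : Module.Basis κ ℂ W, ∀ i j, herm p q (c i : E p q) (b j : E p q) =
      if i = j then 1 else 0 := by
  let Φ : W →ₗ[ℂ] (κ → ℂ) :=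
    { toFun := fun z j => herm p q (z : E p q) (b j : E p q)
      map_add' := fun x y => by ext j; simp [herm_add_left]
      map_smul' := fun r x => by ext j; simp [herm_smul_left] }
  have hΦ : Function.Injective Φ := by
    rw [← LinearMap.ker_eq_bot, LinearMap.ker_eq_bot']
    intro z hz
    refine Subtype.ext (h z z.2 fun w hw => ?_)
    have h1 : w = ∑ i, b.equivFun ⟨w, hw⟩ i • (b i : E p q) := coe_eq_sum_basis b ⟨w, hw⟩
    rw [h1, herm_sum_right]
    refine Finset.sum_eq_zero fun i _ => ?_
    rw [herm_smul_right, show herm p q (z : E p q) (b i : E p q) = 0 from congrFun hz i, mul_zero]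
  let e : W ≃ₗ[ℂ] (κ → ℂ) := LinearMap.linearEquivOfInjective Φ hΦ (by simp [hfr])
  refine ⟨Module.Basis.ofEquivFun e, fun i j => ?_⟩
  have h1 : Φ (Module.Basis.ofEquivFun e i) = Pi.single i 1 := by
    rw [Module.Basis.coe_ofEquivFun]
    exact e.apply_symm_apply _
  have h2 := congrFun h1 j
  rw [Pi.single_apply] at h2
  rw [show (if i = j then (1 : ℂ) else 0) = if j = i then 1 else 0 by simp only [eq_comm], ← h2]
  rfl

/-- For dual bases `c`, `b` of the two isotropic spaces, the vectors `(c k ± b k) / √2` are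
orthonormal with signs `±1`. -/
theorem hasType_sup_of_isotropic {W W' : Submodule ℂ (E p q)} {d : ℕ}
    (h : ∀ z ∈ W, (∀ w ∈ W', herm p q z w = 0) → z = 0)
    (hW : ∀ z ∈ W, ∀ w ∈ W, herm p q z w = 0) (hW' : ∀ z ∈ W', ∀ w ∈ W', herm p q z w = 0)
    (hd : Module.finrank ℂ W = d) (hd' : Module.finrank ℂ W' = d) (hdisj : Disjoint W W') :
    HasType (W ⊔ W') d d := by
  let b := Module.finBasisOfFinrankEq ℂ W' hd'
  obtain ⟨c, hc⟩ := exists_dual_basis h (by simp [hd]) b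
  let r : ℂ := ((Real.sqrt 2)⁻¹ : ℝ)
  have hr : r * star r * 2 = 1 := by
    have h1 : (Real.sqrt 2)⁻¹ * (Real.sqrt 2)⁻¹ * 2 = 1 := by
      rw [← mul_inv, Real.mul_self_sqrt (by norm_num)]; norm_num
    have h2 : star r = r := Complex.conj_ofReal _
    rw [h2]
    have h3 := congrArg (fun x : ℝ => (x : ℂ)) h1
    simpa only [Complex.ofReal_mul, Complex.ofReal_one, Complex.ofReal_ofNat] using h3
  have hcb : ∀ i j, herm p q (b i : E p q) (c j : E p q) = if i = j then 1 else 0 := by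
    intro i j
    rw [herm_symm, hc]
    by_cases hij : i = j
    · subst hij; simp
    · simp [hij, Ne.symm hij]
  refine HasType.of_family
    (Sum.elim (fun k => r • ((c k : E p q) + b k)) (fun k => r • ((c k : E p q) - b k)))
    ?_ ?_ ?_
  · have hc' : ∀ k, (c k : E p q) ∈ W ⊔ W' := fun k => Submodule.mem_sup_left (c k).2
    have hb' : ∀ k, (b k : E p q) ∈ W ⊔ W' := fun k => Submodule.mem_sup_right (b k).2
    rintro (k | k)
    · exact Submodule.smul_mem _ _ (add_mem (hc' k) (hb' k))
    · exact Submodule.smul_mem _ _ (sub_mem (hc' k) (hb' k))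
  · rintro (k | k) (l | l) <;>
      simp only [Sum.elim_inl, Sum.elim_inr, herm_smul_left, herm_smul_right, herm_add_left,
        herm_add_right, herm_sub_left, herm_sub_right, hW _ (c k).2 _ (c l).2,
        hW' _ (b k).2 _ (b l).2, hc, hcb, signMat, diagonal_apply, Sum.inl.injEq, Sum.inr.injEq,
        reduceCtorEq, if_false] <;>
      split_ifs <;> first | linear_combination hr | linear_combination -hr | ring
  · have h1 := Submodule.finrank_sup_add_finrank_inf_eq W W'
    rw [hdisj.eq_bot, finrank_bot, hd, hd', add_zero] at h1
    exact h1

theorem finrank_iSup_le_sum {V : Type*} [AddCommGroup V] [Module ℂ V] [FiniteDimensional ℂ V]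
    {ι : Type*} [Fintype ι] (U : ι → Submodule ℂ V) :
    Module.finrank ℂ (⨆ i, U i : Submodule ℂ V) ≤ ∑ i, Module.finrank ℂ (U i) := by
  classical
  rw [← Finset.sup_univ_eq_iSup]
  induction (Finset.univ : Finset ι) using Finset.induction_on with
  | empty => simp
  | insert a s ha ih =>
    rw [Finset.sup_insert, Finset.sum_insert ha]
    exact (Submodule.finrank_add_le_finrank_add_finrank _ _).trans (Nat.add_le_add_left ih _)

/-- In an orthogonal decomposition of `E` the types of the summands add up to `(p, q)`. -/
theorem sum_types_eq {ι : Type*} [Fintype ι] {U : ι → Submodule ℂ (E p q)} {s t : ι → ℕ}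
    (hU : ∀ i, HasType (U i) (s i) (t i))
    (horth : ∀ i j, i ≠ j → ∀ z ∈ U i, ∀ w ∈ U j, herm p q z w = 0) (htop : ⨆ i, U i = ⊤) :
    ∑ i, s i = p ∧ ∑ i, t i = q := by
  classical
  have hfin : ∀ i, Module.finrank ℂ (U i) = s i + t i := fun i => (hU i).finrank_eq
  choose b hb using hU
  have h1 : ∑ i, s i ≤ p := by
    have := card_le_of_gram_pos (p := p) (q := q)
      (u := fun x : Σ i, Fin (s i) => (b x.1 (Sum.inl x.2) : E p q)) (by
        rintro ⟨i, k⟩ ⟨j, l⟩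
        by_cases hij : i = j
        · subst hij
          simp [hb, signMat, diagonal_apply]
        · rw [horth i j hij _ (b i _).2 _ (b j _).2, if_neg]
          exact fun h => hij (congrArg Sigma.fst h))
    simpa using this
  have h2 : ∑ i, t i ≤ q := by
    have := card_le_of_gram_neg (p := p) (q := q)
      (u := fun x : Σ i, Fin (t i) => (b x.1 (Sum.inr x.2) : E p q)) (by
        rintro ⟨i, k⟩ ⟨j, l⟩
        by_cases hij : i = j
        · subst hij
          simp [hb, signMat, diagonal_apply]
        · rw [horth i j hij _ (b i _).2 _ (b j _).2, if_neg]
          exact fun h => hij (congrArg Sigma.fst h))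
    simpa using this
  -- Comparing total dimensions turns the two inequalities into equalities.
  have h3 := finrank_iSup_le_sum U
  rw [htop, finrank_top, Module.finrank_pi, Fintype.card_sum, Fintype.card_fin,
    Fintype.card_fin, Finset.sum_congr rfl fun i _ => hfin i, Finset.sum_add_distrib] at h3
  omega

/-! ### The `D`-invariant -/

/-- `D` is the sum of the types of the members of `K` and the dimensions of the members of `L`,
where `K`, `L` and `tau(L)` partition the joint eigenspaces of the toral part. -/
def IsDSum (v : LieSubalgebra ℝ (Mat p q)) (D : DMonoid) : Prop :=
  ∃ K L : Finset (Submodule ℂ (E p q)),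
    (∀ W, W ∈ jointEigenspaces (toralPart v) ↔ W ∈ K ∨ W ∈ L ∨ W.map (tau p q) ∈ L) ∧
    (∀ W ∈ K, W.map (tau p q) = W) ∧
    (∀ W ∈ L, W.map (tau p q) ∉ L) ∧
    ∃ (κ : Submodule ℂ (E p q) → KSet) (d : Submodule ℂ (E p q) → ℕ+),
      (∀ W ∈ K, HasType W (κ W).1.1 (κ W).1.2) ∧
      (∀ W ∈ L, Module.finrank ℂ W = d W) ∧
      D = ∑ W ∈ K, Finsupp.single (Sum.inl (κ W)) 1 + ∑ W ∈ L, Finsupp.single (Sum.inr (d W)) 1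

/-- This selects one member of each pair `{W, tau W}`: the smaller one in a well-ordering. -/
theorem exists_half {α : Type*} {σ : α → α} (hσ : Function.Involutive σ) :
    ∃ P : α → Prop, ∀ a, σ a ≠ a → (P a ↔ ¬ P (σ a)) := by
  classical
  let : LinearOrder α := linearOrderOfSTO WellOrderingRel
  refine ⟨fun a => a < σ a, fun a ha => ?_⟩
  change a < σ a ↔ ¬ σ a < σ (σ a)
  rw [hσ a, not_lt]
  exact ⟨le_of_lt, fun h => lt_of_le_of_ne h (Ne.symm ha)⟩

theorem exists_isDSum (hn : 0 < p + q) {v : LieSubalgebra ℝ (Mat p q)} (hv : IsMASA p q v)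
    (hvs : (v : Set (Mat p q)) ⊆ suMinus p q) : ∃ D, IsDSum v D := by
  classical
  have hS : toralPart v ⊆ suMinus p q := toralPart_subset.trans hvs
  have htop := sSup_jointEigenspaces toralPart_semisimple hv.toralPart_comm
  have hfin := finite_jointEigenspaces toralPart_semisimple hv.toralPart_comm
  obtain ⟨P, hP⟩ := exists_half (σ := fun W : Submodule ℂ (E p q) => W.map (tau p q))
    map_tau_map_tau
  have hmem := fun W => hfin.mem_toFinset (a := W)
  have hK : ∀ W ∈ jointEigenspaces (toralPart v), W.map (tau p q) = W →
      ∃ k : KSet, HasType W k.1.1 k.1.2 := by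
    intro W hW hWt
    obtain ⟨s, t, hst⟩ := exists_hasType W fun z hz h =>
      eq_zero_of_herm_map_tau_eq_zero hS htop hW hz (by rwa [hWt])
    exact ⟨⟨(s, t), hst.mem_KSet hn hv hW⟩, hst⟩
  have : Nonempty KSet := ⟨⟨(1, 0), by simp⟩⟩
  choose! κ hκ using hK
  have hd : ∀ W ∈ jointEigenspaces (toralPart v), ∃ d : ℕ+, Module.finrank ℂ W = d := by
    intro W hW
    have : Nontrivial W := Submodule.nontrivial_iff_ne_bot.2 hW.1
    exact ⟨⟨_, Module.finrank_pos⟩, rfl⟩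
  choose! d hd using hd
  refine ⟨_, hfin.toFinset.filter fun W => W.map (tau p q) = W,
    hfin.toFinset.filter fun W => W.map (tau p q) ≠ W ∧ P W, fun W => ?_, fun W hW => ?_,
    fun W hW hW' => ?_, κ, d, fun W hW => ?_, fun W hW => ?_, rfl⟩
  · simp only [Finset.mem_filter, hmem, map_tau_map_tau]
    constructor
    · intro hW
      by_cases h : W.map (tau p q) = W
      · exact Or.inl ⟨hW, h⟩
      · by_cases hPW : P W
        · exact Or.inr (Or.inl ⟨hW, h, hPW⟩)
        · exact Or.inr (Or.inr ⟨map_tau_mem_jointEigenspaces hS hW, Ne.symm h,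
            not_not.1 fun h' => hPW ((hP W h).2 h')⟩)
    · rintro (h | h | h)
      · exact h.1
      · exact h.1
      · rw [← map_tau_map_tau W]
        exact map_tau_mem_jointEigenspaces hS h.1
  · exact (Finset.mem_filter.1 hW).2
  · rw [Finset.mem_filter] at hW hW'
    exact (hP W hW.2.1).1 hW.2.2 hW'.2.2
  · rw [Finset.mem_filter, hmem] at hW
    exact hκ W hW.1 hW.2
  · rw [Finset.mem_filter, hmem] at hW
    exact hd W hW.1

/-- The number of joint eigenspaces of a given type. -/
noncomputable def typeCount (X : Set (Submodule ℂ (E p q))) (k : KSet) : ℕ :=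
  {W | W ∈ X ∧ HasType W k.1.1 k.1.2}.ncard

/-- The number of isotropic joint eigenspaces of a given dimension. -/
noncomputable def isotropicCount (X : Set (Submodule ℂ (E p q))) (j : ℕ+) : ℕ :=
  {W | W ∈ X ∧ (∀ z ∈ W, ∀ w ∈ W, herm p q z w = 0) ∧ Module.finrank ℂ W = j}.ncard

theorem HasType.not_isotropic {W : Submodule ℂ (E p q)} {k : KSet} (h : HasType W k.1.1 k.1.2) :
    ¬ ∀ z ∈ W, ∀ w ∈ W, herm p q z w = 0 := by
  intro h0
  obtain ⟨b, hb⟩ := h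
  have hne : Nonempty (Fin k.1.1 ⊕ Fin k.1.2) := by
    rw [← Fintype.card_pos_iff, Fintype.card_sum, Fintype.card_fin, Fintype.card_fin]
    by_contra hc
    have h1 : k.1.1 = 0 := by omega
    have := k.2 (by rw [h1, zero_mul])
    omega
  obtain ⟨i⟩ := hne
  have := hb i i
  rw [h0 _ (b i).2 _ (b i).2] at this
  exact signMat_apply_self_ne_zero i this.symm

theorem isotropic_of_map_tau_ne {S : Set (Mat p q)} (hS : S ⊆ suMinus p q)
    {W : Submodule ℂ (E p q)} (hW : W ∈ jointEigenspaces S) (hne : W.map (tau p q) ≠ W) :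
    ∀ z ∈ W, ∀ w ∈ W, herm p q z w = 0 :=
  fun _ hz _ hw => herm_eq_zero_of_ne_map_tau hS hW hW hne.symm hz hw

/-- The `tau`-stable joint eigenspaces are exactly those carrying a type from `KSet`, the others are
isotropic. So the coefficients can be read off without `tau`, `K` and `L`; the factor `2` counts `W`
and `tau W`. -/
theorem IsDSum.count {v : LieSubalgebra ℝ (Mat p q)} (hvs : (v : Set (Mat p q)) ⊆ suMinus p q)
    {D : DMonoid} (hD : IsDSum v D) :
    (∀ k, D (Sum.inl k) = typeCount (jointEigenspaces (toralPart v)) k) ∧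
    (∀ j, 2 * D (Sum.inr j) = isotropicCount (jointEigenspaces (toralPart v)) j) := by
  classical
  have hS : toralPart v ⊆ suMinus p q := toralPart_subset.trans hvs
  obtain ⟨K, L, hKL, hK, hL, κ, d, hκ, hd, rfl⟩ := hD
  have hLne : ∀ W ∈ L, W.map (tau p q) ≠ W := fun W hW h => hL W hW (by rwa [h])
  have hLiso : ∀ W ∈ L, ∀ z ∈ W, ∀ w ∈ W, herm p q z w = 0 := fun W hW =>
    isotropic_of_map_tau_ne hS ((hKL W).2 (Or.inr (Or.inl hW))) (hLne W hW)
  have hLiso' : ∀ W : Submodule ℂ (E p q), W.map (tau p q) ∈ L →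
      ∀ z ∈ W, ∀ w ∈ W, herm p q z w = 0 := fun W hW =>
    isotropic_of_map_tau_ne hS ((hKL W).2 (Or.inr (Or.inr hW)))
      fun h => hLne _ hW (congrArg (Submodule.map (tau p q)) h)
  constructor
  · intro k
    have h1 : {W | W ∈ jointEigenspaces (toralPart v) ∧ HasType W k.1.1 k.1.2} =
        ↑(K.filter fun W => κ W = k) := by
      ext W
      rw [Finset.coe_filter, Set.mem_ofPred_eq, Set.mem_ofPred_eq, hKL]
      constructor
      · rintro ⟨h | h | h, hk⟩
        · refine ⟨h, ?_⟩
          obtain ⟨h1, h2⟩ := (hκ W h).unique hk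
          exact Subtype.ext (Prod.ext h1 h2)
        · exact absurd (hLiso W h) hk.not_isotropic
        · exact absurd (hLiso' W h) hk.not_isotropic
      · rintro ⟨h, rfl⟩
        exact ⟨Or.inl h, hκ W h⟩
    rw [typeCount, h1, Set.ncard_coe_finset, Finset.card_filter]
    simp [Finsupp.single_apply]
  · intro j
    have h1 : {W | W ∈ jointEigenspaces (toralPart v) ∧ (∀ z ∈ W, ∀ w ∈ W, herm p q z w = 0) ∧
        Module.finrank ℂ W = j} = ↑((L.filter fun W => d W = j) ∪
          (L.filter fun W => d W = j).image (Submodule.map (tau p q))) := by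
      ext W
      simp only [Finset.coe_union, Finset.coe_image, Finset.coe_filter, Set.mem_union,
        Set.mem_ofPred_eq, hKL, Set.mem_image]
      constructor
      · rintro ⟨h | h | h, hk, hj⟩
        · exact absurd hk (hκ W h).not_isotropic
        · exact Or.inl ⟨h, PNat.coe_injective ((hd W h).symm.trans hj)⟩
        · refine Or.inr ⟨_, ⟨h, PNat.coe_injective ((hd _ h).symm.trans ?_)⟩, map_tau_map_tau W⟩
          rw [finrank_map_tau, hj]
      · rintro (⟨h, rfl⟩ | ⟨W, ⟨h, rfl⟩, rfl⟩)
        · exact ⟨Or.inr (Or.inl h), hLiso W h, hd W h⟩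
        · have h' : (W.map (tau p q)).map (tau p q) ∈ L := by rwa [map_tau_map_tau]
          exact ⟨Or.inr (Or.inr h'), hLiso' _ h', by rw [finrank_map_tau, hd W h]⟩
    rw [isotropicCount, h1, Set.ncard_coe_finset, Finset.card_union_of_disjoint,
      Finset.card_image_of_injective _ map_tau_injective, Finset.card_filter]
    · simp [Finsupp.single_apply]
      ring
    · rw [Finset.disjoint_left]
      intro W hW hW'
      obtain ⟨W', h', rfl⟩ := Finset.mem_image.1 hW'
      exact hL W' (Finset.mem_filter.1 h').1 (Finset.mem_filter.1 hW).1

theorem herm_act {g : SL p q} (hg : g ∈ groupSU p q) (z w : E p q) :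
    herm p q (act g z) (act g w) = herm p q z w := groupSU_herm hg z w

theorem HasType.map_act {g : SL p q} (hg : g ∈ groupSU p q) {W : Submodule ℂ (E p q)} {s t : ℕ}
    (h : HasType W s t) : HasType (W.map (act g : E p q →ₗ[ℂ] E p q)) s t := by
  obtain ⟨b, hb⟩ := h
  refine ⟨b.map ((act g).submoduleMap W), fun i j => ?_⟩
  rw [← hb]
  exact herm_act hg _ _

theorem map_act_inv_map_act (g : SL p q) (W : Submodule ℂ (E p q)) :
    (W.map (act g : E p q →ₗ[ℂ] E p q)).map (act g⁻¹ : E p q →ₗ[ℂ] E p q) = W := by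
  rw [← Submodule.map_comp]
  convert Submodule.map_id W using 2
  ext1 z
  exact LinearMap.ext fun c => act_inv_act g _

theorem map_act_injective (g : SL p q) :
    Function.Injective (Submodule.map (act g : E p q →ₗ[ℂ] E p q)) :=
  Function.LeftInverse.injective (map_act_inv_map_act g)

theorem hasType_map_act_iff {g : SL p q} (hg : g ∈ groupSU p q) {W : Submodule ℂ (E p q)}
    {s t : ℕ} : HasType (W.map (act g : E p q →ₗ[ℂ] E p q)) s t ↔ HasType W s t := by
  refine ⟨fun h => ?_, HasType.map_act hg⟩
  have := h.map_act (inv_mem_groupSU hg)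
  rwa [map_act_inv_map_act] at this

theorem ncard_sep_image {α : Type*} {f : α → α} (hf : Function.Injective f) (X : Set α)
    {P : α → Prop} (hP : ∀ a, P (f a) ↔ P a) :
    {a | a ∈ f '' X ∧ P a}.ncard = {a | a ∈ X ∧ P a}.ncard := by
  rw [← Set.ncard_image_of_injective {a | a ∈ X ∧ P a} hf]
  congr 1
  ext b
  constructor
  · rintro ⟨⟨a, ha, rfl⟩, h⟩
    exact ⟨a, ⟨ha, (hP a).1 h⟩, rfl⟩
  · rintro ⟨a, ⟨ha, h⟩, rfl⟩
    exact ⟨⟨a, ha, rfl⟩, (hP a).2 h⟩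

theorem typeCount_image {g : SL p q} (hg : g ∈ groupSU p q) (X : Set (Submodule ℂ (E p q)))
    (k : KSet) :
    typeCount (Submodule.map (act g : E p q →ₗ[ℂ] E p q) '' X) k = typeCount X k :=
  ncard_sep_image (map_act_injective g) X fun _ => hasType_map_act_iff hg

theorem isotropicCount_image {g : SL p q} (hg : g ∈ groupSU p q)
    (X : Set (Submodule ℂ (E p q))) (j : ℕ+) :
    isotropicCount (Submodule.map (act g : E p q →ₗ[ℂ] E p q) '' X) j = isotropicCount X j := by
  refine ncard_sep_image (map_act_injective g) X fun W => and_congr ?_ ?_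
  · constructor
    · intro h z hz w hw
      rw [← herm_act hg]
      exact h _ (Submodule.mem_map_of_mem hz) _ (Submodule.mem_map_of_mem hw)
    · rintro h _ ⟨z, hz, rfl⟩ _ ⟨w, hw, rfl⟩
      exact (herm_act hg z w).trans (h z hz w hw)
  · rw [LinearEquiv.finrank_map_eq]

/-- For any two admissible conjugating elements, the counts of `IsDSum.count` both agree with those
of `v` itself. -/
theorem existsUnique_isDInvariant (hn : 0 < p + q) {v : LieSubalgebra ℝ (Mat p q)}
    (hv : IsQualifyingMASA p q v) : ∃! D, IsDInvariant v D := by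
  obtain ⟨g, hg, hgv⟩ := hv.exists_groupSU hn
  obtain ⟨D, hD⟩ := exists_isDSum hn (hv.1.map_Ad hg) hgv
  refine ⟨D, ⟨g, hg, hgv, hD⟩, ?_⟩
  rintro D' ⟨k, hk, hkv, hD'⟩
  have h1 := IsDSum.count hgv hD
  have h2 := IsDSum.count hkv hD'
  rw [jointEigenspaces_map_Ad] at h1 h2
  ext (i | j)
  · rw [h1.1, h2.1, typeCount_image hg, typeCount_image hk]
  · apply Nat.eq_of_mul_eq_mul_left two_pos
    rw [h1.2, h2.2, isotropicCount_image hg, isotropicCount_image hk]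

/-! ### The type of the `D`-invariant -/

theorem mem_DSet_add {p q p' q' : ℕ} {D D' : DMonoid} (h : D ∈ DSet p q) (h' : D' ∈ DSet p' q') :
    D + D' ∈ DSet (p + p') (q + q') := by
  constructor <;> rw [Finsupp.sum_add_index' (by simp) (by intros; ring)]
  · rw [← h.1, ← h'.1]
  · rw [← h.2, ← h'.2]

theorem mem_DSet_sum {ι : Type*} (s : Finset ι) (j : ι → JSet) :
    ∑ i ∈ s, Finsupp.single (j i) 1 ∈
      DSet (∑ i ∈ s, (j i).weight.1) (∑ i ∈ s, (j i).weight.2) := by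
  classical
  induction s using Finset.induction_on with
  | empty => simp [DSet]
  | insert a s ha ih =>
    simp only [Finset.sum_insert ha]
    exact mem_DSet_add (by simp [DSet]) ih

/-- The total type is a function of `D`; this recovers numerical identities for `p` and `q` from a
presentation of `D`. -/
theorem mem_DSet_unique {p q p' q' : ℕ} {D : DMonoid} (h : D ∈ DSet p q) (h' : D ∈ DSet p' q') :
    p = p' ∧ q = q' := ⟨h.1.trans h'.1.symm, h.2.trans h'.2.symm⟩

theorem IsDSum.mem_DSet {v : LieSubalgebra ℝ (Mat p q)} (hv : IsMASA p q v)
    (hvs : (v : Set (Mat p q)) ⊆ suMinus p q) {D : DMonoid} (hD : IsDSum v D) : D ∈ DSet p q := by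
  classical
  have hS : toralPart v ⊆ suMinus p q := toralPart_subset.trans hvs
  have htop := sSup_jointEigenspaces toralPart_semisimple hv.toralPart_comm
  have hind := sSupIndep_jointEigenspaces toralPart_semisimple hv.toralPart_comm
  obtain ⟨K, L, hKL, hK, hL, κ, d, hκ, hd, rfl⟩ := hD
  have hKm : ∀ W ∈ K, W ∈ jointEigenspaces (toralPart v) := fun W h => (hKL W).2 (Or.inl h)
  have hLm : ∀ W ∈ L, W ∈ jointEigenspaces (toralPart v) := fun W h =>
    (hKL W).2 (Or.inr (Or.inl h))
  have hLt : ∀ W ∈ L, W.map (tau p q) ∈ jointEigenspaces (toralPart v) := fun W h =>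
    map_tau_mem_jointEigenspaces hS (hLm W h)
  have hLne : ∀ W ∈ L, W.map (tau p q) ≠ W := fun W hW h => hL W hW (by rwa [h])
  have hLpair : ∀ W ∈ L, HasType (W ⊔ W.map (tau p q)) (d W) (d W) := fun W hW =>
    hasType_sup_of_isotropic
      (fun z hz h => eq_zero_of_herm_map_tau_eq_zero hS htop (hLm W hW) hz h)
      (isotropic_of_map_tau_ne hS (hLm W hW) (hLne W hW))
      (isotropic_of_map_tau_ne hS (hLt W hW) (by rw [map_tau_map_tau]; exact (hLne W hW).symm))
      (hd W hW) (by rw [finrank_map_tau, hd W hW])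
      (hind.pairwiseDisjoint (hLm W hW) (hLt W hW) (hLne W hW).symm)
  -- The orthogonal summands of `E`: the members of `K`, and a hyperbolic sum for each member of
  -- `L`.
  let U : K ⊕ L → Submodule ℂ (E p q) :=
    Sum.elim (fun W => W) fun W => W.1 ⊔ W.1.map (tau p q)
  let j : K ⊕ L → JSet := Sum.elim (fun W => Sum.inl (κ W)) fun W => Sum.inr (d W)
  have hU : ∀ i, HasType (U i) (j i).weight.1 (j i).weight.2 := by
    rintro (W | W)
    · exact hκ W W.2
    · exact hLpair W W.2
  have horth : ∀ i i', i ≠ i' → ∀ z ∈ U i, ∀ w ∈ U i', herm p q z w = 0 := by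
    have key : ∀ W ∈ jointEigenspaces (toralPart v), ∀ W' ∈ jointEigenspaces (toralPart v),
        W' ≠ W.map (tau p q) → ∀ z ∈ W, ∀ w ∈ W', herm p q z w = 0 :=
      fun W hW W' hW' h z hz w hw => herm_eq_zero_of_ne_map_tau hS hW hW' h hz hw
    have hKL' : ∀ W ∈ K, ∀ W' ∈ L, ∀ z ∈ W, ∀ w ∈ W' ⊔ W'.map (tau p q), herm p q z w = 0 := by
      intro W hW W' hW' z hz w hw
      obtain ⟨a, ha, b, hb, rfl⟩ := Submodule.mem_sup.1 hw
      rw [herm_add_right, key W (hKm W hW) _ (hLm W' hW') (fun h => ?_) z hz a ha,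
        key W (hKm W hW) _ (hLt W' hW') (fun h => ?_) z hz b hb, add_zero]
      · have := map_tau_injective h
        subst this
        exact hLne _ hW' (hK _ hW)
      · rw [hK W hW] at h
        subst h
        exact hLne _ hW' (hK _ hW)
    rintro (W | W) (W' | W') hne z hz w hw
    · refine key W (hKm W W.2) W' (hKm W' W'.2) (fun h => hne ?_) z hz w hw
      rw [hK W W.2] at h
      exact congrArg Sum.inl (Subtype.ext h.symm)
    · exact hKL' W W.2 W' W'.2 z hz w hw
    · exact herm_eq_zero_symm (hKL' W' W'.2 W W.2 w hw z hz)
    · have hne' : W.1 ≠ W'.1 := fun h => hne (congrArg Sum.inr (Subtype.ext h))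
      obtain ⟨a, ha, b, hb, rfl⟩ := Submodule.mem_sup.1 hz
      obtain ⟨a', ha', b', hb', rfl⟩ := Submodule.mem_sup.1 hw
      have h1 : W'.1 ≠ W.1.map (tau p q) := fun h => hL W W.2 (h ▸ W'.2)
      have h2 : W.1 ≠ W'.1.map (tau p q) := fun h => hL W' W'.2 (h ▸ W.2)
      rw [herm_add_left, herm_add_right, herm_add_right,
        key W (hLm W W.2) W' (hLm W' W'.2) h1 a ha a' ha',
        key W (hLm W W.2) _ (hLt W' W'.2) (fun h => hne' (map_tau_injective h.symm)) a ha b' hb',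
        key _ (hLt W W.2) W' (hLm W' W'.2) (by rw [map_tau_map_tau]; exact hne'.symm) b hb a' ha',
        key _ (hLt W W.2) _ (hLt W' W'.2) (by rw [map_tau_map_tau]; exact h2.symm) b hb b' hb']
      simp
  have hUtop : ⨆ i, U i = ⊤ := by
    rw [eq_top_iff, ← htop]
    refine sSup_le fun W hW => ?_
    rcases (hKL W).1 hW with h | h | h
    · exact le_iSup U (Sum.inl ⟨W, h⟩)
    · exact le_trans le_sup_left (le_iSup U (Sum.inr ⟨W, h⟩))
    · refine le_trans ?_ (le_iSup U (Sum.inr ⟨_, h⟩))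
      refine le_trans ?_ le_sup_right
      exact (map_tau_map_tau W).ge
  have h1 := mem_DSet_sum Finset.univ j
  obtain ⟨h2, h3⟩ := sum_types_eq hU horth hUtop
  rw [h2, h3] at h1
  convert h1 using 1
  rw [Fintype.sum_sum_type]
  simp only [j, Sum.elim_inl, Sum.elim_inr]
  rw [Finset.sum_coe_sort K fun W => Finsupp.single (Sum.inl (κ W) : JSet) 1,
    Finset.sum_coe_sort L fun W => Finsupp.single (Sum.inr (d W) : JSet) 1]

theorem IsDInvariant.mem_DSet {v : LieSubalgebra ℝ (Mat p q)} (hv : IsMASA p q v) {D : DMonoid}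
    (hD : IsDInvariant v D) : D ∈ DSet p q := by
  obtain ⟨g, hg, hgv, h⟩ := hD
  exact IsDSum.mem_DSet (hv.map_Ad hg) hgv h

/-! ### Finiteness of the set of conjugacy classes of centralizers -/

/-- Since `S` acts by scalars on joint eigenspaces that span `E`, commuting with `S` means
preserving them. The centralizer thus depends on `S` only through `jointEigenspaces S`. -/
theorem mem_centralizerSU_iff {S : Set (Mat p q)}
    (htop : sSup (jointEigenspaces S) = ⊤) {x : Mat p q} :
    x ∈ centralizerSU p q S ↔ x ∈ su p q ∧ ∀ W ∈ jointEigenspaces S, ∀ z ∈ W, x *ᵥ z ∈ W := by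
  change (x ∈ su p q ∧ ∀ y ∈ S, ⁅x, y⁆ = 0) ↔ _
  refine and_congr_right fun _ => ⟨fun h => ?_, fun h y hy => ?_⟩
  · rintro _ ⟨-, γ, rfl⟩ z hz
    rw [mem_eigenspaces_iff] at hz ⊢
    intro y hy
    have h1 := h y hy
    rw [Ring.lie_def, sub_eq_zero] at h1
    rw [mulVec_mulVec, ← h1, ← mulVec_mulVec, hz y hy, mulVec_smul]
  · rw [Ring.lie_def, sub_eq_zero]
    refine toLin'.injective (LinearMap.ext fun z => ?_)
    rw [toLin'_apply, toLin'_apply, ← mulVec_mulVec, ← mulVec_mulVec]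
    have hz : z ∈ sSup (jointEigenspaces S) := htop ▸ Submodule.mem_top
    rw [sSup_eq_iSup'] at hz
    induction hz using Submodule.iSup_induction' with
    | mem W z hz =>
      have hxz := h W W.2 z hz
      obtain ⟨-, γ, hγ⟩ := W.2
      rw [hγ] at hz hxz
      rw [mem_eigenspaces_iff.1 hz y hy, mem_eigenspaces_iff.1 hxz y hy, mulVec_smul]
    | zero => simp
    | add a b _ _ ha hb => simp only [mulVec_add, ha, hb]

theorem centralizerSU_eq_map_Ad {S S' : Set (Mat p q)} (htop : sSup (jointEigenspaces S) = ⊤)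
    (htop' : sSup (jointEigenspaces S') = ⊤) {g : SL p q} (hg : g ∈ groupSU p q)
    (h : jointEigenspaces S' =
      Submodule.map (act g : E p q →ₗ[ℂ] E p q) '' jointEigenspaces S) :
    centralizerSU p q S' = (centralizerSU p q S).map (Ad g) := by
  ext y
  rw [LieSubalgebra.mem_map, mem_centralizerSU_iff htop', h, Set.forall_mem_image]
  constructor
  · rintro ⟨hy, hyW⟩
    refine ⟨Ad g⁻¹ y, (mem_centralizerSU_iff htop).2 ⟨Ad_mem_su (inv_mem_groupSU hg) hy,
      fun W hW z hz => ?_⟩, Ad_Ad_inv g y⟩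
    obtain ⟨w, hw, hwy⟩ := hyW hW _ (Submodule.mem_map_of_mem hz)
    have h1 : Ad g⁻¹ y *ᵥ z = w := by
      rw [← act_inv_act g z, Ad_mulVec_act, ← act_inv_act g w]
      exact congrArg _ hwy.symm
    rwa [h1]
  · rintro ⟨x, hx, rfl⟩
    obtain ⟨hx, hxW⟩ := (mem_centralizerSU_iff htop).1 hx
    refine ⟨Ad_mem_su hg hx, fun W hW => ?_⟩
    rintro _ ⟨z, hz, rfl⟩
    exact ⟨x *ᵥ z, hxW W hW z hz, (Ad_mulVec_act g x z).symm⟩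

theorem conjClassSU_map_Ad {g : SL p q} (hg : g ∈ groupSU p q)
    (c : LieSubalgebra ℝ (Mat p q)) : conjClassSU (c.map (Ad g)) = conjClassSU c := by
  ext d
  constructor
  · rintro ⟨k, hk, rfl⟩
    exact ⟨k * g, mul_mem_groupSU hk hg, (map_Ad_mul k g c).symm⟩
  · rintro ⟨k, hk, rfl⟩
    refine ⟨k * g⁻¹, mul_mem_groupSU hk (inv_mem_groupSU hg), ?_⟩
    rw [map_Ad_mul, map_Ad_inv_map]

/-- The values of the form on the vectors of an adapted basis. -/
abbrev GramValue : Type := ({0, 1, -1} : Set ℂ)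

/-- A `tau`-stable space gets an orthonormal basis. In a pair `W`, `tau W` one member gets an
arbitrary basis and the other its dual; all remaining products vanish by orthogonality. -/
theorem exists_block_bases {S : Set (Mat p q)} (hS : S ⊆ suMinus p q)
    (htop : sSup (jointEigenspaces S) = ⊤) :
    ∃ b : ∀ W : Submodule ℂ (E p q), Module.Basis (Fin (Module.finrank ℂ W)) ℂ W,
      ∀ W ∈ jointEigenspaces S, ∀ W' ∈ jointEigenspaces S, ∀ i j,
        herm p q (b W i : E p q) (b W' j : E p q) ∈ ({0, 1, -1} : Set ℂ) := by
  classical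
  have hite : ∀ (P : Prop) [Decidable P], (if P then (1 : ℂ) else 0) ∈ ({0, 1, -1} : Set ℂ) := by
    intro P _
    split_ifs <;> simp
  have hstar : ∀ z ∈ ({0, 1, -1} : Set ℂ), star z ∈ ({0, 1, -1} : Set ℂ) := by
    rintro z (rfl | rfl | rfl) <;> simp
  obtain ⟨P, hP⟩ := exists_half (σ := fun W : Submodule ℂ (E p q) => W.map (tau p q))
    map_tau_map_tau
  let f : ∀ W : Submodule ℂ (E p q), Module.Basis (Fin (Module.finrank ℂ W)) ℂ W :=
    fun W => Module.finBasis ℂ W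
  -- The space `W'` with `W' = tau W` is a variable, so that the basis `f W'`, whose index type
  -- depends on `W'`, needs no transport later.
  have hb : ∀ W : Submodule ℂ (E p q), ∃ b : Module.Basis (Fin (Module.finrank ℂ W)) ℂ W,
      W ∈ jointEigenspaces S →
      (W.map (tau p q) = W → ∀ i j,
        herm p q (b i : E p q) (b j : E p q) ∈ ({0, 1, -1} : Set ℂ)) ∧
      (W.map (tau p q) ≠ W → P W → b = f W) ∧
      (W.map (tau p q) ≠ W → ¬ P W → ∀ W', W' = W.map (tau p q) → ∀ i j,
        herm p q (b i : E p q) (f W' j : E p q) ∈ ({0, 1, -1} : Set ℂ)) := by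
    intro W
    by_cases hW : W ∈ jointEigenspaces S
    swap
    · exact ⟨f W, fun h => absurd h hW⟩
    by_cases hWt : W.map (tau p q) = W
    · obtain ⟨s, t, b, hb⟩ := exists_hasType W fun z hz h =>
        eq_zero_of_herm_map_tau_eq_zero hS htop hW hz (by rwa [hWt])
      have hc : Fintype.card (Fin s ⊕ Fin t) = Module.finrank ℂ W :=
        (Module.finrank_eq_card_basis b).symm
      refine ⟨b.reindex (Fintype.equivFinOfCardEq hc), fun _ => ⟨fun _ i j => ?_,
        fun h => absurd hWt h, fun h => absurd hWt h⟩⟩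
      rw [Module.Basis.reindex_apply, Module.Basis.reindex_apply, hb, signMat_eq_ite]
      split_ifs
      · rcases (Fintype.equivFinOfCardEq hc).symm i with k | k <;> simp [signMat]
      · simp
    · by_cases hPW : P W
      · exact ⟨f W, fun _ => ⟨fun h => absurd h hWt, fun _ _ => rfl, fun _ h => absurd hPW h⟩⟩
      · obtain ⟨c, hc⟩ := exists_dual_basis
          (fun z hz h => eq_zero_of_herm_map_tau_eq_zero hS htop hW hz h)
          (by rw [Fintype.card_fin, finrank_map_tau]) (f (W.map (tau p q)))
        refine ⟨c.reindex (finCongr (finrank_map_tau W)), fun _ => ⟨fun h => absurd h hWt,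
          fun _ h => absurd h hPW, ?_⟩⟩
        rintro - - W' rfl i j
        rw [Module.Basis.reindex_apply, hc]
        exact hite _
  choose b hb using hb
  refine ⟨b, fun W hW W' hW' i j => ?_⟩
  by_cases hWW : W' = W.map (tau p q)
  swap
  · rw [herm_eq_zero_of_ne_map_tau hS hW hW' hWW (b W i).2 (b W' j).2]
    simp
  by_cases hWt : W.map (tau p q) = W
  · obtain rfl := hWW.trans hWt
    exact (hb W' hW).1 hWt i j
  have hWW2 : W = W'.map (tau p q) := by rw [hWW, map_tau_map_tau]
  have hWt' : W'.map (tau p q) ≠ W' := fun h => hWt (by rw [← hWW, hWW2, h])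
  by_cases hPW : P W
  · have hPW' : ¬ P W' := hWW ▸ (hP W hWt).1 hPW
    rw [(hb W hW).2.1 hWt hPW, herm_symm]
    exact hstar _ ((hb W' hW').2.2 hWt' hPW' W hWW2 j i)
  · have hPW' : P W' := by
      by_contra h
      exact hPW ((hP W hWt).2 (hWW ▸ h))
    rw [(hb W' hW').2.1 hWt' hPW']
    exact (hb W hW).2.2 hWt hPW W' hWW i j

/-- A basis with the given Gram matrix that is compatible with a family of subspaces, which
correspond to the classes of a relation on the index set. -/
def IsAdapted (X : Set (Submodule ℂ (E p q))) (c : Module.Basis (Fin (p + q)) ℂ (E p q))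
    (G : Fin (p + q) → Fin (p + q) → GramValue) (R : Fin (p + q) → Fin (p + q) → Prop) : Prop :=
  (∀ i j, herm p q (c i) (c j) = G i j) ∧
    X = Set.range fun i => Submodule.span ℂ (c '' {j | R i j})

/-- The bases of the blocks are concatenated, and `R i j` says that the basis vectors `i` and `j`
lie in the same joint eigenspace. -/
theorem exists_isAdapted {S : Set (Mat p q)} (hS : S ⊆ suMinus p q)
    (hind : sSupIndep (jointEigenspaces S)) (htop : sSup (jointEigenspaces S) = ⊤) :
    ∃ c G R, IsAdapted (jointEigenspaces S) c G R := by
  classical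
  obtain ⟨b, hb⟩ := exists_block_bases hS htop
  have hfin : Finite (jointEigenspaces S) := WellFoundedGT.finite_of_sSupIndep hind
  have hint : DirectSum.IsInternal fun W : jointEigenspaces S => (W : Submodule ℂ (E p q)) :=
    DirectSum.isInternal_submodule_of_iSupIndep_of_iSup_eq_top
      ((sSupIndep_iff _).1 hind) (by rw [← sSup_eq_iSup', htop])
  have : Fintype (jointEigenspaces S) := Fintype.ofFinite _
  let e := hint.collectedBasis fun W => b W
  have hcard : Fintype.card (Σ W : jointEigenspaces S, Fin (Module.finrank ℂ W.1)) = p + q := by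
    rw [← Module.finrank_eq_card_basis e, Module.finrank_pi, Fintype.card_sum, Fintype.card_fin,
      Fintype.card_fin]
  let σ := Fintype.equivFinOfCardEq hcard
  have he : ∀ i, e.reindex σ i = (b (σ.symm i).1 (σ.symm i).2 : E p q) := by
    intro i
    rw [Module.Basis.reindex_apply, hint.collectedBasis_coe]
  have hspan : ∀ W : jointEigenspaces S,
      Submodule.span ℂ (e.reindex σ '' {j | (σ.symm j).1 = W}) = W := by
    intro W
    apply le_antisymm
    · rw [Submodule.span_le]
      rintro _ ⟨j, rfl, rfl⟩
      rw [he]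
      exact (b _ _).2
    · intro z hz
      have h1 : z = ∑ i, (b W).equivFun ⟨z, hz⟩ i • (b W i : E p q) := coe_eq_sum_basis _ ⟨z, hz⟩
      rw [h1]
      refine Submodule.sum_mem _ fun i _ => Submodule.smul_mem _ _ (Submodule.subset_span ?_)
      refine ⟨σ ⟨W, i⟩, ?_, ?_⟩
      · change (σ.symm (σ ⟨W, i⟩)).1 = W
        rw [Equiv.symm_apply_apply]
      · rw [he, Equiv.symm_apply_apply]
  refine ⟨e.reindex σ, fun i j => ⟨_, hb _ (σ.symm i).1.2 _ (σ.symm j).1.2 (σ.symm i).2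
    (σ.symm j).2⟩, fun i j => (σ.symm j).1 = (σ.symm i).1, fun i j => ?_, ?_⟩
  · rw [he, he]
  · ext W
    constructor
    · intro hW
      have : Nontrivial W := Submodule.nontrivial_iff_ne_bot.2 hW.1
      refine ⟨σ ⟨⟨W, hW⟩, ⟨0, Module.finrank_pos⟩⟩, ?_⟩
      simp only [Equiv.symm_apply_apply]
      exact hspan ⟨W, hW⟩
    · rintro ⟨i, rfl⟩
      simp only [hspan]
      exact (σ.symm i).1.2

/-- The linear map `c i ↦ c' i` preserves the Gram matrix and carries the spans to the spans;
normalizing its determinant by a scalar does not change images of subspaces. -/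
theorem IsAdapted.exists_groupSU (hn : 0 < p + q) {X X' : Set (Submodule ℂ (E p q))}
    {c c' : Module.Basis (Fin (p + q)) ℂ (E p q)} {G : Fin (p + q) → Fin (p + q) → GramValue}
    {R : Fin (p + q) → Fin (p + q) → Prop} (h : IsAdapted X c G R) (h' : IsAdapted X' c' G R) :
    ∃ g ∈ groupSU p q, X' = Submodule.map (act g : E p q →ₗ[ℂ] E p q) '' X := by
  let T : E p q ≃ₗ[ℂ] E p q := c.equiv c' (Equiv.refl _)
  have hT : ∀ i, T (c i) = c' i := fun i => by simp [T]
  have hTz : ∀ z, herm p q (T z) (T z) = herm p q z z := by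
    intro z
    rw [← c.sum_equivFun z]
    simp only [map_sum, map_smul, hT, herm_sum_left, herm_sum_right, herm_smul_left,
      herm_smul_right, h.1, h'.1]
  obtain ⟨g, hg, a, ha, hga⟩ := exists_groupSU_smul hn
    (M := LinearMap.toMatrix' (T : E p q →ₗ[ℂ] E p q)) fun z => by
      rw [← toLin'_apply, toLin'_toMatrix']
      exact hTz z
  have hact : (act g : E p q →ₗ[ℂ] E p q) = a • (T : E p q →ₗ[ℂ] E p q) := by
    refine LinearMap.ext fun z => ?_
    change g.1 *ᵥ z = _
    rw [hga, smul_mulVec, ← toLin'_apply, toLin'_toMatrix']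
    rfl
  refine ⟨g, hg, ?_⟩
  rw [h.2, h'.2, ← Set.range_comp]
  congr 1
  funext i
  rw [Function.comp, hact, Submodule.map_smul _ _ a ha, Submodule.map_span, ← Set.image_comp]
  congr 1
  exact Set.image_congr fun j _ => (hT j).symm

theorem finite_conjClasses (hn : 0 < p + q) :
    Set.Finite {c : Set (LieSubalgebra ℝ (Mat p q)) |
      ∃ v : LieSubalgebra ℝ (Mat p q), IsQualifyingMASA p q v ∧
        c = conjClassSU (centralizerSU p q (toralPart v))} := by
  have key : ∀ c : {c : Set (LieSubalgebra ℝ (Mat p q)) |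
      ∃ v : LieSubalgebra ℝ (Mat p q), IsQualifyingMASA p q v ∧
        c = conjClassSU (centralizerSU p q (toralPart v))},
      ∃ d : (Fin (p + q) → Fin (p + q) → GramValue) × (Fin (p + q) → Fin (p + q) → Prop),
      ∃ w : LieSubalgebra ℝ (Mat p q), sSup (jointEigenspaces (toralPart w)) = ⊤ ∧
        c.1 = conjClassSU (centralizerSU p q (toralPart w)) ∧
        ∃ b, IsAdapted (jointEigenspaces (toralPart w)) b d.1 d.2 := by
    rintro ⟨_, v, hv, rfl⟩
    obtain ⟨g, hg, hgv⟩ := hv.exists_groupSU hn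
    have hm := hv.1.map_Ad hg
    have htop := sSup_jointEigenspaces toralPart_semisimple hm.toralPart_comm
    obtain ⟨b, G, R, h⟩ := exists_isAdapted (toralPart_subset.trans hgv)
      (sSupIndep_jointEigenspaces toralPart_semisimple hm.toralPart_comm) htop
    refine ⟨(G, R), v.map (Ad g), htop, ?_, b, h⟩
    rw [centralizerSU_eq_map_Ad (sSup_jointEigenspaces toralPart_semisimple hv.1.toralPart_comm)
      htop hg (jointEigenspaces_map_Ad g v), conjClassSU_map_Ad hg]
  choose d w htop hc b hb using key
  -- The pairs `(G, R)` range over a finite type, so injectivity of this choice proves finiteness.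
  have hinj : Function.Injective d := by
    intro c c' hcc
    have h1 := hb c
    have h2 := hb c'
    rw [← hcc] at h2
    obtain ⟨g, hg, h3⟩ := h1.exists_groupSU hn h2
    apply Subtype.ext
    rw [hc, hc, centralizerSU_eq_map_Ad (htop c) (htop c') hg h3, conjClassSU_map_Ad hg]
  exact Set.finite_coe_iff.1 (Finite.of_injective d hinj)

/-! ### Commutative Frobenius algebras with a real structure -/

/-- The signs `1` on the first and `-1` on the second summand. -/
def sgn {I J : Type} : I ⊕ J → ℂ := Sum.elim (fun _ => 1) (fun _ => -1)

theorem sgn_ne_zero {I J : Type} (i : I ⊕ J) : sgn i ≠ 0 := by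
  rcases i with i | i <;> simp [sgn]

theorem star_sgn {I J : Type} (i : I ⊕ J) : star (sgn i) = sgn i := by
  rcases i with i | i <;> simp [sgn]

theorem signMat_apply (s t : ℕ) (i j : Fin s ⊕ Fin t) :
    signMat s t i j = if i = j then sgn i else 0 := by
  rw [signMat, diagonal_apply]
  rfl

/-- A commutative complex Frobenius algebra with a conjugation and with a real basis that is
orthogonal with respect to the Frobenius form, the first part of the basis being positive and the
second one being negative. -/
structure SplitFrobenius (I J : Type) [DecidableEq I] [DecidableEq J]
    (B : Type) [CommRing B] [Algebra ℂ B] where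
  basis : Module.Basis (I ⊕ J) ℂ B
  form : B →ₗ[ℂ] ℂ
  conj : B →+* B
  conj_smul : ∀ (c : ℂ) (b : B), conj (c • b) = star c • conj b
  conj_basis : ∀ i, conj (basis i) = basis i
  form_basis : ∀ i j, form (basis i * basis j) = if i = j then sgn i else 0

namespace SplitFrobenius

variable {I J I' J' : Type} [DecidableEq I] [DecidableEq J] [DecidableEq I'] [DecidableEq J']
  {B B' : Type} [CommRing B] [Algebra ℂ B] [CommRing B'] [Algebra ℂ B']

theorem linearIndependent_of_form [Fintype I] [Fintype J] (φ : B →ₗ[ℂ] ℂ) (u : I ⊕ J → B)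
    (h : ∀ i j, φ (u i * u j) = if i = j then sgn i else 0) : LinearIndependent ℂ u := by
  rw [Fintype.linearIndependent_iff]
  intro g hg j
  have h1 : φ ((∑ i, g i • u i) * u j) = g j * sgn j := by
    rw [Finset.sum_mul, map_sum, Finset.sum_eq_single j]
    · rw [smul_mul_assoc, map_smul, h, if_pos rfl, smul_eq_mul]
    · intro i _ hij
      rw [smul_mul_assoc, map_smul, h, if_neg hij, smul_zero]
    · simp
  rw [hg, zero_mul, map_zero] at h1
  exact (mul_eq_zero.1 h1.symm).resolve_right (sgn_ne_zero j)

/-- The structure given by a conjugation-invariant orthogonal family of the right cardinality. -/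
noncomputable def ofFamily [Fintype I] [Fintype J] [FiniteDimensional ℂ B] (φ : B →ₗ[ℂ] ℂ)
    (σ : B →+* B) (hσ : ∀ (c : ℂ) (b : B), σ (c • b) = star c • σ b) (u : I ⊕ J → B)
    (hu : ∀ i, σ (u i) = u i) (h : ∀ i j, φ (u i * u j) = if i = j then sgn i else 0)
    (hc : Fintype.card (I ⊕ J) = Module.finrank ℂ B) : SplitFrobenius I J B where
  basis := Module.Basis.mk (linearIndependent_of_form φ u h)
    ((linearIndependent_of_form φ u h).span_eq_top_of_card_eq_finrank' hc).ge
  form := φ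
  conj := σ
  conj_smul := hσ
  conj_basis i := by rw [Module.Basis.mk_apply, hu]
  form_basis i j := by rw [Module.Basis.mk_apply, Module.Basis.mk_apply, h]

/-- Change of the index sets. -/
noncomputable def reindex (F : SplitFrobenius I J B) (e : I ≃ I') (f : J ≃ J') :
    SplitFrobenius I' J' B where
  basis := F.basis.reindex (Equiv.sumCongr e f)
  form := F.form
  conj := F.conj
  conj_smul := F.conj_smul
  conj_basis i := by rw [Module.Basis.reindex_apply, F.conj_basis]
  form_basis i j := by
    rw [Module.Basis.reindex_apply, Module.Basis.reindex_apply, F.form_basis]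
    simp only [Equiv.apply_eq_iff_eq]
    rcases i with i | i <;> rcases j with j | j <;> simp [sgn]

theorem finiteDimensional [Finite I] [Finite J] (F : SplitFrobenius I J B) :
    FiniteDimensional ℂ B := F.basis.finiteDimensional_of_finite

theorem finrank_eq [Fintype I] [Fintype J] (F : SplitFrobenius I J B) :
    Module.finrank ℂ B = Fintype.card I + Fintype.card J := by
  rw [Module.finrank_eq_card_basis F.basis, Fintype.card_sum]

theorem one_ne_zero [h : Nonempty (I ⊕ J)] (F : SplitFrobenius I J B) : (1 : B) ≠ 0 := by
  intro h0
  obtain ⟨i⟩ := h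
  have h1 := F.form_basis i i
  rw [← one_mul (F.basis i * F.basis i), h0, zero_mul, map_zero, if_pos rfl] at h1
  exact sgn_ne_zero i h1.symm

/-- The product of two algebras. -/
noncomputable def prod [Fintype I] [Fintype J] [Fintype I'] [Fintype J']
    (F : SplitFrobenius I J B) (F' : SplitFrobenius I' J' B') :
    SplitFrobenius (I ⊕ I') (J ⊕ J') (B × B') :=
  haveI := F.finiteDimensional
  haveI := F'.finiteDimensional
  ofFamily (F.form.coprod F'.form) (RingHom.prodMap F.conj F'.conj)
    (fun c b => by
      ext
      · exact F.conj_smul c b.1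
      · exact F'.conj_smul c b.2)
    (Sum.elim
      (Sum.elim (fun i => (F.basis (Sum.inl i), 0)) fun i => (0, F'.basis (Sum.inl i)))
      (Sum.elim (fun i => (F.basis (Sum.inr i), 0)) fun i => (0, F'.basis (Sum.inr i))))
    (by rintro ((i | i) | (i | i)) <;> simp [F.conj_basis, F'.conj_basis])
    (by
      rintro ((i | i) | (i | i)) ((j | j) | (j | j)) <;>
        simp [F.form_basis, F'.form_basis, sgn])
    (by
      rw [Module.finrank_prod, F.finrank_eq, F'.finrank_eq]
      simp only [Fintype.card_sum]
      omega)

/-- The product of a finite family of algebras. -/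
noncomputable def pi {ι : Type} [Fintype ι] [DecidableEq ι] {I J : ι → Type}
    [∀ i, DecidableEq (I i)] [∀ i, DecidableEq (J i)] [∀ i, Fintype (I i)] [∀ i, Fintype (J i)]
    {B : ι → Type} [∀ i, CommRing (B i)] [∀ i, Algebra ℂ (B i)]
    (F : ∀ i, SplitFrobenius (I i) (J i) (B i)) :
    SplitFrobenius (Σ i, I i) (Σ i, J i) (∀ i, B i) :=
  haveI := fun i => (F i).finiteDimensional
  ofFamily (∑ i, (F i).form.comp (LinearMap.proj i))
    (RingHom.pi fun i => (F i).conj.comp (Pi.evalRingHom B i))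
    (fun c b => funext fun i => (F i).conj_smul c (b i))
    (Sum.elim (fun x => Pi.single x.1 ((F x.1).basis (Sum.inl x.2)))
      fun x => Pi.single x.1 ((F x.1).basis (Sum.inr x.2)))
    (by
      have key : ∀ (i : ι) (b : B i), (F i).conj b = b →
          (RingHom.pi fun i => (F i).conj.comp (Pi.evalRingHom B i)) (Pi.single i b) =
            Pi.single i b := by
        intro i b hb
        funext k
        change (F k).conj (Pi.single i b k) = _
        by_cases hk : k = i
        · subst hk
          rw [Pi.single_eq_same, hb]
        · rw [Pi.single_eq_of_ne hk, map_zero]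
      rintro (x | x) <;> exact key _ _ ((F x.1).conj_basis _))
    (by
      have key : ∀ (i k : ι) (b : B i) (c : B k), i ≠ k →
          (Pi.single i b * Pi.single k c : ∀ i, B i) = 0 := by
        intro i k b c hik
        funext l
        rw [Pi.mul_apply, Pi.zero_apply]
        by_cases hl : l = i
        · subst hl
          rw [Pi.single_eq_of_ne hik, mul_zero]
        · rw [Pi.single_eq_of_ne hl, zero_mul]
      have key2 : ∀ (i : ι) (b : B i),
          (∑ i, (F i).form.comp (LinearMap.proj i)) (Pi.single i b) = (F i).form b := by
        intro i b
        rw [LinearMap.sum_apply, Finset.sum_eq_single i]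
        · simp
        · intro k _ hk
          simp [Pi.single_eq_of_ne hk]
        · simp
      rintro (⟨i, a⟩ | ⟨i, a⟩) (⟨k, c⟩ | ⟨k, c⟩) <;> by_cases hik : i = k <;>
        first
        | (subst hik
           simp only [Sum.elim_inl, Sum.elim_inr, ← Pi.single_mul, key2, (F i).form_basis]
           simp [sgn])
        | (simp only [Sum.elim_inl, Sum.elim_inr, key _ _ _ _ hik, map_zero]
           simp [hik]))
    (by
      rw [Module.finrank_pi_fintype]
      simp only [(F _).finrank_eq, Fintype.card_sum, Fintype.card_sigma, Finset.sum_add_distrib])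

/-- A square root of the sign. -/
noncomputable def sgnRoot {I J : Type} : I ⊕ J → ℂ :=
  Sum.elim (fun _ => 1) (fun _ => Complex.I)

theorem sgnRoot_sq {I J : Type} (i : I ⊕ J) : sgnRoot i * sgnRoot i = sgn i := by
  rcases i with i | i <;> simp [sgnRoot, sgn]

theorem star_sgnRoot_sq {I J : Type} (i : I ⊕ J) :
    star (sgnRoot i) * star (sgnRoot i) = sgn i := by
  rw [← star_mul, sgnRoot_sq, star_sgn]

theorem sgn_mul_self {I J : Type} (i : I ⊕ J) : sgn i * sgn i = 1 := by
  rcases i with i | i <;> simp [sgn]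

/-- The product of two copies of an algebra, with the conjugation exchanging the factors. -/
noncomputable def pair [Fintype I] [Fintype J] (F : SplitFrobenius I J B) :
    SplitFrobenius (I ⊕ J) (I ⊕ J) (B × B) :=
  haveI := F.finiteDimensional
  let r : ℂ := ((Real.sqrt 2)⁻¹ : ℝ)
  have hr : star r = r := Complex.conj_ofReal _
  have hr2 : r * r * 2 = 1 := by
    have h1 : (Real.sqrt 2)⁻¹ * (Real.sqrt 2)⁻¹ * 2 = 1 := by
      rw [← mul_inv, Real.mul_self_sqrt (by norm_num)]; norm_num
    have h3 := congrArg (fun x : ℝ => (x : ℂ)) h1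
    simpa only [Complex.ofReal_mul, Complex.ofReal_one, Complex.ofReal_ofNat] using h3
  ofFamily (F.form.coprod F.form)
    (RingHom.prod (F.conj.comp (RingHom.snd B B)) (F.conj.comp (RingHom.fst B B)))
    (fun c b => by
      ext
      · exact F.conj_smul c b.2
      · exact F.conj_smul c b.1)
    -- With `ρ = sgnRoot i` these are `r (ρ, conj ρ)` and `i r (ρ, -conj ρ)` times the basis vector.
    -- Both are fixed by the exchanging conjugation. As `ρ² = conj ρ² = sgn i` compensates the sign
    -- of `F`, the first family is positive and the second negative.
    (Sum.elim
      (fun i => ((r * sgnRoot i) • F.basis i, (r * star (sgnRoot i)) • F.basis i))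
      (fun i => ((Complex.I * r * sgnRoot i) • F.basis i,
        (-Complex.I * r * star (sgnRoot i)) • F.basis i)))
    (by
      rintro (i | i) <;> ext <;>
        simp [F.conj_smul, F.conj_basis, hr])
    (by
      have key : ∀ i : I ⊕ J, r * r * sgn i * (sgnRoot i * sgnRoot i) +
          r * r * sgn i * (star (sgnRoot i) * star (sgnRoot i)) = 1 := by
        intro i
        rw [sgnRoot_sq, star_sgnRoot_sq]
        linear_combination (2 * r * r) * sgn_mul_self i + hr2
      have key2 : ∀ i : I ⊕ J, sgnRoot i * sgnRoot i = star (sgnRoot i) * star (sgnRoot i) :=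
        fun i => by rw [sgnRoot_sq, star_sgnRoot_sq]
      rintro (i | i) (j | j) <;>
        simp only [Sum.elim_inl, Sum.elim_inr, Prod.mk_mul_mk, LinearMap.coprod_apply,
          smul_mul_smul_comm, map_smul, F.form_basis, smul_eq_mul, Sum.inl.injEq,
          Sum.inr.injEq, reduceCtorEq, if_false] <;>
        by_cases hij : i = j
      all_goals first | (simp only [if_neg hij]; ring) | (subst hij; simp only [if_true])
      · rw [show sgn (Sum.inl i : (I ⊕ J) ⊕ (I ⊕ J)) = 1 from rfl]
        linear_combination key i
      · linear_combination (r * r * Complex.I * sgn i) * key2 i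
      · linear_combination (r * r * Complex.I * sgn i) * key2 i
      · rw [show sgn (Sum.inr i : (I ⊕ J) ⊕ (I ⊕ J)) = -1 from rfl]
        linear_combination Complex.I ^ 2 * key i + Complex.I_sq)
    (by
      rw [Module.finrank_prod, F.finrank_eq]
      simp only [Fintype.card_sum])

/-- The one-dimensional algebra. -/
noncomputable def scalar [Fintype I] [Fintype J] (i : I ⊕ J) (hi : ∀ j, j = i) :
    SplitFrobenius I J ℂ :=
  ofFamily (sgn i • LinearMap.id) (starRingEnd ℂ) (fun c b => by simp) (fun _ => 1)
    (fun _ => by simp)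
    (fun j k => by
      obtain rfl := hi j
      obtain rfl := hi k
      simp)
    (by rw [Module.finrank_self]; exact Fintype.card_eq_one_iff.2 ⟨i, hi⟩)

end SplitFrobenius

/-! ### A local algebra of arbitrary indefinite type -/

/-- The algebra `ℂ ⊕ V ⊕ ℂ`, where the product of two elements of `V = ℂ^κ` is given by a diagonal
bilinear form with values in the last summand. -/
def QuadAlg (κ : Type) (_ : κ → ℂ) : Type := ℂ × (κ → ℂ) × ℂ

namespace QuadAlg

variable {κ : Type} {s : κ → ℂ}

noncomputable instance : AddCommGroup (QuadAlg κ s) :=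
  inferInstanceAs (AddCommGroup (ℂ × (κ → ℂ) × ℂ))

noncomputable instance : Module ℂ (QuadAlg κ s) :=
  inferInstanceAs (Module ℂ (ℂ × (κ → ℂ) × ℂ))

instance [Finite κ] : FiniteDimensional ℂ (QuadAlg κ s) :=
  inferInstanceAs (FiniteDimensional ℂ (ℂ × (κ → ℂ) × ℂ))

theorem finrank_eq [Fintype κ] : Module.finrank ℂ (QuadAlg κ s) = Fintype.card κ + 2 := by
  change Module.finrank ℂ (ℂ × (κ → ℂ) × ℂ) = _
  rw [Module.finrank_prod, Module.finrank_prod, Module.finrank_self, Module.finrank_pi]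
  omega

@[ext]
theorem ext {x y : QuadAlg κ s} (h1 : x.1 = y.1) (h2 : x.2.1 = y.2.1) (h3 : x.2.2 = y.2.2) :
    x = y := Prod.ext h1 (Prod.ext h2 h3)

instance : One (QuadAlg κ s) := ⟨(1, 0, 0)⟩

/-- The element with the given components. -/
def mk (s : κ → ℂ) (a : ℂ) (v : κ → ℂ) (c : ℂ) : QuadAlg κ s := (a, v, c)

@[simp] theorem mk_fst (a : ℂ) (v : κ → ℂ) (c : ℂ) : (mk s a v c).1 = a := rfl
@[simp] theorem mk_snd (a : ℂ) (v : κ → ℂ) (c : ℂ) : (mk s a v c).2.1 = v := rfl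
@[simp] theorem mk_trd (a : ℂ) (v : κ → ℂ) (c : ℂ) : (mk s a v c).2.2 = c := rfl
@[simp] theorem add_fst (x y : QuadAlg κ s) : (x + y).1 = x.1 + y.1 := rfl
@[simp] theorem add_snd (x y : QuadAlg κ s) : (x + y).2.1 = x.2.1 + y.2.1 := rfl
@[simp] theorem add_trd (x y : QuadAlg κ s) : (x + y).2.2 = x.2.2 + y.2.2 := rfl
@[simp] theorem zero_fst : (0 : QuadAlg κ s).1 = 0 := rfl
@[simp] theorem zero_snd : (0 : QuadAlg κ s).2.1 = 0 := rfl
@[simp] theorem zero_trd : (0 : QuadAlg κ s).2.2 = 0 := rfl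
@[simp] theorem smul_fst (c : ℂ) (x : QuadAlg κ s) : (c • x).1 = c * x.1 := rfl
@[simp] theorem smul_snd (c : ℂ) (x : QuadAlg κ s) : (c • x).2.1 = c • x.2.1 := rfl
@[simp] theorem smul_trd (c : ℂ) (x : QuadAlg κ s) : (c • x).2.2 = c * x.2.2 := rfl
@[simp] theorem one_fst : (1 : QuadAlg κ s).1 = 1 := rfl
@[simp] theorem one_snd : (1 : QuadAlg κ s).2.1 = 0 := rfl
@[simp] theorem one_trd : (1 : QuadAlg κ s).2.2 = 0 := rfl

variable [Fintype κ]

instance : Mul (QuadAlg κ s) :=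
  ⟨fun x y => mk s (x.1 * y.1) (x.1 • y.2.1 + y.1 • x.2.1)
    (x.1 * y.2.2 + y.1 * x.2.2 + (s * x.2.1) ⬝ᵥ y.2.1)⟩

@[simp] theorem mul_fst (x y : QuadAlg κ s) : (x * y).1 = x.1 * y.1 := rfl
@[simp] theorem mul_snd (x y : QuadAlg κ s) :
    (x * y).2.1 = x.1 • y.2.1 + y.1 • x.2.1 := rfl
@[simp] theorem mul_trd (x y : QuadAlg κ s) :
    (x * y).2.2 = x.1 * y.2.2 + y.1 * x.2.2 + (s * x.2.1) ⬝ᵥ y.2.1 := rfl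

theorem form_comm (v w : κ → ℂ) : (s * v) ⬝ᵥ w = (s * w) ⬝ᵥ v :=
  Finset.sum_congr rfl fun i _ => by simp only [Pi.mul_apply]; ring

theorem mul_comm' (x y : QuadAlg κ s) : x * y = y * x := by
  ext1
  · simp [mul_comm]
  · simp [add_comm]
  · rw [mul_trd, mul_trd, form_comm]; ring

theorem mul_assoc' (x y z : QuadAlg κ s) : x * y * z = x * (y * z) := by
  ext1
  · simp [mul_assoc]
  · simp only [mul_fst, mul_snd, smul_add, smul_smul]
    module
  · simp only [mul_fst, mul_snd, mul_trd, mul_add, mul_smul_comm, add_dotProduct, dotProduct_add,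
      smul_dotProduct, dotProduct_smul, smul_eq_mul]
    ring

theorem left_distrib' (x y z : QuadAlg κ s) : x * (y + z) = x * y + x * z := by
  ext1
  · simp [mul_add]
  · simp only [mul_snd, add_fst, add_snd]
    module
  · simp only [mul_trd, add_fst, add_snd, add_trd, dotProduct_add]
    ring

theorem one_mul' (x : QuadAlg κ s) : 1 * x = x := by
  ext1 <;> simp

noncomputable instance : CommRing (QuadAlg κ s) where
  mul_assoc := mul_assoc'
  mul_comm := mul_comm'
  one_mul := one_mul'
  mul_one x := by rw [mul_comm', one_mul']
  left_distrib := left_distrib'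
  right_distrib x y z := by rw [mul_comm', left_distrib', mul_comm' z, mul_comm' z]
  zero_mul x := by ext1 <;> simp
  mul_zero x := by ext1 <;> simp
  zsmul := zsmulRec
  neg_add_cancel := neg_add_cancel

theorem smul_mul' (c : ℂ) (x y : QuadAlg κ s) : c • x * y = c • (x * y) := by
  ext1
  · simp [mul_assoc]
  · simp only [mul_snd, smul_fst, smul_snd]
    module
  · simp only [mul_trd, smul_fst, smul_snd, smul_trd, mul_smul_comm, smul_dotProduct, smul_eq_mul]
    ring

noncomputable instance : Algebra ℂ (QuadAlg κ s) :=
  Algebra.ofModule smul_mul' fun c x y => by rw [mul_comm', smul_mul', mul_comm']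

/-- An element with vanishing first component has its square in the last summand, hence cube zero.
-/
theorem isNilpotent_sub (x : QuadAlg κ s) : IsNilpotent (x - algebraMap ℂ _ x.1) := by
  obtain ⟨y, hy⟩ : ∃ y, y = x - algebraMap ℂ _ x.1 := ⟨_, rfl⟩
  have h0 : y.1 = 0 := by
    have h1 : y + x.1 • 1 = x := by
      rw [hy, Algebra.algebraMap_eq_smul_one, sub_add_cancel]
    have := congrArg Prod.fst h1
    change y.1 + x.1 * 1 = x.1 at this
    linear_combination this
  rw [← hy]
  refine ⟨3, ?_⟩
  rw [pow_succ, pow_two]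
  ext1 <;> simp [h0]

theorem star_form (hs : star s = s) (v w : κ → ℂ) :
    star ((s * v) ⬝ᵥ w) = (s * star v) ⬝ᵥ star w := by
  rw [dotProduct, dotProduct, star_sum]
  refine Finset.sum_congr rfl fun i _ => ?_
  have h : star (s i) = s i := congrFun hs i
  rw [Pi.mul_apply, Pi.mul_apply, Pi.star_apply, Pi.star_apply, star_mul', star_mul', h]

/-- The conjugation of all components. -/
noncomputable def conj (hs : star s = s) : QuadAlg κ s →+* QuadAlg κ s where
  toFun x := mk s (star x.1) (star x.2.1) (star x.2.2)
  map_one' := by ext1 <;> simp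
  map_zero' := by ext1 <;> simp
  map_add' x y := by ext1 <;> simp
  map_mul' x y := by
    ext1
    · simp
    · simp
    · simp only [mul_trd, mk_fst, mk_snd, mk_trd, star_add, star_mul', star_form hs]

theorem conj_apply (hs : star s = s) (x : QuadAlg κ s) :
    conj hs x = mk s (star x.1) (star x.2.1) (star x.2.2) := rfl

/-- The last component as a linear form. -/
def form : QuadAlg κ s →ₗ[ℂ] ℂ where
  toFun x := x.2.2
  map_add' _ _ := rfl
  map_smul' _ _ := rfl

/-- The form, the conjugation and the basis of the algebra. -/
noncomputable def model (I J : Type) [Fintype I] [Fintype J] [DecidableEq I] [DecidableEq J] :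
    SplitFrobenius (Unit ⊕ I) (Unit ⊕ J) (QuadAlg (I ⊕ J) sgn) :=
  SplitFrobenius.ofFamily form (conj (funext star_sgn))
    (fun c x => by ext1 <;> simp [conj_apply])
    -- The vectors `(1, 0, ±1/2)` are orthogonal with squares of form value `±1`; they turn the
    -- hyperbolic plane of the two outer summands into one positive and one negative direction.
    (Sum.elim
      (Sum.elim (fun _ => mk _ 1 0 (1 / 2)) fun i => mk _ 0 (Pi.single (Sum.inl i) 1) 0)
      (Sum.elim (fun _ => mk _ 1 0 (-1 / 2)) fun j => mk _ 0 (Pi.single (Sum.inr j) 1) 0))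
    (by
      have h : ∀ i : I ⊕ J, star (Pi.single i (1 : ℂ) : I ⊕ J → ℂ) = Pi.single i 1 := fun i => by
        rw [← Pi.single_star, star_one]
      rintro ((i | i) | (i | i)) <;> ext1 <;> simp [conj_apply, h])
    (by
      intro i j
      change Prod.snd (Prod.snd (_ * _ : QuadAlg (I ⊕ J) sgn)) = _
      rw [mul_trd]
      rcases i with (i | i) | (i | i) <;> rcases j with (j | j) | (j | j) <;>
        simp [sgn, Pi.single_apply, eq_comm]
      all_goals norm_num)
    (by
      rw [finrank_eq]
      simp only [Fintype.card_sum, Fintype.card_unit]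
      omega)

end QuadAlg

/-- An algebra whose elements are scalars up to nilpotent elements. -/
def IsScalarModNil (B : Type) [CommRing B] [Algebra ℂ B] : Prop :=
  ∀ b : B, ∃ c : ℂ, IsNilpotent (b - algebraMap ℂ B c)

/-- Every type in `K` is the type of a local algebra. -/
theorem exists_splitFrobenius (k : KSet) : ∃ (B : Type) (_ : CommRing B) (_ : Algebra ℂ B),
    IsScalarModNil B ∧ Nonempty (SplitFrobenius (Fin k.1.1) (Fin k.1.2) B) := by
  obtain ⟨⟨s, t⟩, h⟩ := k
  dsimp only at h ⊢
  have hscal : IsScalarModNil ℂ := fun b => ⟨b, by simp⟩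
  rcases s with _ | s
  · obtain rfl : t = 1 := by simpa using h
    refine ⟨ℂ, inferInstance, inferInstance, hscal, ⟨.scalar (Sum.inr 0) ?_⟩⟩
    rintro (i | i)
    · exact i.elim0
    · rw [Subsingleton.elim i 0]
  · rcases t with _ | t
    · obtain rfl : s = 0 := by simpa using h
      refine ⟨ℂ, inferInstance, inferInstance, hscal, ⟨.scalar (Sum.inl 0) ?_⟩⟩
      rintro (i | i)
      · exact congrArg Sum.inl (Subsingleton.elim (α := Fin 1) i 0)
      · exact i.elim0
    -- Here the type is `(s + 1, t + 1)`: the two `Unit` summands of `model` supply the additional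
    -- directions.
    · refine ⟨QuadAlg (Fin s ⊕ Fin t) sgn, inferInstance, inferInstance,
        fun b => ⟨b.1, QuadAlg.isNilpotent_sub b⟩, ⟨(QuadAlg.model (Fin s) (Fin t)).reindex ?_ ?_⟩⟩
      · exact Fintype.equivFinOfCardEq (by simp [add_comm])
      · exact Fintype.equivFinOfCardEq (by simp [add_comm])

/-! ### The maximal abelian subalgebra of a Frobenius algebra -/

theorem tau_single (i : Idx p q) : tau p q (Pi.single i 1) = Pi.single i 1 := by
  rw [tau_apply, ← Pi.single_star, star_one]

namespace SplitFrobenius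

variable {B : Type} [CommRing B] [Algebra ℂ B] (F : SplitFrobenius (Fin p) (Fin q) B)

/-- The identification of `E` with the algebra. -/
noncomputable def coord : E p q ≃ₗ[ℂ] B := F.basis.equivFun.symm

theorem coord_apply (z : E p q) : F.coord z = ∑ i, z i • F.basis i :=
  F.basis.equivFun_symm_apply z

theorem conj_coord (z : E p q) : F.conj (F.coord z) = F.coord (tau p q z) := by
  rw [coord_apply, coord_apply, map_sum]
  exact Finset.sum_congr rfl fun i _ => by rw [F.conj_smul, F.conj_basis]; rfl

theorem conj_conj (b : B) : F.conj (F.conj b) = b := by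
  obtain ⟨z, rfl⟩ := F.coord.surjective b
  rw [conj_coord, conj_coord, tau_tau]

/-- The form becomes `φ(a * conj b)`, so multiplication by `b` has multiplication by `conj b` as
adjoint. Skew elements therefore act by skew operators. -/
theorem herm_eq (z w : E p q) : herm p q z w = F.form (F.coord z * F.conj (F.coord w)) := by
  have h : ∀ a b : E p q, F.form (F.coord a * F.coord b) = ∑ i, a i * b i * sgn i := by
    intro a b
    rw [coord_apply, coord_apply, Finset.sum_mul_sum, map_sum]
    refine Finset.sum_congr rfl fun i _ => ?_
    rw [map_sum, Finset.sum_eq_single i]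
    · rw [smul_mul_smul_comm, map_smul, F.form_basis, if_pos rfl, smul_eq_mul]
    · intro j _ hj
      rw [smul_mul_smul_comm, map_smul, F.form_basis, if_neg hj.symm, smul_zero]
    · simp
  rw [conj_coord, h, herm_apply, Fintype.sum_sum_type]
  simp [sgn, tau_apply, sub_eq_add_neg]

/-- The matrix of the multiplication by an element. -/
noncomputable def mulMat : B →ₐ[ℂ] Mat p q := Algebra.leftMulMatrix F.basis

theorem coord_mulMat (b : B) (z : E p q) : F.coord (F.mulMat b *ᵥ z) = b * F.coord z := by
  have h := Algebra.leftMulMatrix_mulVec_repr F.basis b (F.coord z)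
  have h1 : (F.basis.repr (F.coord z) : E p q) = z := F.basis.equivFun.apply_symm_apply z
  rw [h1] at h
  exact F.basis.equivFun.symm_apply_eq.2 h

theorem mulMat_mulVec (b : B) (z : E p q) : F.mulMat b *ᵥ z = F.coord.symm (b * F.coord z) := by
  rw [← coord_mulMat, LinearEquiv.symm_apply_apply]

theorem tau_mulMat (b : B) (z : E p q) :
    tau p q (F.mulMat b *ᵥ tau p q z) = F.mulMat (F.conj b) *ᵥ z := by
  apply F.coord.injective
  rw [← conj_coord, coord_mulMat, coord_mulMat, ← conj_coord, map_mul, conj_conj]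

theorem trace_mulMat_conj (b : B) :
    (F.mulMat (F.conj b)).trace = star (F.mulMat b).trace := by
  rw [Matrix.trace, Matrix.trace, star_sum]
  refine Finset.sum_congr rfl fun i _ => ?_
  have h := congrFun (F.tau_mulMat b (Pi.single i 1)) i
  rw [tau_single, tau_apply, mulVec_single_one, mulVec_single_one] at h
  exact h.symm

theorem mulMat_mem_su_iff {b : B} :
    F.mulMat b ∈ su p q ↔ (F.mulMat b).trace = 0 ∧ F.conj b = -b := by
  have key : ∀ z w : E p q, herm p q (F.mulMat b *ᵥ z) w + herm p q z (F.mulMat b *ᵥ w) =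
      F.form ((b + F.conj b) * F.coord z * F.conj (F.coord w)) := by
    intro z w
    rw [F.herm_eq, F.herm_eq, coord_mulMat, coord_mulMat, ← map_add, map_mul]
    congr 1
    ring
  refine and_congr_right fun _ => ⟨fun h => ?_, fun h z w => ?_⟩
  · have h1 : F.coord.symm (b + F.conj b) = 0 := by
      refine eq_zero_of_herm_eq_zero fun w => ?_
      have h2 := key (F.coord.symm 1) w
      rw [h, LinearEquiv.apply_symm_apply, mul_one] at h2
      rw [F.herm_eq, LinearEquiv.apply_symm_apply, ← h2]
    replace h1 := F.coord.symm.map_eq_zero_iff.1 h1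
    exact eq_neg_of_add_eq_zero_right h1
  · rw [key, h, add_neg_cancel, zero_mul, zero_mul, map_zero]

theorem mulMat_mem_suMinus {b : B} (h : F.mulMat b ∈ su p q) : F.mulMat b ∈ suMinus p q := by
  refine ⟨h, fun z => ?_⟩
  rw [tau_mulMat, (F.mulMat_mem_su_iff.1 h).2, map_neg, neg_mulVec]

theorem mulMat_smul_one (c : ℂ) : F.mulMat (c • 1) = c • 1 := by
  rw [map_smul, map_one]

/-- The trace of a skew multiplication is imaginary, so removing the scalar part keeps it skew. -/
theorem exists_sub_smul_one_mem_su (hn : 0 < p + q) {b : B} (hb : F.conj b = -b) :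
    ∃ r : ℂ, F.mulMat (b - r • 1) ∈ su p q := by
  have hn' : ((p + q : ℕ) : ℂ) ≠ 0 := Nat.cast_ne_zero.2 hn.ne'
  have ht : star (F.mulMat b).trace = -(F.mulMat b).trace := by
    rw [← trace_mulMat_conj, hb, map_neg, trace_neg]
  refine ⟨(F.mulMat b).trace / (p + q : ℕ), F.mulMat_mem_su_iff.2 ⟨?_, ?_⟩⟩
  · rw [map_sub, mulMat_smul_one, trace_sub, trace_smul, trace_one, Fintype.card_sum,
      Fintype.card_fin, Fintype.card_fin, smul_eq_mul, div_mul_cancel₀ _ hn', sub_self]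
  · have : star ((F.mulMat b).trace / ((p + q : ℕ) : ℂ)) =
        -((F.mulMat b).trace / ((p + q : ℕ) : ℂ)) := by
      rw [star_div₀, ht, star_natCast, neg_div]
    rw [map_sub, F.conj_smul, this, hb, map_one, neg_smul]
    abel

/-- The trace-free skew-adjoint multiplications. -/
noncomputable def masa : LieSubalgebra ℝ (Mat p q) where
  carrier := {x | x ∈ su p q ∧ ∃ b, F.mulMat b = x}
  zero_mem' := ⟨zero_mem _, 0, map_zero _⟩
  add_mem' := by
    rintro _ _ ⟨hx, a, rfl⟩ ⟨hy, b, rfl⟩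
    exact ⟨add_mem hx hy, a + b, map_add _ _ _⟩
  smul_mem' := by
    rintro c _ ⟨hx, a, rfl⟩
    refine ⟨(su p q).smul_mem c hx, (c : ℂ) • a, ?_⟩
    rw [map_smul]
    exact Complex.coe_smul c (F.mulMat a)
  lie_mem' := by
    rintro _ _ ⟨hx, a, rfl⟩ ⟨hy, b, rfl⟩
    refine ⟨(su p q).lie_mem hx hy, 0, ?_⟩
    rw [Ring.lie_def, ← map_mul, ← map_mul, mul_comm, sub_self, map_zero]

theorem masa_subset_suMinus : (F.masa : Set (Mat p q)) ⊆ suMinus p q := by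
  rintro _ ⟨hx, b, rfl⟩
  exact F.mulMat_mem_suMinus hx

/-- An operator commuting with all multiplications is multiplication by its value at `1`. -/
theorem exists_mulMat_eq {x : Mat p q} (h : ∀ b, x * F.mulMat b = F.mulMat b * x) :
    ∃ b, F.mulMat b = x := by
  refine ⟨F.coord (x *ᵥ F.coord.symm 1), ?_⟩
  refine Matrix.ext_of_mulVec_single fun i => ?_
  generalize (Pi.single i 1 : E p q) = z
  have h1 : F.mulMat (F.coord z) *ᵥ F.coord.symm 1 = z := by
    rw [mulMat_mulVec, LinearEquiv.apply_symm_apply, mul_one, LinearEquiv.symm_apply_apply]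
  conv_rhs => rw [← h1, mulVec_mulVec, h, ← mulVec_mulVec]
  rw [mulMat_mulVec, mulMat_mulVec, mul_comm]

theorem isMASA_masa (hn : 0 < p + q) : IsMASA p q F.masa := by
  refine ⟨⟨fun x hx => hx.1, isLieAbelian_iff_lie.2 ?_⟩, fun a ha hle x hx => ⟨ha.1 hx, ?_⟩⟩
  · rintro _ ⟨-, a, rfl⟩ _ ⟨-, b, rfl⟩
    rw [Ring.lie_def, ← map_mul, ← map_mul, mul_comm, sub_self]
  refine F.exists_mulMat_eq ?_
  have h1 : ∀ b, F.conj b = -b → x * F.mulMat b = F.mulMat b * x := by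
    intro b hb
    obtain ⟨r, hr⟩ := F.exists_sub_smul_one_mem_su hn hb
    have h2 := isLieAbelian_iff_lie.1 ha.2 x hx _ (hle ⟨hr, _, rfl⟩)
    rw [Ring.lie_def, sub_eq_zero, map_sub, mulMat_smul_one, mul_sub, sub_mul] at h2
    simpa using h2
  intro b
  -- Skew elements span `B` over `ℂ`: both `b - conj b` and `i (b + conj b)` are skew. Hence
  -- commuting with the skew multiplications implies commuting with all of them.
  have e : b = (1 / 2 : ℂ) • (b - F.conj b) +
      (-Complex.I / 2) • (Complex.I • (b + F.conj b)) := by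
    rw [smul_smul, show -Complex.I / 2 * Complex.I = 1 / 2 by
      linear_combination (-1 / 2 : ℂ) * Complex.I_sq]
    module
  rw [e, map_add, map_smul, map_smul, mul_add, add_mul, mul_smul_comm, smul_mul_assoc,
    mul_smul_comm, smul_mul_assoc, h1, h1]
  · rw [F.conj_smul, map_add, conj_conj, add_comm b, ← neg_smul]
    simp
  · rw [map_sub, conj_conj, neg_sub]

theorem isQualifyingMASA_masa (hn : 0 < p + q) : IsQualifyingMASA p q F.masa := by
  refine ⟨F.isMASA_masa hn, 1, Or.inl one_mem_groupSU, ?_⟩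
  rw [map_Ad_one]
  exact F.masa_subset_suMinus

end SplitFrobenius

/-! ### Recognition of joint eigenspaces -/

/-- Shrinking members of an independent family, or omitting nonzero ones, would by modularity
prevent the supremum from being `⊤`. -/
theorem eq_of_iSupIndep_of_le {α : Type*} [CompleteLattice α] [IsModularLattice α]
    {X Ω : Type*} {A : X → α} (hA : iSupIndep A) {U : Ω → α} {χ : Ω → X}
    (hχ : Function.Injective χ) (hU : ∀ ω, U ω ≤ A (χ ω)) (htop : ⨆ ω, U ω = ⊤) :
    (∀ ω, U ω = A (χ ω)) ∧ ∀ x, x ∉ Set.range χ → A x = ⊥ := by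
  constructor
  · intro ω
    refine eq_of_le_of_inf_le_of_le_sup (hU ω) ((hA (χ ω)).le_bot.trans bot_le) ?_
    refine le_top.trans (htop ▸ iSup_le fun ω' => ?_)
    by_cases h : ω' = ω
    · subst h
      exact le_sup_left
    · have h1 : A (χ ω') ≤ ⨆ j, ⨆ (_ : j ≠ χ ω), A j :=
        le_iSup₂_of_le (χ ω') (hχ.ne h) le_rfl
      exact (hU ω').trans (h1.trans le_sup_right)
  · intro x hx
    refine disjoint_top.1 ((hA x).mono_right (htop ▸ iSup_le fun ω => ?_))
    exact (hU ω).trans (le_iSup₂_of_le (χ ω) (fun h => hx ⟨ω, h⟩) le_rfl)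

/-- Each `U ω` lies in a weight space, with distinct weights for distinct `ω`; as the `U ω` span
`E`, they fill these weight spaces and leave no others. -/
theorem jointEigenspaces_eq_range {S : Set (Mat p q)}
    (hss : ∀ x ∈ S, Module.End.IsSemisimple (Matrix.toLin' x))
    (hcomm : ∀ x ∈ S, ∀ y ∈ S, x * y = y * x) {Ω : Type*} {U : Ω → Submodule ℂ (E p q)}
    (htop : ⨆ ω, U ω = ⊤) (hne : ∀ ω, U ω ≠ ⊥)
    (hsc : ∀ ω, ∀ x ∈ S, ∃ c : ℂ, ∀ z ∈ U ω, x *ᵥ z = c • z)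
    (hsep : ∀ ω ω', ω ≠ ω' → ∃ x ∈ S, ∃ c c' : ℂ, c ≠ c' ∧ (∀ z ∈ U ω, x *ᵥ z = c • z) ∧
      ∀ z ∈ U ω', x *ᵥ z = c' • z) :
    jointEigenspaces S = Set.range U ∧ Function.Injective U := by
  choose χ hχ using hsc
  have hval : ∀ ω x (hx : x ∈ S) c, (∀ z ∈ U ω, x *ᵥ z = c • z) → χ ω x hx = c := by
    intro ω x hx c hc
    obtain ⟨z, hz, hz0⟩ := Submodule.exists_mem_ne_zero_of_ne_bot (hne ω)
    refine smul_left_injective ℂ hz0 ?_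
    change χ ω x hx • z = c • z
    rw [← hχ ω x hx z hz, hc z hz]
  have hinj : Function.Injective fun ω (x : S) => χ ω x x.2 := by
    intro ω ω' h
    by_contra hne
    obtain ⟨x, hx, c, c', hcc, h1, h2⟩ := hsep ω ω' hne
    refine hcc ?_
    rw [← hval ω x hx c h1, ← hval ω' x hx c' h2]
    exact congrFun h ⟨x, hx⟩
  have hle : ∀ ω, U ω ≤ wtSpace S fun x => χ ω x x.2 := fun ω z hz =>
    mem_wtSpace.2 fun x => hχ ω x x.2 z hz
  have hind := iSupIndep_wtSpace hss hcomm
  obtain ⟨h1, h2⟩ := eq_of_iSupIndep_of_le hind hinj hle htop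
  refine ⟨?_, fun ω ω' h => ?_⟩
  · ext W
    rw [mem_jointEigenspaces_iff]
    constructor
    · rintro ⟨h0, ψ, rfl⟩
      by_contra hW
      refine h0 (h2 ψ fun ⟨ω, hω⟩ => hW ⟨ω, ?_⟩)
      rw [h1, ← hω]
    · rintro ⟨ω, rfl⟩
      exact ⟨hne ω, _, h1 ω⟩
  · by_contra hne'
    have h3 := hind.pairwiseDisjoint (hinj.ne hne')
    rw [Function.onFun, ← h1, ← h1, ← h, disjoint_self] at h3
    exact hne ω h3

/-! ### The joint eigenspaces belonging to a system of idempotents -/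

namespace SplitFrobenius

variable {B : Type} [CommRing B] [Algebra ℂ B] (F : SplitFrobenius (Fin p) (Fin q) B)

/-- A decomposition of the algebra into local algebras. -/
structure Blocks (F : SplitFrobenius (Fin p) (Fin q) B) (Ω : Type) [Fintype Ω] where
  idem : Ω → B
  perm : Ω → Ω
  complete : CompleteOrthogonalIdempotents idem
  ne_zero : ∀ ω, idem ω ≠ 0
  conj_idem : ∀ ω, F.conj (idem ω) = idem (perm ω)
  nil : ∀ b ω, ∃ c : ℂ, IsNilpotent ((b - algebraMap ℂ B c) * idem ω)

/-- The subspace belonging to an idempotent. -/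
def block (e : B) : Submodule ℂ (E p q) where
  carrier := {z | e * F.coord z = F.coord z}
  zero_mem' := by simp
  add_mem' := by
    intro a b ha hb
    change _ = _ at ha hb ⊢
    rw [map_add, mul_add, ha, hb]
  smul_mem' := by
    intro c a ha
    change _ = _ at ha ⊢
    rw [map_smul, mul_smul_comm, ha]

theorem mem_block {e : B} {z : E p q} : z ∈ F.block e ↔ e * F.coord z = F.coord z := Iff.rfl

theorem map_tau_block (e : B) : (F.block e).map (tau p q) = F.block (F.conj e) := by
  ext z
  rw [mem_map_tau, mem_block, mem_block, ← conj_coord]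
  constructor
  · intro h
    have := congrArg F.conj h
    rwa [map_mul, conj_conj] at this
  · intro h
    have := congrArg F.conj h
    rwa [map_mul, conj_conj] at this

namespace Blocks

variable {F} {Ω : Type} [Fintype Ω] (P : F.Blocks Ω)

theorem idem_mul_self (ω : Ω) : P.idem ω * P.idem ω = P.idem ω := P.complete.idem ω

theorem idem_mul_of_ne {ω ω' : Ω} (h : ω ≠ ω') : P.idem ω * P.idem ω' = 0 := P.complete.ortho h

theorem idem_injective : Function.Injective P.idem := by
  intro ω ω' h
  by_contra hne
  have := P.idem_mul_of_ne hne
  rw [← h, P.idem_mul_self] at this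
  exact P.ne_zero ω this

theorem perm_perm (ω : Ω) : P.perm (P.perm ω) = ω := by
  apply P.idem_injective
  rw [← P.conj_idem, ← P.conj_idem, F.conj_conj]

theorem iSup_block : ⨆ ω, F.block (P.idem ω) = ⊤ := by
  refine eq_top_iff.2 fun z _ => ?_
  have h : z = ∑ ω, F.coord.symm (P.idem ω * F.coord z) := by
    rw [← map_sum, ← Finset.sum_mul, P.complete.complete, one_mul, LinearEquiv.symm_apply_apply]
  rw [h]
  refine sum_mem fun ω _ => Submodule.mem_iSup_of_mem ω ?_
  rw [mem_block, LinearEquiv.apply_symm_apply, ← mul_assoc, P.idem_mul_self]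

theorem block_ne_bot (ω : Ω) : F.block (P.idem ω) ≠ ⊥ := by
  intro h
  have h1 : F.coord.symm (P.idem ω) ∈ F.block (P.idem ω) := by
    rw [mem_block, LinearEquiv.apply_symm_apply, P.idem_mul_self]
  rw [h, Submodule.mem_bot] at h1
  exact P.ne_zero ω (F.coord.symm.map_eq_zero_iff.1 h1)

/-- On a block, multiplication by `b` is a scalar plus a nilpotent operator, and semisimplicity
leaves only the scalar. -/
theorem exists_scalar {x : Mat p q} (hx : x ∈ toralPart F.masa) (ω : Ω) :
    ∃ c : ℂ, ∀ z ∈ F.block (P.idem ω), x *ᵥ z = c • z := by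
  obtain ⟨⟨-, b, rfl⟩, hs⟩ := hx
  obtain ⟨c, n, hn⟩ := P.nil b ω
  refine ⟨c, fun z hz => ?_⟩
  have hpow : ∀ k, F.coord (((Matrix.toLin' (F.mulMat b) - c • (1 : Module.End ℂ (E p q))) ^ k) z) =
      (b - algebraMap ℂ B c) ^ k * F.coord z := by
    intro k
    induction k with
    | zero => simp
    | succ k ih =>
      rw [pow_succ', Module.End.mul_apply, LinearMap.sub_apply, LinearMap.smul_apply,
        Module.End.one_apply, toLin'_apply, map_sub, map_smul, coord_mulMat, ih,
        Algebra.smul_def]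
      ring
  have h1 : z ∈ Module.End.maxGenEigenspace (Matrix.toLin' (F.mulMat b)) c := by
    rw [Module.End.mem_maxGenEigenspace]
    refine ⟨n, F.coord.injective ?_⟩
    have h2 : P.idem ω ^ n * F.coord z = F.coord z := by
      clear hn
      induction n with
      | zero => rw [pow_zero, one_mul]
      | succ n ih => rw [pow_succ, mul_assoc, F.mem_block.1 hz, ih]
    rw [hpow, map_zero, ← h2, ← mul_assoc, ← mul_pow, hn, zero_mul]
  rw [hs.isFinitelySemisimple.maxGenEigenspace_eq_eigenspace,
    Module.End.mem_eigenspace_iff, toLin'_apply] at h1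
  exact h1

theorem isSemisimple_mulMat (ω : Ω) :
    Module.End.IsSemisimple (Matrix.toLin' (F.mulMat (P.idem ω))) := by
  refine isSemisimple_of_mul_self _root_.one_ne_zero ?_
  rw [one_smul]
  change Matrix.toLin' _ ∘ₗ Matrix.toLin' _ = _
  rw [← toLin'_mul, ← map_mul, P.idem_mul_self]

theorem exists_separating (hn : 0 < p + q) {ω ω' : Ω} (hne : ω ≠ ω') :
    ∃ x ∈ toralPart F.masa, ∃ c c' : ℂ, c ≠ c' ∧
      (∀ z ∈ F.block (P.idem ω), x *ᵥ z = c • z) ∧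
      ∀ z ∈ F.block (P.idem ω'), x *ᵥ z = c' • z := by
  -- The coefficient `1 + i` is neither real nor imaginary. Its imaginary part gives `2 i` on a
  -- fixed idempotent, and its real part distinguishes the values `1 + i` and `-1 + i` on an
  -- exchanged pair.
  have hskew : F.conj ((1 + Complex.I) • P.idem ω - (1 - Complex.I) • P.idem (P.perm ω)) =
      -((1 + Complex.I) • P.idem ω - (1 - Complex.I) • P.idem (P.perm ω)) := by
    rw [map_sub, F.conj_smul, F.conj_smul, P.conj_idem, P.conj_idem, P.perm_perm]
    simp [sub_eq_add_neg, add_comm]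
  obtain ⟨r, hr⟩ := F.exists_sub_smul_one_mem_su hn hskew
  have hcomm : ∀ a b : B, Commute (Matrix.toLin' (F.mulMat a)) (Matrix.toLin' (F.mulMat b)) :=
    fun a b => toLin'_commute (by rw [← map_mul, ← map_mul, mul_comm])
  have hact : ∀ (υ : Ω) (c : ℂ),
      ((1 + Complex.I) • P.idem ω - (1 - Complex.I) • P.idem (P.perm ω)) * P.idem υ =
        c • P.idem υ → ∀ z ∈ F.block (P.idem υ),
      F.mulMat ((1 + Complex.I) • P.idem ω - (1 - Complex.I) • P.idem (P.perm ω) - r • 1) *ᵥ z =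
        (c - r) • z := by
    intro υ c hc z hz
    apply F.coord.injective
    rw [coord_mulMat, map_smul]
    rw [mem_block] at hz
    rw [← hz, ← mul_assoc, sub_mul, hc, smul_mul_assoc, one_mul, sub_mul, smul_mul_assoc,
      smul_mul_assoc, ← sub_smul]
  refine ⟨_, ⟨⟨hr, _, rfl⟩, ?_⟩, ?_⟩
  · rw [map_sub, mulMat_smul_one, map_sub, map_smul, toLin'_one]
    refine Module.End.isSemisimple_sub_algebraMap_iff.2 ?_
    rw [map_sub, map_smul, map_smul, map_sub, map_smul, map_smul]
    exact (Module.End.IsSemisimple_smul _ (P.isSemisimple_mulMat _)).sub_of_commute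
      (((hcomm _ _).smul_left _).smul_right _) (Module.End.IsSemisimple_smul _ (P.isSemisimple_mulMat _))
  have ne_I : (1 + Complex.I) ≠ 0 := fun h => by simpa using congrArg Complex.re h
  by_cases h1 : P.perm ω = ω
  · refine ⟨2 * Complex.I - r, 0 - r, by simp, hact ω _ ?_, hact ω' _ ?_⟩
    · rw [h1, sub_mul, smul_mul_assoc, smul_mul_assoc, P.idem_mul_self]
      module
    · rw [h1, sub_mul, smul_mul_assoc, smul_mul_assoc, P.idem_mul_of_ne hne]
      simp
  · by_cases h2 : P.perm ω = ω'
    · refine ⟨(1 + Complex.I) - r, -(1 - Complex.I) - r, ?_, hact ω _ ?_, hact ω' _ ?_⟩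
      · intro h
        have := congrArg Complex.re (sub_left_injective h)
        norm_num at this
      · rw [sub_mul, smul_mul_assoc, smul_mul_assoc, P.idem_mul_self, P.idem_mul_of_ne h1]
        simp
      · rw [h2, sub_mul, smul_mul_assoc, smul_mul_assoc, P.idem_mul_self, P.idem_mul_of_ne hne]
        module
    · refine ⟨(1 + Complex.I) - r, 0 - r, fun h => ne_I (sub_left_injective h),
        hact ω _ ?_, hact ω' _ ?_⟩
      · rw [sub_mul, smul_mul_assoc, smul_mul_assoc, P.idem_mul_self, P.idem_mul_of_ne h1]
        simp
      · rw [sub_mul, smul_mul_assoc, smul_mul_assoc, P.idem_mul_of_ne hne, P.idem_mul_of_ne h2]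
        simp

theorem jointEigenspaces_eq (hn : 0 < p + q) :
    jointEigenspaces (toralPart F.masa) = Set.range (fun ω => F.block (P.idem ω)) ∧
      Function.Injective fun ω => F.block (P.idem ω) :=
  jointEigenspaces_eq_range toralPart_semisimple (F.isMASA_masa hn).toralPart_comm P.iSup_block
    P.block_ne_bot (fun ω _ hx => P.exists_scalar hx ω) fun _ _ h => P.exists_separating hn h

end Blocks

end SplitFrobenius

/-! ### Realization of the elements of `D_{p,q}` -/

theorem exists_eq_sum_single (D : DMonoid) :
    ∃ (ι κ : Type) (_ : Fintype ι) (_ : Fintype κ) (k : ι → KSet) (m : κ → ℕ+),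
      D = ∑ i, Finsupp.single (Sum.inl (k i)) 1 + ∑ l, Finsupp.single (Sum.inr (m l)) 1 := by
  induction D using Finsupp.induction_linear with
  | zero => exact ⟨Empty, Empty, inferInstance, inferInstance, Empty.elim, Empty.elim, by simp⟩
  | add D D' h h' =>
    obtain ⟨ι, κ, _, _, k, m, rfl⟩ := h
    obtain ⟨ι', κ', _, _, k', m', rfl⟩ := h'
    refine ⟨ι ⊕ ι', κ ⊕ κ', inferInstance, inferInstance, Sum.elim k k', Sum.elim m m', ?_⟩
    simp only [Fintype.sum_sum_type, Sum.elim_inl, Sum.elim_inr]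
    abel
  | single j n =>
    rcases j with j | j
    · exact ⟨Fin n, Empty, inferInstance, inferInstance, fun _ => j, Empty.elim, by simp⟩
    · exact ⟨Empty, Fin n, inferInstance, inferInstance, Empty.elim, fun _ => j, by simp⟩

namespace SplitFrobenius

theorem Blocks.isDSum_masa {B : Type} [CommRing B] [Algebra ℂ B]
    {F : SplitFrobenius (Fin p) (Fin q) B} {ι κ : Type} [Fintype ι] [Fintype κ]
    (P : F.Blocks (ι ⊕ κ × Bool)) (hn : 0 < p + q)
    (hι : ∀ i, P.perm (Sum.inl i) = Sum.inl i)
    (hκ : ∀ l, P.perm (Sum.inr (l, true)) = Sum.inr (l, false))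
    {k : ι → KSet} {m : κ → ℕ+}
    (hk : ∀ i, HasType (F.block (P.idem (Sum.inl i))) (k i).1.1 (k i).1.2)
    (hm : ∀ l, Module.finrank ℂ (F.block (P.idem (Sum.inr (l, true)))) = m l) :
    IsDSum F.masa
      (∑ i, Finsupp.single (Sum.inl (k i)) 1 + ∑ l, Finsupp.single (Sum.inr (m l)) 1) := by
  classical
  obtain ⟨hU, hinj⟩ := P.jointEigenspaces_eq hn
  have htau : ∀ ω, (F.block (P.idem ω)).map (tau p q) = F.block (P.idem (P.perm ω)) := fun ω => by
    rw [map_tau_block, P.conj_idem]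
  have hκ' : ∀ l, P.perm (Sum.inr (l, false)) = Sum.inr (l, true) := fun l => by
    rw [← hκ, P.perm_perm]
  have hK : Function.Injective fun i => F.block (P.idem (Sum.inl i)) :=
    hinj.comp Sum.inl_injective
  have hL : Function.Injective fun l => F.block (P.idem (Sum.inr (l, true))) :=
    fun l l' h => by simpa using hinj h
  refine ⟨Finset.univ.image fun i => F.block (P.idem (Sum.inl i)),
    Finset.univ.image fun l => F.block (P.idem (Sum.inr (l, true))), ?_, ?_, ?_,
    -- Types and dimensions must be functions of subspaces, so the labels are extended along the
    -- injective map to blocks; the default values are never used.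
    Function.extend (fun i => F.block (P.idem (Sum.inl i))) k fun _ => ⟨(1, 0), by simp⟩,
    Function.extend (fun l => F.block (P.idem (Sum.inr (l, true)))) m fun _ => 1, ?_, ?_, ?_⟩
  · intro W
    simp only [hU, Finset.mem_image, Finset.mem_univ, true_and]
    constructor
    · rintro ⟨i | ⟨l, b⟩, rfl⟩
      · exact Or.inl ⟨i, rfl⟩
      · cases b
        · exact Or.inr (Or.inr ⟨l, by rw [htau, hκ']⟩)
        · exact Or.inr (Or.inl ⟨l, rfl⟩)
    · rintro (⟨i, rfl⟩ | ⟨l, rfl⟩ | ⟨l, h⟩)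
      · exact ⟨_, rfl⟩
      · exact ⟨_, rfl⟩
      · refine ⟨Sum.inr (l, false), ?_⟩
        change F.block _ = _
        rw [← hκ, ← htau, h, map_tau_map_tau]
  · simp only [Finset.mem_image, Finset.mem_univ, true_and]
    rintro _ ⟨i, rfl⟩
    rw [htau, hι]
  · simp only [Finset.mem_image, Finset.mem_univ, true_and]
    rintro _ ⟨l, rfl⟩ ⟨l', h⟩
    rw [htau, hκ] at h
    simpa using hinj h
  · simp only [Finset.mem_image, Finset.mem_univ, true_and]
    rintro _ ⟨i, rfl⟩
    rw [hK.extend_apply]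
    exact hk i
  · simp only [Finset.mem_image, Finset.mem_univ, true_and]
    rintro _ ⟨l, rfl⟩
    rw [hL.extend_apply]
    exact hm l
  · rw [Finset.sum_image hK.injOn, Finset.sum_image hL.injOn]
    simp only [hK.extend_apply, hL.extend_apply]

/-! ### Primitive idempotents of a product of algebras. -/

section Idempotents

variable {ι κ : Type} [DecidableEq ι] [DecidableEq κ]
  {A : ι → Type} [∀ i, CommRing (A i)] {C : κ → Type} [∀ l, CommRing (C l)]

/-- The primitive idempotents of the product. -/
def totalIdem : ι ⊕ κ × Bool → (∀ i, A i) × ∀ l, C l × C l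
  | Sum.inl i => (Pi.single i 1, 0)
  | Sum.inr (l, true) => (0, Pi.single l (1, 0))
  | Sum.inr (l, false) => (0, Pi.single l (0, 1))

/-- The permutation of the primitive idempotents by the conjugation. -/
def totalPerm : ι ⊕ κ × Bool → ι ⊕ κ × Bool
  | Sum.inl i => Sum.inl i
  | Sum.inr (l, b) => Sum.inr (l, !b)

theorem single_mul_of_ne {α : Type*} [DecidableEq α] {R : α → Type*} [∀ i, CommRing (R i)]
    {i j : α} (h : i ≠ j) (a : R i) (b : R j) : (Pi.single i a * Pi.single j b : ∀ i, R i) = 0 := by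
  funext k
  rw [Pi.mul_apply, Pi.zero_apply]
  by_cases hk : k = i
  · subst hk
    rw [Pi.single_eq_of_ne h, mul_zero]
  · rw [Pi.single_eq_of_ne hk, zero_mul]

theorem totalIdem_complete [Fintype ι] [Fintype κ] :
    CompleteOrthogonalIdempotents (totalIdem : ι ⊕ κ × Bool → (∀ i, A i) × ∀ l, C l × C l) := by
  rw [CompleteOrthogonalIdempotents.iff_ortho_complete]
  constructor
  · rintro (i | ⟨l, b⟩) (j | ⟨l', b'⟩) hne
    · have h : i ≠ j := fun h => hne (h ▸ rfl)
      simp [totalIdem, single_mul_of_ne h]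
    · cases b' <;> simp [totalIdem]
    · cases b <;> simp [totalIdem]
    · by_cases h : l = l'
      · subst h
        cases b <;> cases b' <;> simp [totalIdem, ← Pi.single_mul] at hne ⊢
      · cases b <;> cases b' <;> simp [totalIdem, single_mul_of_ne h]
  · rw [Fintype.sum_sum_type, Fintype.sum_prod_type]
    simp only [Fintype.sum_bool, totalIdem, Prod.mk_add_mk, add_zero, ← Pi.single_add, zero_add]
    ext1
    · rw [Prod.fst_add, Prod.fst_sum, Prod.fst_sum]
      simpa using Finset.univ_sum_single (1 : ∀ i, A i)
    · rw [Prod.snd_add, Prod.snd_sum, Prod.snd_sum]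
      simp only [Finset.sum_const_zero, zero_add]
      exact Finset.univ_sum_single (1 : ∀ l, C l × C l)

end Idempotents

/-! ### The product algebra with prescribed blocks. -/

section Product

variable {ι κ : Type} [Fintype ι] [Fintype κ] [DecidableEq ι] [DecidableEq κ]
  {I J : ι → Type} [∀ i, DecidableEq (I i)] [∀ i, DecidableEq (J i)] [∀ i, Fintype (I i)]
  [∀ i, Fintype (J i)] {I' J' : κ → Type} [∀ l, DecidableEq (I' l)] [∀ l, DecidableEq (J' l)]
  [∀ l, Fintype (I' l)] [∀ l, Fintype (J' l)]
  {A : ι → Type} [∀ i, CommRing (A i)] [∀ i, Algebra ℂ (A i)]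
  {C : κ → Type} [∀ l, CommRing (C l)] [∀ l, Algebra ℂ (C l)]
  (G : ∀ i, SplitFrobenius (I i) (J i) (A i)) (H : ∀ l, SplitFrobenius (I' l) (J' l) (C l))

/-- The product of algebras and of pairs of algebras. -/
noncomputable def total (e : (Σ i, I i) ⊕ (Σ l, I' l ⊕ J' l) ≃ Fin p)
    (f : (Σ i, J i) ⊕ (Σ l, I' l ⊕ J' l) ≃ Fin q) :
    SplitFrobenius (Fin p) (Fin q) ((∀ i, A i) × ∀ l, C l × C l) :=
  ((pi G).prod (pi fun l => (H l).pair)).reindex e f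

variable {e : (Σ i, I i) ⊕ (Σ l, I' l ⊕ J' l) ≃ Fin p}
  {f : (Σ i, J i) ⊕ (Σ l, I' l ⊕ J' l) ≃ Fin q}

theorem total_conj (b : (∀ i, A i) × ∀ l, C l × C l) : (total G H e f).conj b =
    (fun i => (G i).conj (b.1 i), fun l => ((H l).conj (b.2 l).2, (H l).conj (b.2 l).1)) := rfl

theorem total_form_single (i : ι) (a : A i) :
    (total G H e f).form (Pi.single i a, 0) = (G i).form a := by
  have h : (total G H e f).form (Pi.single i a, 0) =
      (∑ i, (G i).form.comp (LinearMap.proj i)) (Pi.single i a) +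
        (pi fun l => (H l).pair).form 0 := rfl
  rw [h, map_zero, add_zero, LinearMap.sum_apply, Finset.sum_eq_single i]
  · simp
  · intro k _ hk
    simp [Pi.single_eq_of_ne hk]
  · simp

/-- The blocks of the product. -/
noncomputable def totalBlocks (hA : ∀ i, IsScalarModNil (A i)) (hC : ∀ l, IsScalarModNil (C l))
    (hA0 : ∀ i, (1 : A i) ≠ 0) (hC0 : ∀ l, (1 : C l) ≠ 0) :
    (total G H e f).Blocks (ι ⊕ κ × Bool) where
  idem := totalIdem
  perm := totalPerm
  complete := totalIdem_complete
  ne_zero := by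
    rintro (i | ⟨l, b⟩)
    · simp [totalIdem, hA0]
    · cases b <;> simp [totalIdem, hC0]
  conj_idem := by
    rintro (i | ⟨l, b⟩)
    · rw [total_conj]
      ext1
      · funext j
        by_cases h : j = i
        · subst h
          simp [totalIdem, totalPerm]
        · simp [totalIdem, totalPerm, h]
      · simp only [totalIdem, totalPerm, Prod.snd_zero, Prod.fst_zero, Pi.zero_apply, map_zero]
        rfl
    · rw [total_conj]
      cases b <;> ext1
      · simp [totalIdem, totalPerm, ← Pi.zero_def]
      · funext j
        by_cases h : j = l
        · subst h
          simp [totalIdem, totalPerm]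
        · simp [totalIdem, totalPerm, h]
      · simp [totalIdem, totalPerm, ← Pi.zero_def]
      · funext j
        by_cases h : j = l
        · subst h
          simp [totalIdem, totalPerm]
        · simp [totalIdem, totalPerm, h]
  nil := by
    -- The exponent `n + 1` is positive, as the vanishing components away from `i` require. For the
    -- factors `C l × C l` one more increment serves the vanishing entry of the pair.
    have key : ∀ {α : Type} [DecidableEq α] {R : α → Type} [∀ i, CommRing (R i)] (i : α)
        (x : ∀ i, R i) (n : ℕ) (a : R i), (x i * a) ^ n = 0 →
        (x * Pi.single i a) ^ (n + 1) = 0 := by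
      intro α _ R _ i x n a h
      funext j
      rw [Pi.pow_apply, Pi.mul_apply]
      by_cases hj : j = i
      · subst hj
        rw [Pi.single_eq_same, pow_succ, h, zero_mul, Pi.zero_apply]
      · rw [Pi.single_eq_of_ne hj, mul_zero, zero_pow (Nat.succ_ne_zero n), Pi.zero_apply]
    rintro b (i | ⟨l, c⟩)
    · obtain ⟨c, n, hn⟩ := hA i (b.1 i)
      refine ⟨c, n + 1, ?_⟩
      ext1
      · exact key i (b.1 - algebraMap ℂ (∀ i, A i) c) n 1 (by rw [mul_one]; exact hn)
      · simp [totalIdem]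
    · cases c
      · obtain ⟨c, n, hn⟩ := hC l (b.2 l).2
        refine ⟨c, n + 1 + 1, ?_⟩
        ext1
        · simp [totalIdem]
        · refine key l (b.2 - algebraMap ℂ (∀ l, C l × C l) c) (n + 1) (0, 1) ?_
          ext1
          · simp
          · simp [pow_succ, hn]
      · obtain ⟨c, n, hn⟩ := hC l (b.2 l).1
        refine ⟨c, n + 1 + 1, ?_⟩
        ext1
        · simp [totalIdem]
        · refine key l (b.2 - algebraMap ℂ (∀ l, C l × C l) c) (n + 1) (1, 0) ?_
          ext1
          · simp [pow_succ, hn]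
          · simp

/-- The map `g` parametrizes the ideal cut out by `ε`, which is the block up to `F.coord`. -/
theorem finrank_block {B : Type} [CommRing B] [Algebra ℂ B] (F : SplitFrobenius (Fin p) (Fin q) B)
    {V : Type} [AddCommGroup V] [Module ℂ V] {ε : B} (g : V →ₗ[ℂ] B) (hg : Function.Injective g)
    (hr : ∀ b, ε * b = b ↔ ∃ x, g x = b) : Module.finrank ℂ (F.block ε) = Module.finrank ℂ V := by
  have h : F.block ε = LinearMap.range (F.coord.symm.toLinearMap ∘ₗ g) := by
    ext z
    rw [mem_block, hr]
    simp only [LinearMap.mem_range, LinearMap.comp_apply, LinearEquiv.coe_coe,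
      LinearEquiv.symm_apply_eq]
  have hinj : Function.Injective (F.coord.symm.toLinearMap ∘ₗ g) := F.coord.symm.injective.comp hg
  rw [h, LinearMap.finrank_range_of_inj hinj]

theorem finrank_block_inl (i : ι) :
    Module.finrank ℂ ((total G H e f).block (totalIdem (Sum.inl i))) =
      Module.finrank ℂ (A i) := by
  refine finrank_block _ (LinearMap.inl ℂ _ _ ∘ₗ LinearMap.single ℂ A i)
    (LinearMap.inl_injective.comp (Pi.single_injective i)) fun b => ?_
  constructor
  · intro h
    refine ⟨b.1 i, ?_⟩
    rw [← h]
    ext1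
    · funext j
      by_cases hj : j = i
      · subst hj
        simp [totalIdem]
      · simp [totalIdem, hj]
    · simp [totalIdem]
  · rintro ⟨a, rfl⟩
    simp [totalIdem, ← Pi.single_mul]

theorem finrank_block_inr (l : κ) :
    Module.finrank ℂ ((total G H e f).block (totalIdem (Sum.inr (l, true)))) =
      Module.finrank ℂ (C l) := by
  refine finrank_block _
    (LinearMap.inr ℂ _ _ ∘ₗ LinearMap.single ℂ (fun l => C l × C l) l ∘ₗ LinearMap.inl ℂ _ _)
    (LinearMap.inr_injective.comp ((Pi.single_injective l).comp LinearMap.inl_injective))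
    fun b => ?_
  constructor
  · intro h
    refine ⟨(b.2 l).1, ?_⟩
    rw [← h]
    ext1
    · simp [totalIdem]
    · funext j
      by_cases hj : j = l
      · subst hj
        ext1 <;> simp [totalIdem]
      · simp [totalIdem, hj]
  · rintro ⟨a, rfl⟩
    simp [totalIdem, ← Pi.single_mul]

end Product

theorem hasType_block_inl {ι κ : Type} [Fintype ι] [Fintype κ] [DecidableEq ι] [DecidableEq κ]
    {s t : ι → ℕ} {I' J' : κ → Type} [∀ l, DecidableEq (I' l)]
    [∀ l, DecidableEq (J' l)] [∀ l, Fintype (I' l)] [∀ l, Fintype (J' l)]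
    {A : ι → Type} [∀ i, CommRing (A i)] [∀ i, Algebra ℂ (A i)]
    {C : κ → Type} [∀ l, CommRing (C l)] [∀ l, Algebra ℂ (C l)]
    (G : ∀ i, SplitFrobenius (Fin (s i)) (Fin (t i)) (A i))
    (H : ∀ l, SplitFrobenius (I' l) (J' l) (C l))
    (e : (Σ i, Fin (s i)) ⊕ (Σ l, I' l ⊕ J' l) ≃ Fin p)
    (f : (Σ i, Fin (t i)) ⊕ (Σ l, I' l ⊕ J' l) ≃ Fin q) (i : ι) :
    HasType ((total G H e f).block (totalIdem (Sum.inl i))) (s i) (t i) := by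
  refine HasType.of_family
    (fun j => (total G H e f).coord.symm (Pi.single i ((G i).basis j), 0)) (fun j => ?_)
    (fun j k => ?_) ?_
  · rw [mem_block, LinearEquiv.apply_symm_apply]
    simp [totalIdem, ← Pi.single_mul]
  · have h : (total G H e f).conj (Pi.single i ((G i).basis k), 0) =
        (Pi.single i ((G i).basis k), 0) := by
      rw [total_conj]
      ext1
      · funext a
        by_cases ha : a = i
        · subst ha
          simp [(G a).conj_basis]
        · simp [ha]
      · simp only [Pi.zero_apply, Prod.fst_zero, Prod.snd_zero, map_zero]
        rfl
    rw [herm_eq (total G H e f), LinearEquiv.apply_symm_apply, LinearEquiv.apply_symm_apply, h,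
      Prod.mk_mul_mk, ← Pi.single_mul, mul_zero, total_form_single, (G i).form_basis,
      signMat_apply]
  · rw [finrank_block_inl, (G i).finrank_eq, Fintype.card_fin, Fintype.card_fin]

end SplitFrobenius

theorem nonempty_of_KSet (k : KSet) : Nonempty (Fin k.1.1 ⊕ Fin k.1.2) := by
  obtain ⟨⟨s, t⟩, h⟩ := k
  refine Fintype.card_pos_iff.1 ?_
  rw [Fintype.card_sum, Fintype.card_fin, Fintype.card_fin]
  by_contra h0
  have h1 : s = 0 := by dsimp only at h0; omega
  have h2 : t = 0 := by dsimp only at h0; omega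
  simp [h1, h2] at h

theorem exists_isQualifyingMASA (hn : 0 < p + q) {D : DMonoid} (hD : D ∈ DSet p q) :
    ∃ v : LieSubalgebra ℝ (Mat p q), IsQualifyingMASA p q v ∧ IsDInvariant v D := by
  classical
  obtain ⟨ι, κ, _, _, k, m, rfl⟩ := exists_eq_sum_single D
  have hpq := mem_DSet_unique hD (mem_DSet_add
    (mem_DSet_sum Finset.univ fun i => (Sum.inl (k i) : JSet))
    (mem_DSet_sum Finset.univ fun l => (Sum.inr (m l) : JSet)))
  simp only [JSet.weight] at hpq
  choose A _ _ hA hG using fun i => exists_splitFrobenius (k i)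
  -- The doubled factor has type `(m l, m l)` whatever the signs of the algebra being doubled, so
  -- only its dimension matters; the type `(1, m l - 1)` always lies in `KSet`.
  obtain ⟨k', hk'⟩ : ∃ k' : κ → KSet, ∀ l, (k' l).1.1 + (k' l).1.2 = m l := by
    refine ⟨fun l => ⟨(1, (m l : ℕ) - 1), fun h => ?_⟩, fun l => ?_⟩ <;>
      have := (m l).pos <;> dsimp only at * <;> omega
  choose C _ _ hC hH using fun l => exists_splitFrobenius (k' l)
  let G := fun i => (hG i).some
  let H := fun l => (hH l).some
  have e : (Σ i, Fin (k i).1.1) ⊕ (Σ l, Fin (k' l).1.1 ⊕ Fin (k' l).1.2) ≃ Fin p :=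
    Fintype.equivFinOfCardEq (by simp [hk', hpq.1])
  have f : (Σ i, Fin (k i).1.2) ⊕ (Σ l, Fin (k' l).1.1 ⊕ Fin (k' l).1.2) ≃ Fin q :=
    Fintype.equivFinOfCardEq (by simp [hk', hpq.2])
  have hA0 : ∀ i, (1 : A i) ≠ 0 := fun i =>
    have := nonempty_of_KSet (k i)
    (G i).one_ne_zero
  have hC0 : ∀ l, (1 : C l) ≠ 0 := fun l =>
    have := nonempty_of_KSet (k' l)
    (H l).one_ne_zero
  refine ⟨(SplitFrobenius.total G H e f).masa,
    (SplitFrobenius.total G H e f).isQualifyingMASA_masa hn, 1, one_mem_groupSU, ?_⟩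
  rw [map_Ad_one]
  refine ⟨(SplitFrobenius.total G H e f).masa_subset_suMinus,
    (SplitFrobenius.totalBlocks G H hA hC hA0 hC0).isDSum_masa hn (fun _ => rfl) (fun _ => rfl)
      (fun i => SplitFrobenius.hasType_block_inl G H e f i) fun l => ?_⟩
  exact (SplitFrobenius.finrank_block_inr G H l).trans (by
    rw [(H l).finrank_eq, Fintype.card_fin, Fintype.card_fin, hk'])

end SUpq

theorem mainTheorem4 (p q : ℕ) (hp : 1 ≤ p) (hq : 1 ≤ q) (hpq : 3 ≤ p + q) :
    (∀ v : LieSubalgebra ℝ (SUpq.Mat p q), SUpq.IsQualifyingMASA p q v →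
      ∃! D : SUpq.DMonoid, SUpq.IsDInvariant v D) ∧
    (∀ D : SUpq.DMonoid,
      (∃ v : LieSubalgebra ℝ (SUpq.Mat p q),
        SUpq.IsQualifyingMASA p q v ∧ SUpq.IsDInvariant v D) ↔ D ∈ SUpq.DSet p q) ∧
    Set.Finite {c : Set (LieSubalgebra ℝ (SUpq.Mat p q)) |
      ∃ v : LieSubalgebra ℝ (SUpq.Mat p q), SUpq.IsQualifyingMASA p q v ∧
        c = SUpq.conjClassSU (SUpq.centralizerSU p q (SUpq.toralPart v))} :=
  ⟨fun _ hv => SUpq.existsUnique_isDInvariant (by omega) hv,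
    fun _ => ⟨fun ⟨_, hv, h⟩ => SUpq.IsDInvariant.mem_DSet hv.1 h,
      SUpq.exists_isQualifyingMASA (by omega)⟩,
    SUpq.finite_conjClasses (by omega)⟩
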